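/- **Setting.** Let $C$ be a Riemann surface (Hausdorff, second countable) with a spin structure $T^*_{C,-}$, i.e. a holomorphic line bundle with an isomorphism $T^*_{C,-}\otimes T^*_{C,-}\cong\omega_C$. Choose holomorphic charts $x_\alpha:U_\alpha\to\mathbb C$ covering $C$, with transition functions $x_\beta=f_{\alpha\beta}(x_\alpha)$, and frames $\theta_\alpha$ of $T^*_{C,-}$ over $U_\alpha$ with $\theta_\alpha\otimes\theta_\alpha=dx_\alpha$ and $\theta_\beta=\zeta_{\alpha\beta}\theta_\alpha$, so that $\zeta_{\alpha\beta}^2=f_{\alpha\beta}'$. The super Riemann surface $S(C,T^*_{C,-})$ has the local coordinates $(x|\theta)$, the transition maps $\rho_{\alpha\beta}:\ y=f_{\alpha\beta}(x),\ \eta=\theta\,\zeta_{\alpha\beta}(x)$, and the superconformal structure generated by $D=D_{(x|\theta)}=\partial_\theta+\theta\,\partial_x$. Let $\mathbb A^{0|n}_{\mathbb C}=\mathrm{Spec}\,\mathbb C[\xi_1,\dots,\xi_n]$ with odd parameters $\xi_i$. A map $u$ over $\mathbb A^{0|n}_{\mathbb C}$ between domains of $\mathbb C^{1|1}$ is superconformal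 if $u_*D_{(x|\theta)}=h\,D_{(y|\eta)}$ with $h$ nowhere vanishing. A deformation $\mathcal X\to\mathbb A^{0|n}_{\mathbb C}$ of $S(C,T^*_{C,-})$ is given by holomorphic superconformal transition maps $\vartheta_{\alpha\beta}$ over $\mathbb A^{0|n}_{\mathbb C}$ that satisfy the cocycle conditions and reduce to $\rho_{\alpha\beta}$ modulo $(\xi_1,\dots,\xi_n)$. Smooth functions are functions of $(x,\widetilde x|\theta,\xi)$, where $\widetilde x$ is the complex conjugate of $x$ on the reduced space and odd variables are not conjugated; maps over $\mathbb A^{0|n}_{\mathbb C}$ pull back the conjugate coordinate to the conjugate of the reduced map. The Dolbeault operator in local coordinates is $\widetilde\partial=d\widetilde x\,\partial/\partial\widetilde x$. An identification of the smooth supermanifold $\mathcal X^\infty$ underlying $\mathcal X$ with $S(C,T^*_{\mathcal X,-})^\infty=S(C,T^*_{C,-})^\infty\times\mathbb A^{0|n}_{\mathbb C}$ is a diffeomorphism $\Phi:S(C,T^*_{C,-})^\infty\times\mathbb A^{0|n}_{\mathbb C}\to\mathcal X^\infty$ over $\mathbb A^{0|n}_{\mathbb C}$ which is the identity modulo $(\xi_1,\dots,\xi_n)$;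 in charts it is given by $x_\xi=u_\alpha^+(x,\widetilde x|\theta,\xi)$, $\theta_\xi=u_\alpha^-(x,\widetilde x|\theta,\xi)$, with $u_\beta\circ\rho_{\alpha\beta}=\vartheta_{\alpha\beta}\circ u_\alpha$. It is called superconformal if all $u_\alpha$ are superconformal. Write $\widetilde\partial_\xi=\Phi^*\circ\widetilde\partial_{\mathcal X}\circ(\Phi^*)^{-1}$ for the complex structure of $\mathcal X$ transported by $\Phi$. A smooth vector $(0,1)$-form $\varphi$ on $S(C,T^*_{C,-})^\infty\times\mathbb A^{0|n}_{\mathbb C}$ is locally of the form $d\widetilde x\,(a\,\partial_x+b\,\partial_\theta)$ with smooth functions $a,b$ of $(x,\widetilde x|\theta,\xi)$, the local expressions agreeing on overlaps; it is even if $a$ is even and $b$ is odd, and an even form is superconformal if locally $[\varphi,D_{(x|\theta)}]=c\,D_{(x|\theta)}$ for some smooth $c$ (a function times $d\widetilde x$). **Theorem.** Let $\mathcal X\to\mathbb A^{0|n}_{\mathbb C}$ be a deformation of $S(C,T^*_{C,-})$. Then there exists a superconformal identification $\Phi$ of $S(C,T^*_{C,-})^\infty\times\mathbb A^{0|n}_{\mathbb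 C}$ with $\mathcal X^\infty$. Moreover, for every identification $\Phi$ there exists a smooth, even vector $(0,1)$-form $\varphi(\xi)$ on $S(C,T^*_{C,-})^\infty\times\mathbb A^{0|n}_{\mathbb C}$ such that $$\varphi(\xi)\equiv0 \mod (\xi_1,\dots,\xi_n)\qquad\text{and}\qquad \widetilde\partial_\xi=\widetilde\partial-\varphi(\xi),$$ and $\varphi(\xi)$ is superconformal whenever $\Phi$ is superconformal. -/

import Mathlib

open scoped Manifold ContDiff

noncomputable section

/-! ## The Grassmann algebra -/

/-- The complex Grassmann algebra on `m` anticommuting generators `e_0, …, e_{m-1}`; an element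
`∑_I a_I e_I` (with `e_I` the product of the `e_i`, `i ∈ I`, in increasing order) is stored as the
family of its coefficients `a_I`. -/
def Grassmann (m : ℕ) : Type := Finset (Fin m) → ℂ

namespace Grassmann

variable {m : ℕ}

instance : NormedAddCommGroup (Grassmann m) :=
  inferInstanceAs (NormedAddCommGroup (Finset (Fin m) → ℂ))

instance : NormedSpace ℂ (Grassmann m) :=
  inferInstanceAs (NormedSpace ℂ (Finset (Fin m) → ℂ))

instance : NormedSpace ℝ (Grassmann m) :=
  inferInstanceAs (NormedSpace ℝ (Finset (Fin m) → ℂ))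

instance : IsScalarTower ℝ ℂ (Grassmann m) :=
  inferInstanceAs (IsScalarTower ℝ ℂ (Finset (Fin m) → ℂ))

@[ext] theorem ext {a b : Grassmann m} (h : ∀ I, a I = b I) : a = b := funext h

/-- The sign in `e_I * e_J = sgn I J • e_{I ∪ J}` for disjoint `I`, `J`: one factor `-1` for every
pair `(i, j) ∈ I × J` with `j < i`. -/
def sgn (I J : Finset (Fin m)) : ℂ := ∏ i ∈ I, ∏ j ∈ J, if j < i then -1 else 1

theorem sgn_union_left {I J K : Finset (Fin m)} (h : Disjoint I J) :
    sgn (I ∪ J) K = sgn I K * sgn J K := Finset.prod_union h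

theorem sgn_union_right {I J K : Finset (Fin m)} (h : Disjoint J K) :
    sgn I (J ∪ K) = sgn I J * sgn I K := by
  simp only [sgn, Finset.prod_union h, Finset.prod_mul_distrib]

instance : One (Grassmann m) := ⟨fun I => if I = ∅ then 1 else 0⟩

instance : Mul (Grassmann m) :=
  ⟨fun a b K => ∑ I ∈ K.powerset, sgn I (K \ I) * a I * b (K \ I)⟩

theorem one_apply (I : Finset (Fin m)) : (1 : Grassmann m) I = if I = ∅ then 1 else 0 := rfl

theorem mul_apply (a b : Grassmann m) (K : Finset (Fin m)) :
    (a * b) K = ∑ I ∈ K.powerset, sgn I (K \ I) * a I * b (K \ I) := rfl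

theorem add_apply (a b : Grassmann m) (K : Finset (Fin m)) : (a + b) K = a K + b K := rfl

theorem zero_apply (K : Finset (Fin m)) : (0 : Grassmann m) K = 0 := rfl

theorem smul_apply (c : ℂ) (a : Grassmann m) (K : Finset (Fin m)) : (c • a) K = c * a K := rfl

protected theorem one_mul (a : Grassmann m) : 1 * a = a := by
  ext K
  rw [mul_apply, Finset.sum_eq_single ∅]
  · simp [one_apply, sgn]
  · intro I _ hI
    simp [one_apply, hI]
  · simp

protected theorem mul_one (a : Grassmann m) : a * 1 = a := by
  ext K
  rw [mul_apply, Finset.sum_eq_single K]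
  · simp [one_apply, sgn]
  · intro I hI hne
    have : K \ I ≠ ∅ := by
      intro h
      exact hne (Finset.Subset.antisymm (Finset.mem_powerset.1 hI)
        (Finset.sdiff_eq_empty_iff_subset.1 h))
    simp [one_apply, this]
  · simp

protected theorem mul_assoc (a b c : Grassmann m) : a * b * c = a * (b * c) := by
  ext K
  simp only [mul_apply, Finset.mul_sum, Finset.sum_mul]
  rw [Finset.sum_sigma', Finset.sum_sigma']
  refine Finset.sum_bij' (fun p _ => ⟨p.2, p.1 \ p.2⟩) (fun p _ => ⟨p.1 ∪ p.2, p.1⟩) ?_ ?_ ?_ ?_ ?_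
  · rintro ⟨L, I⟩ h
    simp only [Finset.mem_sigma, Finset.mem_powerset] at h ⊢
    exact ⟨h.2.trans h.1, Finset.sdiff_subset_sdiff h.1 le_rfl⟩
  · rintro ⟨I, J⟩ h
    simp only [Finset.mem_sigma, Finset.mem_powerset] at h ⊢
    exact ⟨Finset.union_subset h.1 (h.2.trans Finset.sdiff_subset), Finset.subset_union_left⟩
  · rintro ⟨L, I⟩ h
    simp only [Finset.mem_sigma, Finset.mem_powerset] at h
    simp [Finset.union_sdiff_of_subset h.2]
  · rintro ⟨I, J⟩ h
    simp only [Finset.mem_sigma, Finset.mem_powerset] at h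
    have hd : Disjoint I J := (Finset.disjoint_sdiff).mono_right h.2
    simp [Finset.union_sdiff_cancel_left hd]
  · rintro ⟨L, I⟩ h
    simp only [Finset.mem_sigma, Finset.mem_powerset] at h
    obtain ⟨hL, hI⟩ := h
    dsimp only
    have e1 : (K \ I) \ (L \ I) = K \ L := by
      ext x
      simp only [Finset.mem_sdiff]
      constructor
      · rintro ⟨⟨h1, h2⟩, h3⟩
        exact ⟨h1, fun hx => h3 ⟨hx, h2⟩⟩
      · rintro ⟨h1, h2⟩
        exact ⟨⟨h1, fun hx => h2 (hI hx)⟩, fun hx => h2 hx.1⟩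
    have e2 : K \ I = (L \ I) ∪ (K \ L) := by
      ext x
      simp only [Finset.mem_sdiff, Finset.mem_union]
      constructor
      · rintro ⟨h1, h2⟩
        by_cases hx : x ∈ L
        · exact Or.inl ⟨hx, h2⟩
        · exact Or.inr ⟨h1, hx⟩
      · rintro (⟨h1, h2⟩ | ⟨h1, h2⟩)
        · exact ⟨hL h1, h2⟩
        · exact ⟨h1, fun hx => h2 (hI hx)⟩
    have d1 : Disjoint (L \ I) (K \ L) :=
      (Finset.disjoint_sdiff).mono_left Finset.sdiff_subset
    have s1 : sgn L (K \ L) = sgn I (K \ L) * sgn (L \ I) (K \ L) := by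
      rw [← sgn_union_left Finset.disjoint_sdiff, Finset.union_sdiff_of_subset hI]
    have s2 : sgn I (K \ I) = sgn I (L \ I) * sgn I (K \ L) := by
      rw [e2, sgn_union_right d1]
    rw [e1, s1, s2]
    ring

instance : Ring (Grassmann m) :=
  { (inferInstance : AddCommGroup (Grassmann m)) with
    mul_assoc := Grassmann.mul_assoc
    one_mul := Grassmann.one_mul
    mul_one := Grassmann.mul_one
    zero_mul := fun a => by ext K; simp [mul_apply, zero_apply]
    mul_zero := fun a => by ext K; simp [mul_apply, zero_apply]
    left_distrib := fun a b c => by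
      ext K; simp only [mul_apply, add_apply, mul_add, Finset.sum_add_distrib]
    right_distrib := fun a b c => by
      ext K; simp only [mul_apply, add_apply, mul_add, add_mul, Finset.sum_add_distrib] }

instance : Algebra ℂ (Grassmann m) :=
  Algebra.ofModule
    (fun c a b => by
      ext K
      simp only [mul_apply, smul_apply, Finset.mul_sum]
      exact Finset.sum_congr rfl fun I _ => by ring)
    (fun c a b => by
      ext K
      simp only [mul_apply, smul_apply, Finset.mul_sum]
      exact Finset.sum_congr rfl fun I _ => by ring)

/-- The generator `e_i`. -/
def gen (i : Fin m) : Grassmann m := fun I => if I = {i} then 1 else 0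

/-- The body (degree zero part) of an element. -/
def body (a : Grassmann m) : ℂ := a ∅

/-- Even elements: only products of an even number of generators occur. -/
def IsEven (a : Grassmann m) : Prop := ∀ I, Odd I.card → a I = 0

/-- Odd elements: only products of an odd number of generators occur. -/
def IsOdd (a : Grassmann m) : Prop := ∀ I, Even I.card → a I = 0

end Grassmann

/-! ## Superfunctions on domains of `ℂ^{1|1} × 𝔸^{0|n}`

The coordinates are `(x, x̃ | θ, ξ_1, …, ξ_n)`. The Grassmann algebra has `n + 1` generators; the
generator `0` is `θ` and the generator `i + 1` is the `i`-th parameter `ξ`. Odd variables are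
not conjugated. A superfunction is a function of `x ∈ ℂ` with values in the Grassmann algebra,
considered on some open set. -/

/-- Superfunctions of `(x, x̃ | θ, ξ_1, …, ξ_n)`. -/
abbrev SuperFun (n : ℕ) : Type := ℂ → Grassmann (n + 1)

namespace SuperFun

variable {n : ℕ}

/-- The odd coordinate `θ`. -/
def theta (n : ℕ) : Grassmann (n + 1) := Grassmann.gen 0

/-- The parameter `ξ_i`. -/
def xi {n : ℕ} (i : Fin n) : Grassmann (n + 1) := Grassmann.gen i.succ

/-- Congruence modulo the (two-sided) ideal generated by `ξ_1, …, ξ_n`. -/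
def ModXi (a b : Grassmann (n + 1)) : Prop := a - b ∈ TwoSidedIdeal.span (Set.range (xi (n := n)))

/-- Smooth superfunctions on a set. -/
def SmoothOn (F : SuperFun n) (U : Set ℂ) : Prop := ContDiffOn ℝ ∞ F U

/-- `∂F/∂x`. -/
def dx (F : SuperFun n) : SuperFun n := fun z =>
  (1 / 2 : ℂ) • (fderiv ℝ F z 1 - Complex.I • fderiv ℝ F z Complex.I)

/-- `∂F/∂x̃`. -/
def dxt (F : SuperFun n) : SuperFun n := fun z =>
  (1 / 2 : ℂ) • (fderiv ℝ F z 1 + Complex.I • fderiv ℝ F z Complex.I)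

/-- The part `A` in the decomposition `F = A + θ B` with `A`, `B` free of `θ`. -/
def thetaFree (F : SuperFun n) : SuperFun n := fun z I => if 0 ∈ I then 0 else F z I

/-- The odd (left) derivation `∂F/∂θ`: the part `B` in the decomposition `F = A + θ B` with `A`,
`B` free of `θ`. -/
def dtheta (F : SuperFun n) : SuperFun n := fun z I => if 0 ∈ I then 0 else F z (insert 0 I)

/-- The superconformal generator `D = ∂/∂θ + θ ∂/∂x`. -/
def D (F : SuperFun n) : SuperFun n := fun z => dtheta F z + theta n * dx F z

end SuperFun

open SuperFun

/-! ## Maps between superdomains -/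

/-- The data of a map over `𝔸^{0|n}` of superdomains, `y = even (x, x̃ | θ, ξ)`,
`η = odd (x, x̃ | θ, ξ)` (and `ξ_i ↦ ξ_i`). The conjugate coordinate `ỹ` is pulled back to the
complex conjugate of the body of `y`. -/
structure SuperMap (n : ℕ) where
  even : SuperFun n
  odd : SuperFun n

namespace SuperMap

variable {n : ℕ}

/-- The map of reduced spaces. -/
def base (u : SuperMap n) : ℂ → ℂ := fun x => (u.even x).body

/-- The pullback `u^* F` of a superfunction `F = A + θ B`. It is obtained by the substitution
`y = y₀ + N`, `η = odd`, where `y₀` is the body of `y` and `N` is nilpotent, and by Taylor's formula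
in the variable `y` (which is a finite sum, because `N ^ (n + 2) = 0`). -/
def pull (u : SuperMap n) (F : SuperFun n) : SuperFun n := fun x =>
  ∑ k ∈ Finset.range (n + 2), ((k.factorial : ℂ)⁻¹) •
    ((u.even x - algebraMap ℂ (Grassmann (n + 1)) (u.base x)) ^ k *
      ((dx^[k] (thetaFree F)) (u.base x) + u.odd x * (dx^[k] (dtheta F)) (u.base x)))

/-- `u` is a smooth map from the superdomain over `U` to the superdomain over `V`. -/
structure IsSmooth (u : SuperMap n) (U V : Set ℂ) : Prop where
  smooth_even : SmoothOn u.even U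
  smooth_odd : SmoothOn u.odd U
  isEven : ∀ x ∈ U, (u.even x).IsEven
  isOdd : ∀ x ∈ U, (u.odd x).IsOdd
  mapsTo : Set.MapsTo u.base U V

/-- `u` is a holomorphic map from the superdomain over `U` to the superdomain over `V`. -/
structure IsHolomorphic (u : SuperMap n) (U V : Set ℂ) : Prop extends u.IsSmooth U V where
  holomorphic_even : DifferentiableOn ℂ u.even U
  holomorphic_odd : DifferentiableOn ℂ u.odd U

/-- `u` is superconformal: `u_* D = h D` with a smooth nowhere vanishing function `h`, that is
`D (u^* F) = h u^* (D F)` for every function `F` on the target. -/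
def IsSuperconformal (u : SuperMap n) (U V : Set ℂ) : Prop :=
  ∃ h : SuperFun n, SmoothOn h U ∧ (∀ x ∈ U, (h x).body ≠ 0) ∧
    ∀ F : SuperFun n, SmoothOn F V → Set.EqOn (D (u.pull F)) (fun x => h x * u.pull (D F) x) U

/-- `u` and `v` restrict to the same map on the central fibre `ξ = 0`, over `U`. -/
def EqModXi (u v : SuperMap n) (U : Set ℂ) : Prop :=
  ∀ x ∈ U, ModXi (u.even x) (v.even x) ∧ ModXi (u.odd x) (v.odd x)

/-- `w = v ∘ u` over `U`. -/
def IsComp (w v u : SuperMap n) (U : Set ℂ) : Prop :=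
  Set.EqOn w.even (u.pull v.even) U ∧ Set.EqOn w.odd (u.pull v.odd) U

/-- The identity map, `y = x`, `η = θ`. -/
def ident (n : ℕ) : SuperMap n where
  even := fun x => algebraMap ℂ _ x
  odd := fun _ => theta n

end SuperMap

/-! ## Super Riemann surfaces and their deformations -/

/-- A Riemann surface `C` with a spin structure `T^*_{C,-}`, presented by an atlas. The holomorphic
charts `x_α = chart α` cover `C`; the line bundle `T^*_{C,-}` has a frame `θ_α` over the domain of
the chart `α`, with `θ_α ⊗ θ_α` corresponding to `d x_α` under the isomorphism of
`T^*_{C,-} ⊗ T^*_{C,-}` with the canonical bundle, and `θ_β = zeta α β · θ_α` on overlaps, where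
`zeta α β` is written in the coordinate `x_α`. Equivalently, this is a superconformal atlas of the
super Riemann surface `S(C, T^*_{C,-})`, with transition functions
`x_β = f_{αβ}(x_α)`, `θ_β = θ_α ζ_{αβ}(x_α)`. -/
structure SuperRiemannSurface (ι : Type*) (C : Type*) [TopologicalSpace C] [ChartedSpace ℂ C] where
  chart : ι → OpenPartialHomeomorph C ℂ
  chart_mem : ∀ α, chart α ∈ IsManifold.maximalAtlas 𝓘(ℂ) ω C
  cover : ∀ p : C, ∃ α, p ∈ (chart α).source
  zeta : ι → ι → ℂ → ℂ
  zeta_holomorphic : ∀ α β, DifferentiableOn ℂ (zeta α β) ((chart α).symm.trans (chart β)).source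
  zeta_sq : ∀ α β, ∀ x ∈ ((chart α).symm.trans (chart β)).source,
    zeta α β x ^ 2 = deriv ((chart α).symm.trans (chart β)) x
  zeta_cocycle : ∀ α β γ, ∀ x ∈ ((chart α).symm.trans (chart β)).source ∩
      ((chart α).symm.trans (chart γ)).source,
    zeta α γ x = zeta β γ ((chart α).symm.trans (chart β) x) * zeta α β x

namespace SuperRiemannSurface

variable {ι C : Type*} [TopologicalSpace C] [ChartedSpace ℂ C]

/-- The image of the chart `α`. -/
def dom (S : SuperRiemannSurface ι C) (α : ι) : Set ℂ := (S.chart α).target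

/-- The image in the chart `α` of the intersection of the domains of the charts `α` and `β`. -/
def overlap (S : SuperRiemannSurface ι C) (α β : ι) : Set ℂ :=
  ((S.chart α).symm.trans (S.chart β)).source

/-- The transition function `f_{αβ}` of `C`. -/
def trans (S : SuperRiemannSurface ι C) (α β : ι) : ℂ → ℂ :=
  (S.chart α).symm.trans (S.chart β)

/-- The transition map `y = f_{αβ}(x)`, `η = θ ζ_{αβ}(x)` of the product
`S(C, T^*_{C,-}) × 𝔸^{0|n}`. -/
def rho (S : SuperRiemannSurface ι C) (n : ℕ) (α β : ι) : SuperMap n where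
  even := fun x => algebraMap ℂ _ (S.trans α β x)
  odd := fun x => S.zeta α β x • theta n

end SuperRiemannSurface

/-- A deformation `𝒳 → 𝔸^{0|n}` of a super Riemann surface, given by its atlas: for every pair of
charts a holomorphic superconformal transition map `ϑ_{αβ}` over `𝔸^{0|n}` which restricts on the
central fibre to the transition map of the given super Riemann surface; these maps satisfy the
cocycle conditions. -/
structure Deformation {ι C : Type*} [TopologicalSpace C] [ChartedSpace ℂ C]
    (S : SuperRiemannSurface ι C) (n : ℕ) where
  transition : ι → ι → SuperMap n
  holomorphic : ∀ α β, (transition α β).IsHolomorphic (S.overlap α β) (S.overlap β α)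
  superconformal : ∀ α β, (transition α β).IsSuperconformal (S.overlap α β) (S.overlap β α)
  central : ∀ α β, (transition α β).EqModXi (S.rho n α β) (S.overlap α β)
  inverse : ∀ α β, (SuperMap.ident n).IsComp (transition β α) (transition α β) (S.overlap α β)
  cocycle : ∀ α β γ, (transition α γ).IsComp (transition β γ) (transition α β)
    (S.overlap α β ∩ S.overlap α γ)

/-- A diffeomorphism, over `𝔸^{0|n}`, of `S(C, T^*_{C,-})^∞ × 𝔸^{0|n}` with the smooth
supermanifold `𝒳^∞` underlying the deformation `𝒳`, which is the identity on the central fibre. In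
the charts `α` it is given by `x_ξ = u_α^+(x, x̃ | θ, ξ)`, `θ_ξ = u_α^-(x, x̃ | θ, ξ)`, and on
overlaps `u_β ∘ ρ_{αβ} = ϑ_{αβ} ∘ u_α`. (Such a map is invertible since it is the identity modulo
the nilpotent ideal `(ξ_1, …, ξ_n)`.) -/
structure SmoothIdentification {ι C : Type*} [TopologicalSpace C] [ChartedSpace ℂ C]
    {S : SuperRiemannSurface ι C} {n : ℕ} (X : Deformation S n) where
  map : ι → SuperMap n
  smooth : ∀ α, (map α).IsSmooth (S.dom α) (S.dom α)
  central : ∀ α, (map α).EqModXi (SuperMap.ident n) (S.dom α)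
  glue_even : ∀ α β, Set.EqOn ((S.rho n α β).pull (map β).even)
    ((map α).pull (X.transition α β).even) (S.overlap α β)
  glue_odd : ∀ α β, Set.EqOn ((S.rho n α β).pull (map β).odd)
    ((map α).pull (X.transition α β).odd) (S.overlap α β)

namespace SmoothIdentification

variable {ι C : Type*} [TopologicalSpace C] [ChartedSpace ℂ C]
  {S : SuperRiemannSurface ι C} {n : ℕ} {X : Deformation S n}

/-- The diffeomorphism respects the (relative) superconformal structures: in the charts,
`(u_α)_* D_{(x|θ)} = h D_{(x_ξ|θ_ξ)}` with `h` nowhere vanishing. -/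
def IsSuperconformal (Φ : SmoothIdentification X) : Prop :=
  ∀ α, (Φ.map α).IsSuperconformal (S.dom α) (S.dom α)

/-- The complex structure `∂̃_ξ` of `𝒳`, transported along the diffeomorphism `Φ` to
`S(C, T^*_{C,-})^∞ × 𝔸^{0|n}`, is `d x̃ ⊗ P α` in the charts `α`: on functions over open subsets
one has `P ∘ Φ^* = Φ^* ∘ ∂/∂x̃_ξ`, where `d x̃_ξ ∂/∂x̃_ξ` is the Dolbeault operator of `𝒳^∞`. -/
def IsComplexStructure (Φ : SmoothIdentification X) (P : ι → SuperFun n → SuperFun n) : Prop :=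
  ∀ α, ∀ V : Set ℂ, IsOpen V → V ⊆ S.dom α → ∀ F : SuperFun n, SmoothOn F V →
    Set.EqOn (P α ((Φ.map α).pull F)) ((Φ.map α).pull (dxt F)) V

end SmoothIdentification

/-! ## Vector `(0,1)`-forms -/

/-- A smooth vector `(0,1)`-form on `S(C, T^*_{C,-})^∞ × 𝔸^{0|n}`, relative to `𝔸^{0|n}`. In the
chart `α` it is `d x̃ ⊗ (a_α ∂/∂x + b_α ∂/∂θ)`; on overlaps the local expressions are
related by the transition map `ρ_{αβ}`, with `d x̃_β = conj (f_{αβ}') d x̃_α`. -/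
structure VectorForm {ι C : Type*} [TopologicalSpace C] [ChartedSpace ℂ C]
    (S : SuperRiemannSurface ι C) (n : ℕ) where
  a : ι → SuperFun n
  b : ι → SuperFun n
  smooth_a : ∀ α, SmoothOn (a α) (S.dom α)
  smooth_b : ∀ α, SmoothOn (b α) (S.dom α)
  glue : ∀ α β, ∀ F : SuperFun n, SmoothOn F (S.overlap β α) → ∀ x ∈ S.overlap α β,
    a α x * dx ((S.rho n α β).pull F) x + b α x * dtheta ((S.rho n α β).pull F) x =
      (starRingEnd ℂ) (deriv (S.trans α β) x) •
        (S.rho n α β).pull (fun y => a β y * dx F y + b β y * dtheta F y) x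

namespace VectorForm

variable {ι C : Type*} [TopologicalSpace C] [ChartedSpace ℂ C]
  {S : SuperRiemannSurface ι C} {n : ℕ}

/-- The coefficient of `d x̃` of the form, acting as a vector field on the functions in the
chart `α`. -/
def act (φ : VectorForm S n) (α : ι) (F : SuperFun n) : SuperFun n := fun x =>
  φ.a α x * dx F x + φ.b α x * dtheta F x

/-- The form is even (`∂/∂x` and `d x̃` are even, `∂/∂θ` is odd). -/
def IsEven (φ : VectorForm S n) : Prop :=
  ∀ α, ∀ x ∈ S.dom α, (φ.a α x).IsEven ∧ (φ.b α x).IsOdd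

/-- The form vanishes modulo the ideal `(ξ_1, …, ξ_n)`. -/
def VanishesModXi (φ : VectorForm S n) : Prop :=
  ∀ α, ∀ x ∈ S.dom α, ModXi (φ.a α x) 0 ∧ ModXi (φ.b α x) 0

/-- An even form is superconformal if `[φ, D] = c D` in the charts, for smooth `c` (multiplied
by `d x̃`). -/
def IsSuperconformal (φ : VectorForm S n) : Prop :=
  ∀ α, ∃ c : SuperFun n, SmoothOn c (S.dom α) ∧
    ∀ F : SuperFun n, SmoothOn F (S.dom α) → ∀ x ∈ S.dom α,
      φ.act α (D F) x - D (φ.act α F) x = c x * D F x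

end VectorForm

/-- The operator `∂̃ - φ` on `S(C, T^*_{C,-})^∞ × 𝔸^{0|n}` (the coefficient of `d x̃` in the
chart `α`). -/
def perturbedDolbeault {ι C : Type*} [TopologicalSpace C] [ChartedSpace ℂ C]
    {S : SuperRiemannSurface ι C} {n : ℕ} (φ : VectorForm S n) (α : ι) (F : SuperFun n) :
    SuperFun n := fun x => dxt F x - φ.act α F x

end

/-!
A smooth function of `(x, x̃ | θ, ξ)` is evaluated on Grassmann-valued points by its finite Taylor
expansion in the nilpotent directions. A superconformal map that is the identity modulo `ξ` is
determined by its restriction to `θ = 0`, and every such restriction extends to one: the equation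
`D u⁺ = (D u⁻) u⁻` determines the `θ`-components up to the sign of a square root of an even
function with invertible body. A superconformal identification is therefore the same as a family
of Grassmann-valued points, one for each chart, that the transition maps of the deformation carry
into each other. Such a family is built degree by degree: evaluation on points that differ only in
high degree is affine to leading order, so averaging with a partition of unity makes a family
compatible in one more degree, and a Grassmann algebra vanishes in large degree.

For any identification, `∂̃ - φ` annihilates the pullbacks of the holomorphic coordinates if and
only if the coefficients of `φ` solve a linear system whose matrix, the super Jacobian of the local
map, is the identity modulo `ξ`. The solution vanishes modulo `ξ`, and its uniqueness makes the
local forms agree on overlaps. When the identification is superconformal, the compatibility of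
`∂̃` with `D` makes the form superconformal.
-/

noncomputable section

open SuperFun

/-! ### Parity, degree filtration and square roots in Grassmann algebras -/

namespace Grassmann

variable {m : ℕ}

theorem neg_apply (a : Grassmann m) (K : Finset (Fin m)) : (-a) K = -a K := rfl

theorem sub_apply (a b : Grassmann m) (K : Finset (Fin m)) : (a - b) K = a K - b K := rfl

theorem real_smul_apply (c : ℝ) (a : Grassmann m) (K : Finset (Fin m)) :
    (c • a) K = (c : ℂ) * a K :=
  Complex.real_smul

theorem real_smul_eq (c : ℝ) (a : Grassmann m) : c • a = (c : ℂ) • a := by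
  ext K; rw [real_smul_apply, smul_apply]

theorem sum_apply {κ : Type*} (s : Finset κ) (f : κ → Grassmann m) (K : Finset (Fin m)) :
    (∑ i ∈ s, f i) K = ∑ i ∈ s, f i K :=
  Finset.sum_apply K s f

theorem algebraMap_apply (c : ℂ) (K : Finset (Fin m)) :
    (algebraMap ℂ (Grassmann m) c) K = if K = ∅ then c else 0 := by
  rw [Algebra.algebraMap_eq_smul_one, smul_apply, one_apply]; split_ifs <;> simp

theorem sgn_mul_self (I J : Finset (Fin m)) : sgn I J * sgn I J = 1 := by
  simp only [sgn, ← Finset.prod_mul_distrib]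
  refine Finset.prod_eq_one fun i _ => Finset.prod_eq_one fun j _ => ?_
  split_ifs <;> norm_num

theorem sgn_mul_sgn_swap {I J : Finset (Fin m)} (h : Disjoint I J) :
    sgn I J * sgn J I = (-1) ^ (I.card * J.card) := by
  have sgn_comm : sgn J I = ∏ i ∈ I, ∏ j ∈ J, if i < j then (-1 : ℂ) else 1 := by
    rw [sgn, Finset.prod_comm]
  rw [sgn_comm, sgn]
  simp only [← Finset.prod_mul_distrib]
  rw [Finset.prod_congr rfl (g := fun _ => (-1 : ℂ) ^ J.card)]
  · rw [Finset.prod_const, ← pow_mul, mul_comm]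
  · intro i hi
    rw [← Finset.prod_const]
    refine Finset.prod_congr rfl fun j hj => ?_
    have hne : i ≠ j := fun hij => Finset.disjoint_left.1 h hi (hij ▸ hj)
    rcases lt_or_gt_of_ne hne with hlt | hlt <;> simp [hlt, not_lt_of_gt hlt]

theorem sgn_swap {I J : Finset (Fin m)} (h : Disjoint I J) :
    sgn J I = (-1) ^ (I.card * J.card) * sgn I J := by
  rw [← sgn_mul_sgn_swap h, mul_right_comm, sgn_mul_self, one_mul]

theorem mul_apply_swap (a b : Grassmann m) (K : Finset (Fin m)) :
    (b * a) K = ∑ I ∈ K.powerset,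
      (-1) ^ (I.card * (K \ I).card) * (sgn I (K \ I) * a I * b (K \ I)) := by
  have sdiff_sdiff : ∀ I ∈ K.powerset, K \ (K \ I) = I := fun I hI =>
    Finset.sdiff_sdiff_eq_self (Finset.mem_powerset.1 hI)
  rw [mul_apply]
  refine Finset.sum_bij' (fun I _ => K \ I) (fun I _ => K \ I) (by simp) (by simp)
    sdiff_sdiff sdiff_sdiff fun I hI => ?_
  rw [sdiff_sdiff I hI, sgn_swap Finset.sdiff_disjoint]
  ring

theorem IsEven.mul_comm {a : Grassmann m} (ha : a.IsEven) (b : Grassmann m) : a * b = b * a := by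
  ext K
  rw [mul_apply_swap a b, mul_apply]
  refine Finset.sum_congr rfl fun I _ => ?_
  rcases Nat.even_or_odd I.card with h | h
  · rw [(h.mul_right _).neg_one_pow, _root_.one_mul]
  · rw [ha I h]; ring

theorem IsOdd.mul_eq_neg {a b : Grassmann m} (ha : a.IsOdd) (hb : b.IsOdd) :
    a * b = -(b * a) := by
  ext K
  rw [neg_apply, mul_apply_swap a b, mul_apply, ← Finset.sum_neg_distrib]
  refine Finset.sum_congr rfl fun I _ => ?_
  rcases Nat.even_or_odd I.card with h | h
  · rw [ha I h]; ring
  rcases Nat.even_or_odd (K \ I).card with h' | h'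
  · rw [hb _ h']; ring
  · rw [(h.mul h').neg_one_pow]; ring

theorem IsOdd.mul_self {a : Grassmann m} (ha : a.IsOdd) : a * a = 0 := by
  have two_smul_eq : (2 : ℂ) • (a * a) = 0 := by
    rw [two_smul]; nth_rewrite 1 [ha.mul_eq_neg ha]; simp
  exact (smul_eq_zero.1 two_smul_eq).resolve_left two_ne_zero

/-- The even (`p = 0`) and the odd (`p = 1`) part of the Grassmann algebra. -/
def parityPart (m : ℕ) (p : ZMod 2) : Submodule ℂ (Grassmann m) where
  carrier := {a | ∀ I, (I.card : ZMod 2) ≠ p → a I = 0}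
  add_mem' ha hb I hI := by rw [add_apply, ha I hI, hb I hI, add_zero]
  zero_mem' _ _ := rfl
  smul_mem' c a ha I hI := by rw [smul_apply, ha I hI, mul_zero]

theorem mem_parityPart_zero {a : Grassmann m} : a ∈ parityPart m 0 ↔ a.IsEven :=
  forall_congr' fun _ => imp_congr_left ZMod.natCast_ne_zero_iff_odd

theorem mem_parityPart_one {a : Grassmann m} : a ∈ parityPart m 1 ↔ a.IsOdd :=
  forall_congr' fun I => imp_congr_left <| by
    rw [Ne, ZMod.natCast_eq_one_iff_odd, Nat.not_odd_iff_even]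

theorem mul_mem_parityPart {p q : ZMod 2} {a b : Grassmann m} (ha : a ∈ parityPart m p)
    (hb : b ∈ parityPart m q) : a * b ∈ parityPart m (p + q) := by
  intro K hK
  rw [mul_apply]
  refine Finset.sum_eq_zero fun I hI => ?_
  by_cases hIp : (I.card : ZMod 2) = p
  · have hcard : ((K \ I).card : ZMod 2) + I.card = K.card := by
      exact_mod_cast congrArg (Nat.cast (R := ZMod 2))
        (Finset.card_sdiff_add_card_eq_card (Finset.mem_powerset.1 hI))
    rw [hb (K \ I) fun hq => hK (by rw [← hcard, hIp, hq, add_comm]), mul_zero]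
  · rw [ha I hIp, mul_zero, zero_mul]

theorem isEven_algebraMap (c : ℂ) : (algebraMap ℂ (Grassmann m) c).IsEven := fun I hI => by
  rw [algebraMap_apply, if_neg]; rintro rfl; simp at hI

theorem isEven_one : (1 : Grassmann m).IsEven := by
  simpa using isEven_algebraMap (m := m) 1

theorem isOdd_zero : (0 : Grassmann m).IsOdd := fun _ _ => rfl

theorem IsEven.add {a b : Grassmann m} (ha : a.IsEven) (hb : b.IsEven) : (a + b).IsEven :=
  mem_parityPart_zero.1 (add_mem (mem_parityPart_zero.2 ha) (mem_parityPart_zero.2 hb))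

theorem IsOdd.add {a b : Grassmann m} (ha : a.IsOdd) (hb : b.IsOdd) : (a + b).IsOdd :=
  mem_parityPart_one.1 (add_mem (mem_parityPart_one.2 ha) (mem_parityPart_one.2 hb))

theorem IsEven.sub {a b : Grassmann m} (ha : a.IsEven) (hb : b.IsEven) : (a - b).IsEven :=
  mem_parityPart_zero.1 (sub_mem (mem_parityPart_zero.2 ha) (mem_parityPart_zero.2 hb))

theorem IsOdd.sub {a b : Grassmann m} (ha : a.IsOdd) (hb : b.IsOdd) : (a - b).IsOdd :=
  mem_parityPart_one.1 (sub_mem (mem_parityPart_one.2 ha) (mem_parityPart_one.2 hb))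

theorem IsEven.smul {a : Grassmann m} (c : ℂ) (ha : a.IsEven) : (c • a).IsEven :=
  mem_parityPart_zero.1 (Submodule.smul_mem _ c (mem_parityPart_zero.2 ha))

theorem IsOdd.smul {a : Grassmann m} (c : ℂ) (ha : a.IsOdd) : (c • a).IsOdd :=
  mem_parityPart_one.1 (Submodule.smul_mem _ c (mem_parityPart_one.2 ha))

theorem IsEven.sum {κ : Type*} {s : Finset κ} {f : κ → Grassmann m}
    (h : ∀ i ∈ s, (f i).IsEven) : (∑ i ∈ s, f i).IsEven :=
  mem_parityPart_zero.1 (sum_mem fun i hi => mem_parityPart_zero.2 (h i hi))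

theorem IsOdd.sum {κ : Type*} {s : Finset κ} {f : κ → Grassmann m}
    (h : ∀ i ∈ s, (f i).IsOdd) : (∑ i ∈ s, f i).IsOdd :=
  mem_parityPart_one.1 (sum_mem fun i hi => mem_parityPart_one.2 (h i hi))

theorem IsEven.mul {a b : Grassmann m} (ha : a.IsEven) (hb : b.IsEven) : (a * b).IsEven :=
  mem_parityPart_zero.1 (mul_mem_parityPart (mem_parityPart_zero.2 ha) (mem_parityPart_zero.2 hb))

theorem IsOdd.mul {a b : Grassmann m} (ha : a.IsOdd) (hb : b.IsOdd) : (a * b).IsEven :=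
  mem_parityPart_zero.1 (mul_mem_parityPart (mem_parityPart_one.2 ha) (mem_parityPart_one.2 hb))

theorem IsEven.mul_isOdd {a b : Grassmann m} (ha : a.IsEven) (hb : b.IsOdd) :
    (a * b).IsOdd :=
  mem_parityPart_one.1 (mul_mem_parityPart (mem_parityPart_zero.2 ha) (mem_parityPart_one.2 hb))

theorem IsOdd.mul_isEven {a b : Grassmann m} (ha : a.IsOdd) (hb : b.IsEven) :
    (a * b).IsOdd :=
  mem_parityPart_one.1 (mul_mem_parityPart (mem_parityPart_one.2 ha) (mem_parityPart_zero.2 hb))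

theorem IsEven.pow {a : Grassmann m} (ha : a.IsEven) (k : ℕ) : (a ^ k).IsEven := by
  induction k with
  | zero => simpa using isEven_one
  | succ k ih => rw [pow_succ]; exact ih.mul ha

/-- The elements all of whose terms are products of at least `j` generators. -/
def degreeGE (m j : ℕ) : Submodule ℂ (Grassmann m) where
  carrier := {a | ∀ I, I.card < j → a I = 0}
  add_mem' ha hb I hI := by rw [add_apply, ha I hI, hb I hI, add_zero]
  zero_mem' _ _ := rfl
  smul_mem' c a ha I hI := by rw [smul_apply, ha I hI, mul_zero]

theorem degreeGE_anti {i j : ℕ} (h : i ≤ j) : degreeGE m j ≤ degreeGE m i :=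
  fun _ ha I hI => ha I (hI.trans_le h)

theorem mem_degreeGE_zero (a : Grassmann m) : a ∈ degreeGE m 0 :=
  fun _ hI => absurd hI (Nat.not_lt_zero _)

theorem mem_degreeGE_one {a : Grassmann m} : a ∈ degreeGE m 1 ↔ a.body = 0 := by
  refine ⟨fun h => h ∅ (by simp), fun h I hI => ?_⟩
  have : I = ∅ := Finset.card_eq_zero.1 (by omega)
  rw [this]; exact h

theorem mul_mem_degreeGE {i j : ℕ} {a b : Grassmann m} (ha : a ∈ degreeGE m i)
    (hb : b ∈ degreeGE m j) : a * b ∈ degreeGE m (i + j) := by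
  intro K hK
  rw [mul_apply]
  refine Finset.sum_eq_zero fun I hI => ?_
  have hcard := Finset.card_sdiff_add_card_eq_card (Finset.mem_powerset.1 hI)
  rcases lt_or_ge I.card i with h | h
  · rw [ha I h, mul_zero, zero_mul]
  · rw [hb (K \ I) (by omega), mul_zero]

theorem mul_mem_degreeGE_left {i : ℕ} {a : Grassmann m} (b : Grassmann m) (ha : a ∈ degreeGE m i) :
    a * b ∈ degreeGE m i := mul_mem_degreeGE ha (mem_degreeGE_zero b)

theorem mul_mem_degreeGE_right {i : ℕ} {a : Grassmann m} (b : Grassmann m) (ha : a ∈ degreeGE m i) :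
    b * a ∈ degreeGE m i := by simpa using mul_mem_degreeGE (mem_degreeGE_zero b) ha

theorem pow_mem_degreeGE {i : ℕ} {a : Grassmann m} (ha : a ∈ degreeGE m i) (k : ℕ) :
    a ^ k ∈ degreeGE m (k * i) := by
  induction k with
  | zero => rw [Nat.zero_mul]; exact mem_degreeGE_zero _
  | succ k ih => rw [pow_succ, Nat.succ_mul]; exact mul_mem_degreeGE ih ha

theorem eq_zero_of_mem_degreeGE {j : ℕ} (hj : m < j) {a : Grassmann m} (ha : a ∈ degreeGE m j) :
    a = 0 := by
  ext I
  exact ha I (lt_of_le_of_lt (by simpa using I.card_le_univ) hj)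

theorem IsEven.mem_degreeGE_two {a : Grassmann m} (ha : a.IsEven) (h : a.body = 0) :
    a ∈ degreeGE m 2 := by
  intro I hI
  rcases Nat.even_or_odd I.card with h' | h'
  · have : I = ∅ := Finset.card_eq_zero.1 (by grind)
    rw [this]; exact h
  · exact ha I h'

theorem IsOdd.mem_degreeGE_one {a : Grassmann m} (ha : a.IsOdd) : a ∈ degreeGE m 1 :=
  Grassmann.mem_degreeGE_one.2 (ha ∅ (by simp))

@[simp] theorem body_add (a b : Grassmann m) : (a + b).body = a.body + b.body := rfl
@[simp] theorem body_sub (a b : Grassmann m) : (a - b).body = a.body - b.body := rfl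
@[simp] theorem body_zero : (0 : Grassmann m).body = 0 := rfl
@[simp] theorem body_smul (c : ℂ) (a : Grassmann m) : (c • a).body = c * a.body := rfl

@[simp] theorem body_algebraMap (c : ℂ) : (algebraMap ℂ (Grassmann m) c).body = c := by
  rw [body, algebraMap_apply, if_pos rfl]

@[simp] theorem body_one : (1 : Grassmann m).body = 1 := rfl

@[simp] theorem body_mul (a b : Grassmann m) : (a * b).body = a.body * b.body := by
  rw [body, mul_apply]; simp [sgn, body]

theorem IsOdd.body_eq_zero {a : Grassmann m} (ha : a.IsOdd) : a.body = 0 := ha ∅ (by simp)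

theorem pow_eq_zero_of_body {a : Grassmann m} (ha : a.body = 0) {k : ℕ} (hk : m < k) :
    a ^ k = 0 :=
  eq_zero_of_mem_degreeGE (by omega) (pow_mem_degreeGE (mem_degreeGE_one.2 ha) k)

theorem isUnit_of_body_ne_zero {a : Grassmann m} (ha : a.body ≠ 0) : IsUnit a := by
  have hnil : IsNilpotent (a - algebraMap ℂ _ a.body) :=
    ⟨m + 1, pow_eq_zero_of_body (by simp) (by omega)⟩
  have hunit : IsUnit (algebraMap ℂ (Grassmann m) a.body) := (isUnit_iff_ne_zero.2 ha).map _
  simpa using hnil.isUnit_add_left_of_commute hunit ((isEven_algebraMap _).mul_comm _).symm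

/-- The inverse of an element with body `1`, as a geometric sum (of no meaning for other bodies).
Being polynomial in `a`, it is smooth in `a`. -/
def geomInv (a : Grassmann m) : Grassmann m := ∑ k ∈ Finset.range (m + 1), (1 - a) ^ k

theorem mul_geomInv {a : Grassmann m} (ha : a.body = 1) : a * geomInv a = 1 := by
  have h := mul_neg_geom_sum (1 - a) (m + 1)
  rwa [pow_eq_zero_of_body (by rw [body_sub, body_one, ha, sub_self]) (by omega),
    sub_sub_cancel, sub_zero] at h

theorem geomInv_mul {a : Grassmann m} (ha : a.body = 1) : geomInv a * a = 1 := by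
  have h := geom_sum_mul_neg (1 - a) (m + 1)
  rwa [pow_eq_zero_of_body (by rw [body_sub, body_one, ha, sub_self]) (by omega),
    sub_sub_cancel, sub_zero] at h

protected theorem IsEven.geomInv {a : Grassmann m} (ha : a.IsEven) : (geomInv a).IsEven :=
  IsEven.sum fun k _ => (isEven_one.sub ha).pow k

/-- Successive approximations of the square root of an element with body `1`: the `k`-th one is
correct up to terms of degree greater than `k`. -/
def sqrtIter (a : Grassmann m) : ℕ → Grassmann m
  | 0 => 1
  | k + 1 => sqrtIter a k + (1 / 2 : ℂ) • (a - sqrtIter a k * sqrtIter a k)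

/-- The square root with body `1` of an element with body `1` (of no meaning for other bodies). -/
def sqrt (a : Grassmann m) : Grassmann m := sqrtIter a m

protected theorem IsEven.sqrtIter {a : Grassmann m} (ha : a.IsEven) (k : ℕ) :
    (sqrtIter a k).IsEven := by
  induction k with
  | zero => exact isEven_one
  | succ k ih => exact ih.add ((ha.sub (ih.mul ih)).smul _)

theorem body_sqrtIter {a : Grassmann m} (ha : a.body = 1) (k : ℕ) : (sqrtIter a k).body = 1 := by
  induction k with
  | zero => rfl
  | succ k ih => simp [sqrtIter, body_add, body_smul, body_sub, body_mul, ih, ha]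

theorem sub_mul_self_add_half_smul (a l : Grassmann m) :
    a - (l + (1 / 2 : ℂ) • (a - l * l)) * (l + (1 / 2 : ℂ) • (a - l * l)) =
      (1 / 2 : ℂ) • ((a - l * l) * (1 - l)) + (1 / 2 : ℂ) • ((1 - l) * (a - l * l)) -
        (1 / 4 : ℂ) • ((a - l * l) * (a - l * l)) := by
  obtain ⟨e, rfl⟩ : ∃ e, a = e + l * l := ⟨a - l * l, by abel⟩
  simp only [add_sub_cancel_right, mul_add, add_mul, mul_sub, sub_mul, smul_mul_assoc,
    mul_smul_comm, _root_.mul_one, _root_.one_mul]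
  module

theorem sub_sqrtIter_mul_self_mem_degreeGE {a : Grassmann m} (ha : a.body = 1) (k : ℕ) :
    a - sqrtIter a k * sqrtIter a k ∈ degreeGE m (k + 1) := by
  induction k with
  | zero => exact mem_degreeGE_one.2 (by simp [ha, sqrtIter])
  | succ k ih =>
    have one_sub_mem : 1 - sqrtIter a k ∈ degreeGE m 1 :=
      mem_degreeGE_one.2 (by simp [body_sqrtIter ha])
    rw [sqrtIter, sub_mul_self_add_half_smul]
    refine sub_mem (add_mem (Submodule.smul_mem _ _ (mul_mem_degreeGE ih one_sub_mem))
      (Submodule.smul_mem _ _ ?_)) (Submodule.smul_mem _ _ ?_)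
    · exact add_comm 1 (k + 1) ▸ mul_mem_degreeGE one_sub_mem ih
    · exact degreeGE_anti (by omega) (mul_mem_degreeGE ih ih)

theorem sqrt_mul_self {a : Grassmann m} (ha : a.body = 1) : sqrt a * sqrt a = a :=
  (sub_eq_zero.1 <|
    eq_zero_of_mem_degreeGE (by omega) (sub_sqrtIter_mul_self_mem_degreeGE ha m)).symm

theorem IsEven.eq_of_mul_self_eq {a b : Grassmann m} (ha : a.IsEven)
    (h : a * a = b * b) (hb : a.body = b.body) (h0 : a.body ≠ 0) : a = b := by
  have hu : IsUnit (a + b) := isUnit_of_body_ne_zero <| by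
    rw [body_add, ← hb, ← two_mul]; exact mul_ne_zero two_ne_zero h0
  have : (a - b) * (a + b) = 0 := by
    rw [sub_mul, mul_add, mul_add, h, ha.mul_comm b]; abel
  exact sub_eq_zero.1 (hu.mul_left_eq_zero.1 this)

end Grassmann

/-! ### The odd coordinate -/

namespace Grassmann

instance (m : ℕ) : FiniteDimensional ℂ (Grassmann m) :=
  inferInstanceAs (FiniteDimensional ℂ (Finset (Fin m) → ℂ))

instance (m : ℕ) : FiniteDimensional ℝ (Grassmann m) :=
  inferInstanceAs (FiniteDimensional ℝ (Finset (Fin m) → ℂ))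

/-- The grading involution of the Grassmann algebra: `1` on even and `-1` on odd elements. -/
def gradeInvolL (m : ℕ) : Grassmann m →L[ℂ] Grassmann m :=
  ContinuousLinearMap.pi (φ := fun _ => ℂ) fun I =>
    (-1 : ℂ) ^ I.card • ContinuousLinearMap.proj (R := ℂ) (φ := fun _ => ℂ) I

section GradeInvol

variable {m : ℕ}

theorem gradeInvolL_apply (a : Grassmann m) (I : Finset (Fin m)) :
    gradeInvolL m a I = (-1) ^ I.card * a I := rfl

theorem IsEven.gradeInvolL_eq {a : Grassmann m} (ha : a.IsEven) : gradeInvolL m a = a := by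
  ext I
  rw [gradeInvolL_apply]
  rcases Nat.even_or_odd I.card with h | h
  · rw [h.neg_one_pow, one_mul]
  · rw [ha I h, mul_zero]

theorem IsOdd.gradeInvolL_eq {a : Grassmann m} (ha : a.IsOdd) : gradeInvolL m a = -a := by
  ext I
  rw [gradeInvolL_apply, neg_apply]
  rcases Nat.even_or_odd I.card with h | h
  · rw [ha I h, mul_zero, neg_zero]
  · rw [h.neg_one_pow, neg_one_mul]

theorem gradeInvolL_mul (a b : Grassmann m) :
    gradeInvolL m (a * b) = gradeInvolL m a * gradeInvolL m b := by
  ext K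
  rw [gradeInvolL_apply, mul_apply, mul_apply, Finset.mul_sum]
  refine Finset.sum_congr rfl fun I hI => ?_
  rw [gradeInvolL_apply, gradeInvolL_apply,
    ← Finset.card_sdiff_add_card_eq_card (Finset.mem_powerset.1 hI), pow_add]
  ring

theorem IsOdd.mul_gradeInvolL {ψ : Grassmann m} (hψ : ψ.IsOdd) (a : Grassmann m) :
    ψ * gradeInvolL m a = a * ψ := by
  ext K
  rw [mul_apply_swap ψ a, mul_apply]
  refine Finset.sum_congr rfl fun I _ => ?_
  rw [gradeInvolL_apply]
  rcases Nat.even_or_odd I.card with h | h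
  · rw [hψ I h]; ring
  · rw [pow_mul, h.neg_one_pow]; ring

end GradeInvol

variable {n : ℕ}

/-- The continuous linear map taking `a = A + θ B`, with `A` and `B` free of `θ`, to `A`. -/
def thetaFreeL : Grassmann (n + 1) →L[ℂ] Grassmann (n + 1) :=
  ContinuousLinearMap.pi (φ := fun _ => ℂ) fun I =>
    if 0 ∈ I then 0 else ContinuousLinearMap.proj (R := ℂ) (φ := fun _ => ℂ) I

/-- The continuous linear map taking `a = A + θ B`, with `A` and `B` free of `θ`, to `B`. -/
def dthetaL : Grassmann (n + 1) →L[ℂ] Grassmann (n + 1) :=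
  ContinuousLinearMap.pi (φ := fun _ => ℂ) fun I =>
    if 0 ∈ I then 0 else ContinuousLinearMap.proj (R := ℂ) (φ := fun _ => ℂ) (insert 0 I)

theorem thetaFreeL_apply (a : Grassmann (n + 1)) (I : Finset (Fin (n + 1))) :
    thetaFreeL a I = if 0 ∈ I then 0 else a I :=
  apply_ite (fun f : (Finset (Fin (n + 1)) → ℂ) →L[ℂ] ℂ => f a) (0 ∈ I) 0
    (ContinuousLinearMap.proj I)

theorem dthetaL_apply (a : Grassmann (n + 1)) (I : Finset (Fin (n + 1))) :
    dthetaL a I = if 0 ∈ I then 0 else a (insert 0 I) :=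
  apply_ite (fun f : (Finset (Fin (n + 1)) → ℂ) →L[ℂ] ℂ => f a) (0 ∈ I) 0
    (ContinuousLinearMap.proj (insert 0 I))

@[simp] theorem thetaFreeL_thetaFreeL (a : Grassmann (n + 1)) :
    thetaFreeL (thetaFreeL a) = thetaFreeL a := by
  ext I; simp only [thetaFreeL_apply]; split_ifs <;> rfl

@[simp] theorem thetaFreeL_dthetaL (a : Grassmann (n + 1)) :
    thetaFreeL (dthetaL a) = dthetaL a := by
  ext I; simp only [thetaFreeL_apply, dthetaL_apply]; split_ifs <;> rfl

@[simp] theorem dthetaL_thetaFreeL (a : Grassmann (n + 1)) : dthetaL (thetaFreeL a) = 0 := by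
  ext I; simp only [thetaFreeL_apply, dthetaL_apply]; simp [zero_apply]

@[simp] theorem dthetaL_dthetaL (a : Grassmann (n + 1)) : dthetaL (dthetaL a) = 0 := by
  ext I; simp only [dthetaL_apply]; simp [zero_apply]

theorem sgn_singleton_zero (J : Finset (Fin (n + 1))) : sgn {0} J = 1 := by
  simp [sgn]

theorem theta_mul_apply (a : Grassmann (n + 1)) (K : Finset (Fin (n + 1))) :
    (theta n * a) K = if 0 ∈ K then a (K.erase 0) else 0 := by
  rw [mul_apply]
  split_ifs with h
  · rw [Finset.sum_eq_single {0}]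
    · rw [sgn_singleton_zero, Finset.sdiff_singleton_eq_erase]; simp [theta, gen]
    · intro I _ hI; simp [theta, gen, hI]
    · intro h'; simp [h] at h'
  · refine Finset.sum_eq_zero fun I hI => ?_
    have : I ≠ {0} := by
      rintro rfl; exact h (Finset.mem_powerset.1 hI (by simp))
    simp [theta, gen, this]

theorem thetaFreeL_add_theta_mul_dthetaL (a : Grassmann (n + 1)) :
    thetaFreeL a + theta n * dthetaL a = a := by
  ext I
  rw [add_apply, theta_mul_apply, thetaFreeL_apply, dthetaL_apply]
  split_ifs with h h'
  · simp at h'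
  · simp [Finset.insert_erase h]
  · simp

@[simp] theorem dthetaL_theta_mul (a : Grassmann (n + 1)) :
    dthetaL (theta n * a) = thetaFreeL a := by
  ext I
  rw [dthetaL_apply, theta_mul_apply, thetaFreeL_apply]
  split_ifs with h h'
  · rfl
  · rw [Finset.erase_insert h]
  · simp at h'

@[simp] theorem thetaFreeL_theta_mul (a : Grassmann (n + 1)) : thetaFreeL (theta n * a) = 0 := by
  ext I
  rw [thetaFreeL_apply, theta_mul_apply]
  split_ifs <;> rfl

@[simp] theorem thetaFreeL_mul (a b : Grassmann (n + 1)) :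
    thetaFreeL (a * b) = thetaFreeL a * thetaFreeL b := by
  ext K
  rw [thetaFreeL_apply, mul_apply, mul_apply]
  split_ifs with h
  · symm
    refine Finset.sum_eq_zero fun I _ => ?_
    rw [thetaFreeL_apply, thetaFreeL_apply]
    by_cases hI : 0 ∈ I
    · simp [hI]
    · simp [h, hI]
  · refine Finset.sum_congr rfl fun I hI => ?_
    have zero_notMem : 0 ∉ I := fun h' => h (Finset.mem_powerset.1 hI h')
    have zero_notMem_sdiff : 0 ∉ K \ I := fun h' => h (Finset.sdiff_subset h')
    rw [thetaFreeL_apply, thetaFreeL_apply, if_neg zero_notMem, if_neg zero_notMem_sdiff]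

@[simp] theorem thetaFreeL_algebraMap (c : ℂ) : thetaFreeL (algebraMap ℂ (Grassmann (n + 1)) c) =
    algebraMap ℂ _ c := by
  ext I; rw [thetaFreeL_apply, algebraMap_apply]; split_ifs with h h' <;> simp_all

@[simp] theorem thetaFreeL_one : thetaFreeL (1 : Grassmann (n + 1)) = 1 := by
  simpa using thetaFreeL_algebraMap (n := n) 1

@[simp] theorem thetaFreeL_pow (a : Grassmann (n + 1)) (k : ℕ) :
    thetaFreeL (a ^ k) = thetaFreeL a ^ k := by
  induction k with
  | zero => simp
  | succ k ih => rw [pow_succ, pow_succ, thetaFreeL_mul, ih]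

@[simp] theorem dthetaL_algebraMap (c : ℂ) : dthetaL (algebraMap ℂ (Grassmann (n + 1)) c) = 0 := by
  rw [← thetaFreeL_algebraMap, dthetaL_thetaFreeL]

@[simp] theorem dthetaL_one : dthetaL (1 : Grassmann (n + 1)) = 0 := by
  simpa using dthetaL_algebraMap (n := n) 1

@[simp] theorem dthetaL_theta : dthetaL (theta n) = 1 := by
  simpa using dthetaL_theta_mul (1 : Grassmann (n + 1))

@[simp] theorem thetaFreeL_theta : thetaFreeL (theta n) = 0 := by
  simpa using thetaFreeL_theta_mul (1 : Grassmann (n + 1))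

theorem isOdd_theta : (theta n).IsOdd := by
  intro I hI
  rw [theta, gen, if_neg]; rintro rfl; simp at hI

protected theorem IsEven.thetaFreeL {a : Grassmann (n + 1)} (ha : a.IsEven) :
    (thetaFreeL a).IsEven := fun I hI => by
  rw [thetaFreeL_apply, ha I hI, ite_self]

protected theorem IsOdd.thetaFreeL {a : Grassmann (n + 1)} (ha : a.IsOdd) :
    (thetaFreeL a).IsOdd := fun I hI => by
  rw [thetaFreeL_apply, ha I hI, ite_self]

protected theorem IsEven.dthetaL {a : Grassmann (n + 1)} (ha : a.IsEven) :
    (dthetaL a).IsOdd := fun I hI => by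
  rw [dthetaL_apply]
  split_ifs with h
  · rfl
  · exact ha _ (by rw [Finset.card_insert_of_notMem h]; exact hI.add_one)

protected theorem IsOdd.dthetaL {a : Grassmann (n + 1)} (ha : a.IsOdd) :
    (dthetaL a).IsEven := fun I hI => by
  rw [dthetaL_apply]
  split_ifs with h
  · rfl
  · exact ha _ (by rw [Finset.card_insert_of_notMem h]; exact hI.add_one)

theorem dthetaL_add_theta_mul {A B : Grassmann (n + 1)} (hA : thetaFreeL A = A)
    (hB : thetaFreeL B = B) : dthetaL (A + theta n * B) = B := by
  rw [map_add, dthetaL_theta_mul, hB, ← hA, dthetaL_thetaFreeL, zero_add]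

theorem thetaFreeL_gradeInvolL (a : Grassmann (n + 1)) :
    thetaFreeL (gradeInvolL _ a) = gradeInvolL _ (thetaFreeL a) := by
  ext I
  simp only [thetaFreeL_apply, gradeInvolL_apply, mul_ite, mul_zero]

theorem dthetaL_gradeInvolL (a : Grassmann (n + 1)) :
    dthetaL (gradeInvolL _ a) = -gradeInvolL _ (dthetaL a) := by
  ext I
  rw [neg_apply, dthetaL_apply, gradeInvolL_apply, gradeInvolL_apply, dthetaL_apply]
  split_ifs with h
  · simp
  · rw [Finset.card_insert_of_notMem h, pow_succ]; ring

theorem dthetaL_mul (a b : Grassmann (n + 1)) :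
    dthetaL (a * b) = dthetaL a * b + gradeInvolL _ a * dthetaL b := by
  have free_mul : thetaFreeL a * b = thetaFreeL a * thetaFreeL b +
      theta n * (gradeInvolL _ (thetaFreeL a) * dthetaL b) := by
    rw [← mul_assoc, isOdd_theta.mul_gradeInvolL, mul_assoc, ← mul_add,
      thetaFreeL_add_theta_mul_dthetaL]
  have invol_eq : gradeInvolL _ a = gradeInvolL _ (thetaFreeL a) - dthetaL a * theta n := by
    rw [← isOdd_theta.mul_gradeInvolL, ← neg_add_eq_sub, ← neg_mul, ← isOdd_theta.gradeInvolL_eq,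
      ← gradeInvolL_mul, ← map_add, add_comm (theta n * _), thetaFreeL_add_theta_mul_dthetaL]
  calc dthetaL (a * b)
      = dthetaL (thetaFreeL a * b + theta n * (dthetaL a * b)) := by
        rw [← mul_assoc, ← add_mul, thetaFreeL_add_theta_mul_dthetaL]
    _ = gradeInvolL _ (thetaFreeL a) * dthetaL b + dthetaL a * thetaFreeL b := by
        rw [map_add, free_mul, dthetaL_add_theta_mul, dthetaL_theta_mul, thetaFreeL_mul,
          thetaFreeL_dthetaL] <;> simp [thetaFreeL_gradeInvolL]
    _ = dthetaL a * (thetaFreeL b + theta n * dthetaL b) + gradeInvolL _ a * dthetaL b := by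
        rw [invol_eq]; noncomm_ring
    _ = dthetaL a * b + gradeInvolL _ a * dthetaL b := by
        rw [thetaFreeL_add_theta_mul_dthetaL]

theorem IsEven.dthetaL_mul {a : Grassmann (n + 1)} (ha : a.IsEven) (b : Grassmann (n + 1)) :
    dthetaL (a * b) = dthetaL a * b + a * dthetaL b := by
  rw [Grassmann.dthetaL_mul, ha.gradeInvolL_eq]

theorem IsOdd.dthetaL_mul {a : Grassmann (n + 1)} (ha : a.IsOdd) (b : Grassmann (n + 1)) :
    dthetaL (a * b) = dthetaL a * b - a * dthetaL b := by
  rw [Grassmann.dthetaL_mul, ha.gradeInvolL_eq, neg_mul, sub_eq_add_neg]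

theorem IsEven.dthetaL_pow {a : Grassmann (n + 1)} (ha : a.IsEven) (k : ℕ) :
    dthetaL (a ^ k) = (k : ℂ) • (dthetaL a * a ^ (k - 1)) := by
  induction k with
  | zero => simp
  | succ k ih =>
    rw [pow_succ, (ha.pow k).dthetaL_mul, ih, (ha.pow k).mul_comm]
    rcases k with _ | k
    · simp
    · simp only [Nat.add_sub_cancel, smul_mul_assoc, mul_assoc, ← pow_succ]
      push_cast
      module

theorem body_thetaFreeL (a : Grassmann (n + 1)) : (thetaFreeL a).body = a.body := by
  rw [body, thetaFreeL_apply, if_neg (by simp)]; rfl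

/-- The monomial `e_I`, the product of the generators `e_i`, `i ∈ I`, in increasing order. -/
def monomial {m : ℕ} (I : Finset (Fin m)) : Grassmann m := fun J => if J = I then 1 else 0

theorem gen_mul_monomial {m : ℕ} {i : Fin m} {I : Finset (Fin m)} (hi : i ∈ I) :
    gen i * monomial (I.erase i) = sgn {i} (I.erase i) • monomial I := by
  ext K
  rw [mul_apply, smul_apply, monomial]
  by_cases hK : K = I
  · subst hK
    rw [Finset.sum_eq_single {i}]
    · simp [gen, monomial, Finset.sdiff_singleton_eq_erase]
    · intro J _ hJ; simp [gen, hJ]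
    · intro h; simp [hi] at h
  · rw [if_neg hK, mul_zero]
    refine Finset.sum_eq_zero fun J hJ => ?_
    by_cases hJi : J = {i}
    · subst hJi
      have hiK : i ∈ K := Finset.mem_powerset.1 hJ (by simp)
      have : K.erase i ≠ I.erase i := fun h => hK <| by
        rw [← Finset.insert_erase hiK, h, Finset.insert_erase hi]
      simp [monomial, Finset.sdiff_singleton_eq_erase, this]
    · simp [gen, hJi]

theorem mul_apply_singleton {m : ℕ} (a b : Grassmann m) (i : Fin m) :
    (a * b) {i} = a ∅ * b {i} + a {i} * b ∅ := by
  have : ({i} : Finset (Fin m)).powerset = {∅, {i}} := by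
    ext J; simp [Finset.subset_singleton_iff]
  rw [mul_apply, this, Finset.sum_pair (by simp)]
  simp [sgn]

theorem eq_sum_monomial {m : ℕ} (a : Grassmann m) : a = ∑ I, a I • monomial I := by
  ext J
  rw [sum_apply, Finset.sum_eq_single J]
  · simp [smul_apply, monomial]
  · intro I _ hI; simp [smul_apply, monomial, hI.symm]
  · simp

end Grassmann

namespace SuperFun

open Grassmann

variable {n : ℕ}

/-- The ideal of the elements whose coefficients of `1` and of `θ` vanish; it is the ideal generated
by the parameters `ξ_1, …, ξ_n`. -/
def xiIdeal (n : ℕ) : TwoSidedIdeal (Grassmann (n + 1)) :=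
  TwoSidedIdeal.mk' {a | a ∅ = 0 ∧ a {0} = 0} ⟨rfl, rfl⟩
    (fun ha hb => ⟨by rw [Grassmann.add_apply, ha.1, hb.1, add_zero],
      by rw [Grassmann.add_apply, ha.2, hb.2, add_zero]⟩)
    (fun ha => ⟨by rw [neg_apply, ha.1, neg_zero], by rw [neg_apply, ha.2, neg_zero]⟩)
    (fun ha => ⟨by simp [mul_apply, ha.1], by rw [mul_apply_singleton, ha.1, ha.2]; ring⟩)
    (fun ha => ⟨by simp [mul_apply, ha.1], by rw [mul_apply_singleton, ha.1, ha.2]; ring⟩)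

theorem mem_xiIdeal {a : Grassmann (n + 1)} : a ∈ xiIdeal n ↔ a ∅ = 0 ∧ a {0} = 0 :=
  TwoSidedIdeal.mem_mk' _ _ _ _ _ _ _

theorem monomial_mem_span_xi {I : Finset (Fin (n + 1))} {i : Fin n} (hi : i.succ ∈ I) :
    (monomial I : Grassmann (n + 1)) ∈ TwoSidedIdeal.span (Set.range (xi (n := n))) := by
  have factor : monomial I =
      xi i * (sgn {i.succ} (I.erase i.succ) • monomial (I.erase i.succ)) := by
    rw [xi, mul_smul_comm, gen_mul_monomial hi, smul_smul, sgn_mul_self, one_smul]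
  rw [factor]
  exact TwoSidedIdeal.mul_mem_right _ _ _ (TwoSidedIdeal.subset_span ⟨i, rfl⟩)

theorem span_range_xi : TwoSidedIdeal.span (Set.range (xi (n := n))) = xiIdeal n := by
  refine le_antisymm (TwoSidedIdeal.span_le.2 ?_) fun a ha => ?_
  · rintro _ ⟨i, rfl⟩
    rw [SetLike.mem_coe, mem_xiIdeal]
    simp [xi, gen, Fin.succ_ne_zero, eq_comm]
  · rw [eq_sum_monomial a]
    refine sum_mem fun I _ => ?_
    by_cases hI : ∃ i : Fin n, i.succ ∈ I
    · obtain ⟨i, hi⟩ := hI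
      rw [← mul_one (monomial I), ← mul_smul_comm]
      exact TwoSidedIdeal.mul_mem_right _ _ _ (monomial_mem_span_xi hi)
    · have I_subset : I ⊆ {0} := fun j hj => by
        rcases Fin.eq_zero_or_eq_succ j with rfl | ⟨i, rfl⟩
        · simp
        · exact absurd ⟨i, hj⟩ hI
      have coeff_eq_zero : a I = 0 := by
        rcases Finset.subset_singleton_iff.1 I_subset with rfl | rfl
        exacts [(mem_xiIdeal.1 ha).1, (mem_xiIdeal.1 ha).2]
      rw [coeff_eq_zero, zero_smul]
      exact zero_mem _

theorem modXi_iff {a b : Grassmann (n + 1)} : ModXi a b ↔ a ∅ = b ∅ ∧ a {0} = b {0} := by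
  rw [ModXi, span_range_xi, mem_xiIdeal, Grassmann.sub_apply, Grassmann.sub_apply, sub_eq_zero,
    sub_eq_zero]

theorem modXi_iff_body {a b : Grassmann (n + 1)} :
    ModXi a b ↔ a.body = b.body ∧ (dthetaL a).body = (dthetaL b).body := by
  rw [modXi_iff, body, body, body, body, dthetaL_apply, dthetaL_apply]
  simp

end SuperFun

/-! ### Calculus of superfunctions -/

namespace Grassmann

variable {m n : ℕ}

/-- Multiplication as a continuous real bilinear map. -/
def mulL (m : ℕ) : Grassmann m →L[ℝ] Grassmann m →L[ℝ] Grassmann m :=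
  LinearMap.toContinuousBilinearMap <| LinearMap.mk₂ ℝ (fun a b => a * b) add_mul
    (fun c a b => by simp only [real_smul_eq, smul_mul_assoc]) mul_add
    (fun c a b => by simp only [real_smul_eq, mul_smul_comm])

theorem mulL_apply (a b : Grassmann m) : mulL m a b = a * b := rfl

/-- The body as a continuous complex linear map. -/
def bodyL (m : ℕ) : Grassmann m →L[ℂ] ℂ :=
  LinearMap.toContinuousLinearMap { toFun := body, map_add' := body_add, map_smul' := body_smul }

theorem bodyL_apply (a : Grassmann m) : bodyL m a = a.body := rfl

section Calculus

variable {E : Type*} [NormedAddCommGroup E] [NormedSpace ℝ E]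

theorem hasFDerivAt_mul {f g : E → Grassmann m} {f' g' : E →L[ℝ] Grassmann m} {x : E}
    (hf : HasFDerivAt f f' x) (hg : HasFDerivAt g g' x) :
    HasFDerivAt (fun y => f y * g y) (mulL m (f x) ∘L g' + (mulL m).flip (g x) ∘L f') x :=
  (mulL m).hasFDerivAt_of_bilinear hf hg

theorem differentiableAt_mul {f g : E → Grassmann m} {x : E}
    (hf : DifferentiableAt ℝ f x) (hg : DifferentiableAt ℝ g x) :
    DifferentiableAt ℝ (fun y => f y * g y) x :=
  (hasFDerivAt_mul hf.hasFDerivAt hg.hasFDerivAt).differentiableAt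

theorem contDiffOn_mul {f g : E → Grassmann m} {s : Set E} (hf : ContDiffOn ℝ ∞ f s)
    (hg : ContDiffOn ℝ ∞ g s) : ContDiffOn ℝ ∞ (fun y => f y * g y) s :=
  ((mulL m).isBoundedBilinearMap.contDiff).comp_contDiffOn (hf.prodMk hg)

theorem contDiffOn_pow {f : E → Grassmann m} {s : Set E} (hf : ContDiffOn ℝ ∞ f s) (k : ℕ) :
    ContDiffOn ℝ ∞ (fun y => f y ^ k) s := by
  induction k with
  | zero => simpa using contDiffOn_const
  | succ k ih => simp only [pow_succ]; exact contDiffOn_mul ih hf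

theorem contDiffOn_clm_comp {F : Type*} [NormedAddCommGroup F] [NormedSpace ℂ F]
    {f : E → Grassmann m} {s : Set E} (L : Grassmann m →L[ℂ] F)
    (hf : ContDiffOn ℝ ∞ f s) : ContDiffOn ℝ ∞ (fun y => L (f y)) s :=
  (L.restrictScalars ℝ).contDiff.comp_contDiffOn hf

theorem contDiffOn_smul {f : E → Grassmann m} {s : Set E} (c : ℂ)
    (hf : ContDiffOn ℝ ∞ f s) : ContDiffOn ℝ ∞ (fun y => c • f y) s :=
  contDiffOn_clm_comp (c • ContinuousLinearMap.id ℂ (Grassmann m)) hf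

theorem contDiffOn_geomInv {f : E → Grassmann m} {s : Set E} (hf : ContDiffOn ℝ ∞ f s) :
    ContDiffOn ℝ ∞ (fun y => geomInv (f y)) s :=
  ContDiffOn.sum fun k _ => contDiffOn_pow (contDiffOn_const.sub hf) k

theorem contDiffOn_sqrt {f : E → Grassmann m} {s : Set E} (hf : ContDiffOn ℝ ∞ f s) :
    ContDiffOn ℝ ∞ (fun y => sqrt (f y)) s := by
  suffices ∀ k, ContDiffOn ℝ ∞ (fun y => sqrtIter (f y) k) s from this m
  intro k
  induction k with
  | zero => exact contDiffOn_const
  | succ k ih => exact ih.add (contDiffOn_smul _ (hf.sub (contDiffOn_mul ih ih)))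

-- The hypothesis `degree_succ` holds for linear systems `Δ' = N Δ` with nilpotent coefficients;
-- each coefficient of `Δ` is then constant, by induction on its degree.
theorem eq_zero_of_deriv_mem_degreeGE {κ : Type*} {Δ Δ' : κ → ℝ → Grassmann m}
    (initial : ∀ i, Δ i 0 = 0) (hasDeriv : ∀ i t, HasDerivAt (Δ i) (Δ' i t) t)
    (degree_succ : ∀ k, (∀ i t, Δ i t ∈ degreeGE m k) → ∀ i t, Δ' i t ∈ degreeGE m (k + 1))
    (i : κ) (t : ℝ) : Δ i t = 0 := by
  suffices mem_degreeGE : ∀ k i t, Δ i t ∈ degreeGE m k from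
    eq_zero_of_mem_degreeGE (Nat.lt_succ_self m) (mem_degreeGE _ i t)
  intro k
  induction k with
  | zero => exact fun i t => mem_degreeGE_zero _
  | succ k ih =>
    intro i t I hI
    have coeff_hasDeriv : ∀ t, HasDerivAt (fun t => Δ i t I) 0 t := fun t => by
      have := hasDerivAt_pi.1 (hasDeriv i t) I
      rwa [degree_succ k ih i t I hI] at this
    have coeff_const := is_const_of_deriv_eq_zero (fun t => (coeff_hasDeriv t).differentiableAt)
      (fun t => (coeff_hasDeriv t).deriv) t 0
    exact coeff_const.trans (by rw [initial]; rfl)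

end Calculus

end Grassmann

namespace SuperFun

open Grassmann

variable {n : ℕ} {F H : SuperFun n} {U V : Set ℂ} {z : ℂ}

theorem thetaFree_apply (F : SuperFun n) (z : ℂ) : thetaFree F z = thetaFreeL (F z) :=
  Grassmann.ext fun I => (thetaFreeL_apply (F z) I).symm

theorem dtheta_apply (F : SuperFun n) (z : ℂ) : dtheta F z = dthetaL (F z) :=
  Grassmann.ext fun I => (dthetaL_apply (F z) I).symm

theorem thetaFree_eq (F : SuperFun n) : thetaFree F = fun z => thetaFreeL (F z) :=
  funext (thetaFree_apply F)

theorem dtheta_eq (F : SuperFun n) : dtheta F = fun z => dthetaL (F z) :=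
  funext (dtheta_apply F)

theorem SmoothOn.differentiableAt (hF : SmoothOn F V) (hV : IsOpen V) (hz : z ∈ V) :
    DifferentiableAt ℝ F z :=
  ((hF z hz).contDiffAt (hV.mem_nhds hz)).differentiableAt (by simp)

theorem SmoothOn.mul (hF : SmoothOn F V) (hH : SmoothOn H V) :
    SmoothOn (fun y => F y * H y) V := contDiffOn_mul hF hH

theorem SmoothOn.add (hF : SmoothOn F V) (hH : SmoothOn H V) :
    SmoothOn (fun y => F y + H y) V := ContDiffOn.add hF hH

theorem SmoothOn.sub (hF : SmoothOn F V) (hH : SmoothOn H V) :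
    SmoothOn (fun y => F y - H y) V := ContDiffOn.sub hF hH

theorem SmoothOn.smul (c : ℂ) (hF : SmoothOn F V) : SmoothOn (fun y => c • F y) V :=
  contDiffOn_smul c hF

theorem smoothOn_const (a : Grassmann (n + 1)) : SmoothOn (fun _ => a) V := contDiffOn_const

theorem smoothOn_algebraMap : SmoothOn (fun y => algebraMap ℂ (Grassmann (n + 1)) y) V := by
  have : ContDiff ℝ ∞ (((ContinuousLinearMap.id ℂ ℂ).smulRight
    (1 : Grassmann (n + 1))).restrictScalars ℝ) := ContinuousLinearMap.contDiff _
  refine this.contDiffOn.congr fun y _ => ?_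
  simp [Algebra.algebraMap_eq_smul_one]

theorem SmoothOn.thetaFree (hF : SmoothOn F V) : SmoothOn (thetaFree F) V := by
  rw [thetaFree_eq]; exact contDiffOn_clm_comp thetaFreeL hF

theorem SmoothOn.dtheta (hF : SmoothOn F V) : SmoothOn (dtheta F) V := by
  rw [dtheta_eq]; exact contDiffOn_clm_comp dthetaL hF

theorem SmoothOn.mono (hF : SmoothOn F V) (h : U ⊆ V) : SmoothOn F U := ContDiffOn.mono hF h

theorem SmoothOn.fderiv_apply (hF : SmoothOn F V) (hV : IsOpen V) (w : ℂ) :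
    SmoothOn (fun z => fderiv ℝ F z w) V :=
  (hF.fderiv_of_isOpen hV (by simp)).clm_apply contDiffOn_const

theorem SmoothOn.dx (hF : SmoothOn F V) (hV : IsOpen V) : SmoothOn (dx F) V :=
  contDiffOn_smul _ ((hF.fderiv_apply hV 1).sub ((hF.fderiv_apply hV Complex.I).smul _))

theorem SmoothOn.dxt (hF : SmoothOn F V) (hV : IsOpen V) : SmoothOn (dxt F) V :=
  contDiffOn_smul _ ((hF.fderiv_apply hV 1).add ((hF.fderiv_apply hV Complex.I).smul _))

theorem SmoothOn.iterate_dx (hF : SmoothOn F V) (hV : IsOpen V) (k : ℕ) :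
    SmoothOn (SuperFun.dx^[k] F) V := by
  induction k with
  | zero => exact hF
  | succ k ih => rw [Function.iterate_succ_apply']; exact ih.dx hV

theorem SmoothOn.D (hF : SmoothOn F V) (hV : IsOpen V) : SmoothOn (D F) V :=
  hF.dtheta.add ((smoothOn_const _).mul (hF.dx hV))

theorem dx_eq_of_hasFDerivAt {L : ℂ →L[ℝ] Grassmann (n + 1)} (h : HasFDerivAt F L z) :
    dx F z = (1 / 2 : ℂ) • (L 1 - Complex.I • L Complex.I) := by
  rw [SuperFun.dx, h.fderiv]

theorem dxt_eq_of_hasFDerivAt {L : ℂ →L[ℝ] Grassmann (n + 1)} (h : HasFDerivAt F L z) :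
    dxt F z = (1 / 2 : ℂ) • (L 1 + Complex.I • L Complex.I) := by
  rw [SuperFun.dxt, h.fderiv]

theorem fderiv_eq_smul_dx_add_smul_dxt (F : SuperFun n) (z w : ℂ) :
    fderiv ℝ F z w = w • dx F z + (starRingEnd ℂ) w • dxt F z := by
  have w_eq : w = w.re • (1 : ℂ) + w.im • Complex.I := by
    simp [Complex.real_smul, Complex.re_add_im]
  have conj_w_eq : (starRingEnd ℂ) w = (w.re : ℂ) - (w.im : ℂ) * Complex.I := by
    apply Complex.ext <;> simp
  conv_lhs => rw [w_eq, map_add, map_smul, map_smul, real_smul_eq, real_smul_eq]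
  rw [conj_w_eq]
  nth_rewrite 3 [← Complex.re_add_im w]
  simp only [dx, dxt]
  match_scalars
  · ring
  · linear_combination (w.im : ℂ) * Complex.I_mul_I

theorem dx_congr (h : F =ᶠ[nhds z] H) : dx F z = dx H z := by
  rw [dx, dx, h.fderiv_eq]

theorem dxt_congr (h : F =ᶠ[nhds z] H) : dxt F z = dxt H z := by
  rw [dxt, dxt, h.fderiv_eq]

theorem dx_eqOn (hV : IsOpen V) (h : Set.EqOn F H V) : Set.EqOn (dx F) (dx H) V :=
  fun _ hz => dx_congr (h.eventuallyEq_of_mem (hV.mem_nhds hz))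

theorem dxt_eqOn (hV : IsOpen V) (h : Set.EqOn F H V) : Set.EqOn (dxt F) (dxt H) V :=
  fun _ hz => dxt_congr (h.eventuallyEq_of_mem (hV.mem_nhds hz))

theorem iterate_dx_eqOn (hV : IsOpen V) (h : Set.EqOn F H V) (k : ℕ) :
    Set.EqOn (dx^[k] F) (dx^[k] H) V := by
  induction k with
  | zero => exact h
  | succ k ih => 
    rw [Function.iterate_succ_apply', Function.iterate_succ_apply']
    exact dx_eqOn hV ih

theorem D_eqOn (hV : IsOpen V) (h : Set.EqOn F H V) : Set.EqOn (D F) (D H) V := fun z hz => by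
  rw [D, D, dx_eqOn hV h hz, dtheta_apply, dtheta_apply, h hz]

theorem dx_mul (hF : DifferentiableAt ℝ F z) (hH : DifferentiableAt ℝ H z) :
    dx (fun y => F y * H y) z = dx F z * H z + F z * dx H z := by
  rw [dx_eq_of_hasFDerivAt (hasFDerivAt_mul hF.hasFDerivAt hH.hasFDerivAt), dx, dx]
  simp only [_root_.add_apply, ContinuousLinearMap.comp_apply,
    ContinuousLinearMap.flip_apply, mulL_apply, smul_mul_assoc, mul_smul_comm, mul_sub, sub_mul]
  module

theorem dxt_mul (hF : DifferentiableAt ℝ F z) (hH : DifferentiableAt ℝ H z) :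
    dxt (fun y => F y * H y) z = dxt F z * H z + F z * dxt H z := by
  rw [dxt_eq_of_hasFDerivAt (hasFDerivAt_mul hF.hasFDerivAt hH.hasFDerivAt), dxt, dxt]
  simp only [_root_.add_apply, ContinuousLinearMap.comp_apply,
    ContinuousLinearMap.flip_apply, mulL_apply, smul_mul_assoc, mul_smul_comm, mul_add, add_mul]
  module

theorem dx_add (hF : DifferentiableAt ℝ F z) (hH : DifferentiableAt ℝ H z) :
    dx (fun y => F y + H y) z = dx F z + dx H z := by
  have h : HasFDerivAt (fun y => F y + H y) _ z := hF.hasFDerivAt.add hH.hasFDerivAt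
  rw [dx_eq_of_hasFDerivAt h, dx, dx]
  simp only [_root_.add_apply]
  module

theorem dxt_add (hF : DifferentiableAt ℝ F z) (hH : DifferentiableAt ℝ H z) :
    dxt (fun y => F y + H y) z = dxt F z + dxt H z := by
  have h : HasFDerivAt (fun y => F y + H y) _ z := hF.hasFDerivAt.add hH.hasFDerivAt
  rw [dxt_eq_of_hasFDerivAt h, dxt, dxt]
  simp only [_root_.add_apply]
  module

theorem dx_const (a : Grassmann (n + 1)) (z : ℂ) : dx (fun _ => a) z = 0 := by
  simp [dx]

theorem dxt_const (a : Grassmann (n + 1)) (z : ℂ) : dxt (fun _ => a) z = 0 := by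
  simp [dxt]

theorem dx_clm_comp (L : Grassmann (n + 1) →L[ℂ] Grassmann (n + 1)) (hF : DifferentiableAt ℝ F z) :
    dx (fun y => L (F y)) z = L (dx F z) := by
  have h : HasFDerivAt (fun y => L (F y)) _ z :=
    ((L.restrictScalars ℝ).hasFDerivAt).comp z hF.hasFDerivAt
  rw [dx_eq_of_hasFDerivAt h, dx]
  simp

theorem dxt_clm_comp (L : Grassmann (n + 1) →L[ℂ] Grassmann (n + 1)) (hF : DifferentiableAt ℝ F z) :
    dxt (fun y => L (F y)) z = L (dxt F z) := by
  have h : HasFDerivAt (fun y => L (F y)) _ z :=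
    ((L.restrictScalars ℝ).hasFDerivAt).comp z hF.hasFDerivAt
  rw [dxt_eq_of_hasFDerivAt h, dxt]
  simp

theorem dx_dtheta (hF : DifferentiableAt ℝ F z) : dx (dtheta F) z = dthetaL (dx F z) := by
  rw [dtheta_eq, dx_clm_comp dthetaL hF]

theorem dx_thetaFree (hF : DifferentiableAt ℝ F z) : dx (thetaFree F) z = thetaFreeL (dx F z) := by
  rw [thetaFree_eq, dx_clm_comp thetaFreeL hF]

theorem dxt_dtheta (hF : DifferentiableAt ℝ F z) : dxt (dtheta F) z = dthetaL (dxt F z) := by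
  rw [dtheta_eq, dxt_clm_comp dthetaL hF]

theorem dx_dxt (hF : SmoothOn F V) (hV : IsOpen V) (hz : z ∈ V) :
    dx (dxt F) z = dxt (dx F) z := by
  have second_symm : IsSymmSndFDerivAt ℝ F z :=
    ((hF z hz).contDiffAt (hV.mem_nhds hz)).isSymmSndFDerivAt <| by
      rw [minSmoothness_of_isRCLikeNormedField]
      exact WithTop.coe_le_coe.2 (le_top : (2 : ℕ∞) ≤ ⊤)
  have fderiv_differentiable : DifferentiableAt ℝ (fderiv ℝ F) z :=
    ((hF.fderiv_of_isOpen hV (m := ∞) (by simp)).contDiffAt (hV.mem_nhds hz)).differentiableAt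
      (by simp)
  have hasFDerivAt_fderiv_apply : ∀ w, HasFDerivAt (fun y => fderiv ℝ F y w)
      ((ContinuousLinearMap.apply ℝ _ w) ∘L (fderiv ℝ (fderiv ℝ F) z)) z := fun w =>
    (ContinuousLinearMap.apply ℝ (Grassmann (n + 1)) w).hasFDerivAt.comp z
      fderiv_differentiable.hasFDerivAt
  have hasFDerivAt_smul : ∀ (c : ℂ) {f : SuperFun n} {f' : ℂ →L[ℝ] Grassmann (n + 1)},
      HasFDerivAt f f' z → HasFDerivAt (fun y => c • f y) (c • f') z :=
    fun c _ _ h => h.const_smul c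
  have hasFDerivAt_dxt : HasFDerivAt (dxt F) _ z := hasFDerivAt_smul _
    ((hasFDerivAt_fderiv_apply 1).add
      (hasFDerivAt_smul Complex.I (hasFDerivAt_fderiv_apply Complex.I)))
  have hasFDerivAt_dx : HasFDerivAt (dx F) _ z := hasFDerivAt_smul _
    ((hasFDerivAt_fderiv_apply 1).sub
      (hasFDerivAt_smul Complex.I (hasFDerivAt_fderiv_apply Complex.I)))
  rw [dx_eq_of_hasFDerivAt hasFDerivAt_dxt, dxt_eq_of_hasFDerivAt hasFDerivAt_dx]
  simp only [_root_.smul_apply, _root_.add_apply,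
    _root_.sub_apply, ContinuousLinearMap.comp_apply, ContinuousLinearMap.apply_apply]
  rw [second_symm.eq Complex.I 1]
  module

theorem fderiv_real_I (hF : DifferentiableAt ℂ F z) :
    fderiv ℝ F z Complex.I = Complex.I • fderiv ℝ F z 1 := by
  rw [hF.fderiv_restrictScalars ℝ, ContinuousLinearMap.coe_restrictScalars', ← map_smul,
    smul_eq_mul, mul_one]

theorem dxt_eq_zero_of_differentiableAt (hF : DifferentiableAt ℂ F z) : dxt F z = 0 := by
  rw [dxt, fderiv_real_I hF, smul_smul, Complex.I_mul_I]
  module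

theorem dx_eq_deriv (hF : DifferentiableAt ℂ F z) : dx F z = deriv F z := by
  rw [dx, fderiv_real_I hF, smul_smul, Complex.I_mul_I, hF.fderiv_restrictScalars ℝ,
    ContinuousLinearMap.coe_restrictScalars', fderiv_apply_one_eq_deriv]
  module

end SuperFun

/-! ### Evaluation on Grassmann-valued points -/

namespace SuperFun

open Grassmann

variable {n : ℕ} {F H : SuperFun n} {U V : Set ℂ} {z : ℂ}

/-- The coefficient of the monomial `e_I`, regarded as a scalar of the Grassmann algebra. -/
def coeffL (I : Finset (Fin (n + 1))) : Grassmann (n + 1) →L[ℂ] Grassmann (n + 1) :=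
  (ContinuousLinearMap.proj (R := ℂ) (φ := fun _ => ℂ) I).smulRight (1 : Grassmann (n + 1))

theorem coeffL_apply (I : Finset (Fin (n + 1))) (a : Grassmann (n + 1)) : coeffL I a = a I • 1 :=
  rfl

theorem dx_apply_congr (hV : IsOpen V) (hF : SmoothOn F V) (hH : SmoothOn H V)
    {I : Finset (Fin (n + 1))} (h : ∀ y ∈ V, F y I = H y I) (hz : z ∈ V) :
    dx F z I = dx H z I := by
  have coeff_eqOn : Set.EqOn (fun y => coeffL I (F y)) (fun y => coeffL I (H y)) V :=
    fun y hy => by simp only [coeffL_apply, h y hy]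
  have coeff_eq := dx_eqOn hV coeff_eqOn hz
  rw [dx_clm_comp _ (hF.differentiableAt hV hz), dx_clm_comp _ (hH.differentiableAt hV hz)]
    at coeff_eq
  simpa [coeffL_apply] using congrArg body coeff_eq

theorem dxt_apply_congr (hV : IsOpen V) (hF : SmoothOn F V) (hH : SmoothOn H V)
    {I : Finset (Fin (n + 1))} (h : ∀ y ∈ V, F y I = H y I) (hz : z ∈ V) :
    dxt F z I = dxt H z I := by
  have coeff_eqOn : Set.EqOn (fun y => coeffL I (F y)) (fun y => coeffL I (H y)) V :=
    fun y hy => by simp only [coeffL_apply, h y hy]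
  have coeff_eq := dxt_eqOn hV coeff_eqOn hz
  rw [dxt_clm_comp _ (hF.differentiableAt hV hz), dxt_clm_comp _ (hH.differentiableAt hV hz)]
    at coeff_eq
  simpa [coeffL_apply] using congrArg body coeff_eq

theorem dx_apply_eq_zero (hV : IsOpen V) (hF : SmoothOn F V) {I : Finset (Fin (n + 1))}
    (h : ∀ y ∈ V, F y I = 0) (hz : z ∈ V) : dx F z I = 0 := by
  rw [dx_apply_congr hV hF (smoothOn_const 0) h hz, dx_const, Grassmann.zero_apply]

theorem dxt_apply_eq_zero (hV : IsOpen V) (hF : SmoothOn F V) {I : Finset (Fin (n + 1))}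
    (h : ∀ y ∈ V, F y I = 0) (hz : z ∈ V) : dxt F z I = 0 := by
  rw [dxt_apply_congr hV hF (smoothOn_const 0) h hz, dxt_const, Grassmann.zero_apply]

theorem isEven_dx (hV : IsOpen V) (hF : SmoothOn F V) (h : ∀ y ∈ V, (F y).IsEven) :
    ∀ z ∈ V, (dx F z).IsEven :=
  fun _ hz I hI => dx_apply_eq_zero hV hF (fun y hy => h y hy I hI) hz

theorem isOdd_dx (hV : IsOpen V) (hF : SmoothOn F V) (h : ∀ y ∈ V, (F y).IsOdd) :
    ∀ z ∈ V, (dx F z).IsOdd :=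
  fun _ hz I hI => dx_apply_eq_zero hV hF (fun y hy => h y hy I hI) hz

theorem isEven_dxt (hV : IsOpen V) (hF : SmoothOn F V) (h : ∀ y ∈ V, (F y).IsEven) :
    ∀ z ∈ V, (dxt F z).IsEven :=
  fun _ hz I hI => dxt_apply_eq_zero hV hF (fun y hy => h y hy I hI) hz

theorem isOdd_dxt (hV : IsOpen V) (hF : SmoothOn F V) (h : ∀ y ∈ V, (F y).IsOdd) :
    ∀ z ∈ V, (dxt F z).IsOdd :=
  fun _ hz I hI => dxt_apply_eq_zero hV hF (fun y hy => h y hy I hI) hz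

theorem isEven_iterate_dx (hV : IsOpen V) (hF : SmoothOn F V) (h : ∀ y ∈ V, (F y).IsEven)
    (k : ℕ) : ∀ z ∈ V, (dx^[k] F z).IsEven := by
  induction k with
  | zero => exact h
  | succ k ih =>
    rw [Function.iterate_succ_apply']; exact isEven_dx hV (hF.iterate_dx hV k) ih

theorem isOdd_iterate_dx (hV : IsOpen V) (hF : SmoothOn F V) (h : ∀ y ∈ V, (F y).IsOdd)
    (k : ℕ) : ∀ z ∈ V, (dx^[k] F z).IsOdd := by
  induction k with
  | zero => exact h
  | succ k ih =>
    rw [Function.iterate_succ_apply']; exact isOdd_dx hV (hF.iterate_dx hV k) ih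

/-- The nilpotent part of an element, its difference to its body. -/
def soul (g : Grassmann (n + 1)) : Grassmann (n + 1) := g - algebraMap ℂ _ g.body

/-- The Taylor series `∑ N ^ k X_k / k!` with derivatives `X_k` and a nilpotent increment `N`, cut
off after the power `N ^ (n + 1)`. -/
def taylorSum (N : Grassmann (n + 1)) (X : ℕ → Grassmann (n + 1)) : Grassmann (n + 1) :=
  ∑ k ∈ Finset.range (n + 2), ((k.factorial : ℂ)⁻¹) • (N ^ k * X k)

/-- The value of the superfunction `F` at the Grassmann-valued point `y = g`, `η = ψ`, defined by
Taylor's formula at the body of `g`; the pullback of `F` along a map is its pointwise value. -/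
def evalAt (F : SuperFun n) (g ψ : Grassmann (n + 1)) : Grassmann (n + 1) :=
  taylorSum (soul g) fun k => (dx^[k] (thetaFree F)) g.body + ψ * (dx^[k] (dtheta F)) g.body

theorem pull_apply (u : SuperMap n) (F : SuperFun n) (x : ℂ) :
    u.pull F x = evalAt F (u.even x) (u.odd x) := rfl

theorem body_soul (g : Grassmann (n + 1)) : (soul g).body = 0 := by
  rw [soul, body_sub, body_algebraMap, sub_self]

theorem isEven_soul {g : Grassmann (n + 1)} (hg : g.IsEven) : (soul g).IsEven :=
  hg.sub (isEven_algebraMap _)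

theorem soul_pow {g : Grassmann (n + 1)} (hg : g.IsEven) : soul g ^ (n + 1) = 0 :=
  eq_zero_of_mem_degreeGE (by omega)
    (pow_mem_degreeGE ((isEven_soul hg).mem_degreeGE_two (body_soul g)) (n + 1))

-- Differentiating the powers of the increment shifts the derivatives in the Taylor series.
theorem sum_pow_pred_mul_eq_taylorSum_succ {N : Grassmann (n + 1)} (hN : N ^ (n + 1) = 0)
    (X : ℕ → Grassmann (n + 1)) :
    ∑ k ∈ Finset.range (n + 2), ((k.factorial : ℂ)⁻¹) • ((k : ℂ) • (N ^ (k - 1) * X k)) =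
      taylorSum N fun k => X (k + 1) := by
  rw [taylorSum, Finset.sum_range_succ', Finset.sum_range_succ _ (n + 1), hN]
  simp only [Nat.cast_zero, zero_smul, smul_zero, add_zero, zero_mul]
  refine Finset.sum_congr rfl fun k _ => ?_
  rw [smul_smul, Nat.add_sub_cancel, Nat.factorial_succ]
  congr 1
  push_cast
  have : (k + 1 : ℂ) ≠ 0 := by exact_mod_cast Nat.succ_ne_zero k
  field_simp

theorem taylorSum_add (N : Grassmann (n + 1)) (X Y : ℕ → Grassmann (n + 1)) :
    taylorSum N (fun k => X k + Y k) = taylorSum N X + taylorSum N Y := by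
  simp only [taylorSum, mul_add, smul_add, Finset.sum_add_distrib]

theorem taylorSum_smul (N : Grassmann (n + 1)) (c : ℂ) (X : ℕ → Grassmann (n + 1)) :
    taylorSum N (fun k => c • X k) = c • taylorSum N X := by
  simp only [taylorSum, mul_smul_comm, Finset.smul_sum, smul_comm c]

theorem taylorSum_mul_left {N : Grassmann (n + 1)} (hN : N.IsEven) (a : Grassmann (n + 1))
    (X : ℕ → Grassmann (n + 1)) : taylorSum N (fun k => a * X k) = a * taylorSum N X := by
  simp only [taylorSum, Finset.mul_sum, mul_smul_comm, ← mul_assoc, (hN.pow _).mul_comm a]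

theorem iterate_dx_dxt (hV : IsOpen V) (hF : SmoothOn F V) (k : ℕ) :
    Set.EqOn (dx^[k] (dxt F)) (dxt (dx^[k] F)) V := by
  induction k with
  | zero => exact fun _ _ => rfl
  | succ k ih =>
    intro z hz
    rw [Function.iterate_succ_apply', Function.iterate_succ_apply', dx_eqOn hV ih hz,
      dx_dxt (hF.iterate_dx hV k) hV hz]

theorem iterate_dx_clm_comp (hV : IsOpen V) (hF : SmoothOn F V)
    (L : Grassmann (n + 1) →L[ℂ] Grassmann (n + 1)) (k : ℕ) :
    Set.EqOn (dx^[k] fun y => L (F y)) (fun y => L (dx^[k] F y)) V := by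
  induction k with
  | zero => exact fun _ _ => rfl
  | succ k ih =>
    intro z hz
    simp only [Function.iterate_succ_apply']
    rw [dx_eqOn hV ih hz, dx_clm_comp L ((hF.iterate_dx hV k).differentiableAt hV hz)]

theorem fderiv_iterate_dx_clm_comp (hV : IsOpen V) (hF : SmoothOn F V)
    (L : Grassmann (n + 1) →L[ℂ] Grassmann (n + 1)) (k : ℕ) (hz : z ∈ V) (c : ℂ) :
    fderiv ℝ (dx^[k] fun y => L (F y)) z c =
      c • L (dx^[k] (dx F) z) + (starRingEnd ℂ) c • L (dx^[k] (dxt F) z) := by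
  have differentiable := (hF.iterate_dx hV k).differentiableAt hV hz
  rw [fderiv_eq_smul_dx_add_smul_dxt, dx_eqOn hV (iterate_dx_clm_comp hV hF L k) hz,
    dxt_eqOn hV (iterate_dx_clm_comp hV hF L k) hz, dx_clm_comp L differentiable,
    dxt_clm_comp L differentiable, iterate_dx_dxt hV hF k hz, ← Function.iterate_succ_apply' dx,
    Function.iterate_succ_apply]

theorem evalAt_eq (hV : IsOpen V) (hF : SmoothOn F V) {g : Grassmann (n + 1)} (hg : g.body ∈ V)
    (ψ : Grassmann (n + 1)) : evalAt F g ψ = taylorSum (soul g) fun k =>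
      thetaFreeL (dx^[k] F g.body) + ψ * dthetaL (dx^[k] F g.body) := by
  simp only [evalAt, thetaFree_eq, dtheta_eq, iterate_dx_clm_comp hV hF _ _ hg]

theorem thetaFree_dtheta (F : SuperFun n) : thetaFree (dtheta F) = dtheta F :=
  funext fun z => by rw [thetaFree_apply, dtheta_apply, thetaFreeL_dthetaL]

theorem dtheta_dtheta (F : SuperFun n) : dtheta (dtheta F) = fun _ => 0 :=
  funext fun z => by rw [dtheta_apply, dtheta_apply, dthetaL_dthetaL]

theorem iterate_dx_zero (k : ℕ) : dx^[k] (fun _ => (0 : Grassmann (n + 1))) = fun _ => 0 := by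
  induction k with
  | zero => rfl
  | succ k ih => rw [Function.iterate_succ_apply', ih]; exact funext fun z => dx_const 0 z

theorem evalAt_dtheta (F : SuperFun n) (g ψ : Grassmann (n + 1)) :
    evalAt (dtheta F) g ψ = taylorSum (soul g) fun k => (dx^[k] (dtheta F)) g.body := by
  simp only [evalAt, thetaFree_dtheta, dtheta_dtheta, iterate_dx_zero, mul_zero, add_zero]

theorem evalAt_algebraMap (F : SuperFun n) (c : ℂ) (ψ : Grassmann (n + 1)) :
    evalAt F (algebraMap ℂ _ c) ψ = thetaFreeL (F c) + ψ * dthetaL (F c) := by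
  have : soul (algebraMap ℂ (Grassmann (n + 1)) c) = 0 := by rw [soul, body_algebraMap, sub_self]
  rw [evalAt, this, taylorSum, Finset.sum_range_succ', body_algebraMap]
  simp [thetaFree_apply, dtheta_apply]

theorem evalAt_congr (hV : IsOpen V) (h : Set.EqOn F H V) {g : Grassmann (n + 1)} (hg : g.body ∈ V)
    (ψ : Grassmann (n + 1)) : evalAt F g ψ = evalAt H g ψ := by
  simp only [evalAt]
  congr 1
  funext k
  rw [iterate_dx_eqOn hV (fun y hy => ?_) k hg (F := thetaFree F) (H := thetaFree H),
    iterate_dx_eqOn hV (fun y hy => ?_) k hg (F := dtheta F) (H := dtheta H)]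
  · rw [dtheta_apply, dtheta_apply, h hy]
  · rw [thetaFree_apply, thetaFree_apply, h hy]

theorem iterate_dx_add (hV : IsOpen V) (hF : SmoothOn F V) (hH : SmoothOn H V) (k : ℕ) :
    Set.EqOn (dx^[k] fun y => F y + H y) (fun y => dx^[k] F y + dx^[k] H y) V := by
  induction k with
  | zero => exact fun _ _ => rfl
  | succ k ih =>
    intro z hz
    simp only [Function.iterate_succ_apply']
    rw [dx_eqOn hV ih hz, dx_add ((hF.iterate_dx hV k).differentiableAt hV hz)
      ((hH.iterate_dx hV k).differentiableAt hV hz)]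

theorem evalAt_add (hV : IsOpen V) (hF : SmoothOn F V) (hH : SmoothOn H V) {g : Grassmann (n + 1)}
    (hg : g.body ∈ V) (ψ : Grassmann (n + 1)) :
    evalAt (fun y => F y + H y) g ψ = evalAt F g ψ + evalAt H g ψ := by
  simp only [evalAt_eq hV (hF.add hH) hg, evalAt_eq hV hF hg, evalAt_eq hV hH hg, ← taylorSum_add,
    iterate_dx_add hV hF hH _ hg, map_add, mul_add, add_add_add_comm]

theorem thetaFreeL_soul (g : Grassmann (n + 1)) : thetaFreeL (soul g) = soul (thetaFreeL g) := by
  rw [soul, soul, map_sub, thetaFreeL_algebraMap, body_thetaFreeL]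

theorem thetaFreeL_evalAt (hV : IsOpen V) (hF : SmoothOn F V) {g : Grassmann (n + 1)}
    (hg : g.body ∈ V) (ψ : Grassmann (n + 1)) :
    thetaFreeL (evalAt F g ψ) = evalAt F (thetaFreeL g) (thetaFreeL ψ) := by
  rw [evalAt_eq hV hF hg, evalAt_eq hV hF (by rwa [body_thetaFreeL])]
  simp only [taylorSum, map_sum, map_smul, map_add, thetaFreeL_mul, thetaFreeL_pow,
    thetaFreeL_soul, thetaFreeL_thetaFreeL, thetaFreeL_dthetaL, body_thetaFreeL]

theorem gradeInvolL_evalAt (hV : IsOpen V) (hF : SmoothOn F V) {g ψ : Grassmann (n + 1)}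
    (hg : g.body ∈ V) (hge : g.IsEven) (hψ : ψ.IsOdd) :
    gradeInvolL _ (evalAt F g ψ) = evalAt (fun y => gradeInvolL _ (F y)) g ψ := by
  rw [evalAt_eq hV hF hg, evalAt_eq hV (contDiffOn_clm_comp _ hF) hg]
  simp only [taylorSum, map_sum, map_smul, map_add, gradeInvolL_mul,
    ((isEven_soul hge).pow _).gradeInvolL_eq, hψ.gradeInvolL_eq,
    iterate_dx_clm_comp hV hF _ _ hg, thetaFreeL_gradeInvolL, dthetaL_gradeInvolL, neg_mul, mul_neg]

theorem body_evalAt (F : SuperFun n) (g : Grassmann (n + 1)) {ψ : Grassmann (n + 1)}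
    (hψ : ψ.body = 0) : (evalAt F g ψ).body = (F g.body).body := by
  have sub_mem : evalAt F g ψ - thetaFreeL (F g.body) ∈ degreeGE (n + 1) 1 := by
    rw [evalAt, taylorSum, Finset.sum_range_succ', pow_zero, one_mul, Nat.factorial_zero,
      Nat.cast_one, inv_one, one_smul, Function.iterate_zero_apply, Function.iterate_zero_apply,
      thetaFree_apply, add_sub_assoc, add_sub_cancel_left]
    refine add_mem (sum_mem fun k _ => Submodule.smul_mem _ _ ?_)
      (mul_mem_degreeGE_left _ (mem_degreeGE_one.2 hψ))
    rw [pow_succ', mul_assoc]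
    exact mul_mem_degreeGE_left _ (mem_degreeGE_one.2 (body_soul g))
  have body_eq_zero := mem_degreeGE_one.1 sub_mem
  rwa [body_sub, body_thetaFreeL, sub_eq_zero] at body_eq_zero

theorem isEven_evalAt (hV : IsOpen V) (hF : SmoothOn F V) (h : ∀ y ∈ V, (F y).IsEven)
    {g ψ : Grassmann (n + 1)} (hg : g.body ∈ V) (hge : g.IsEven) (hψ : ψ.IsOdd) :
    (evalAt F g ψ).IsEven := by
  have even_deriv := fun k => isEven_iterate_dx hV hF h k _ hg
  rw [evalAt_eq hV hF hg, taylorSum]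
  exact IsEven.sum fun k _ => (((isEven_soul hge).pow k).mul
    ((even_deriv k).thetaFreeL.add (hψ.mul (even_deriv k).dthetaL))).smul _

theorem isOdd_evalAt (hV : IsOpen V) (hF : SmoothOn F V) (h : ∀ y ∈ V, (F y).IsOdd)
    {g ψ : Grassmann (n + 1)} (hg : g.body ∈ V) (hge : g.IsEven) (hψ : ψ.IsOdd) :
    (evalAt F g ψ).IsOdd := by
  have odd_deriv := fun k => isOdd_iterate_dx hV hF h k _ hg
  rw [evalAt_eq hV hF hg, taylorSum]
  exact IsOdd.sum fun k _ => (((isEven_soul hge).pow k).mul_isOdd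
    ((odd_deriv k).thetaFreeL.add (hψ.mul_isEven (odd_deriv k).dthetaL))).smul _

theorem contDiffOn_evalAt (hV : IsOpen V) (hF : SmoothOn F V) :
    ContDiffOn ℝ ∞ (fun p : Grassmann (n + 1) × Grassmann (n + 1) => evalAt F p.1 p.2)
      {p | p.1.body ∈ V} := by
  have body_smooth : ContDiffOn ℝ ∞ (fun p : Grassmann (n + 1) × Grassmann (n + 1) => p.1.body)
      {p | p.1.body ∈ V} := contDiffOn_clm_comp (bodyL (n + 1)) contDiff_fst.contDiffOn
  have soul_smooth : ContDiffOn ℝ ∞ (fun p : Grassmann (n + 1) × Grassmann (n + 1) => soul p.1)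
      {p | p.1.body ∈ V} :=
    contDiff_fst.contDiffOn.sub
      ((smoothOn_algebraMap (V := Set.univ)).comp body_smooth fun _ _ => trivial)
  simp only [evalAt, taylorSum]
  refine ContDiffOn.sum fun k _ =>
    contDiffOn_smul _ (contDiffOn_mul (contDiffOn_pow soul_smooth k) ?_)
  exact ((hF.thetaFree.iterate_dx hV k).comp body_smooth fun _ h => h).add
    (contDiffOn_mul contDiff_snd.contDiffOn
      ((hF.dtheta.iterate_dx hV k).comp body_smooth fun _ h => h))

section Chain

variable {E : Type*} [NormedAddCommGroup E] [NormedSpace ℝ E]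

theorem hasFDerivAt_pow_of_isEven {f : E → Grassmann (n + 1)} {f' : E →L[ℝ] Grassmann (n + 1)}
    {x : E} (hf : HasFDerivAt f f' x) (he : (f x).IsEven) (k : ℕ) :
    HasFDerivAt (fun y => f y ^ k)
      ((k : ℂ) • ((mulL (n + 1)).flip (f x ^ (k - 1)) ∘L f')) x := by
  induction k with
  | zero => simpa using hasFDerivAt_const (1 : Grassmann (n + 1)) x
  | succ k ih =>
    simp only [pow_succ]
    refine (hasFDerivAt_mul ih hf).congr_fderiv ?_
    ext1 v
    simp only [_root_.add_apply, _root_.smul_apply, ContinuousLinearMap.comp_apply,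
      ContinuousLinearMap.flip_apply, mulL_apply, Nat.add_sub_cancel]
    rw [(he.pow k).mul_comm]
    rcases k with _ | k
    · simp
    · simp only [Nat.add_sub_cancel, smul_mul_assoc, mul_assoc, ← pow_succ]
      push_cast
      module

theorem exists_hasFDerivAt_taylorSum {N : E → Grassmann (n + 1)} {X : ℕ → E → Grassmann (n + 1)}
    {N' : E →L[ℝ] Grassmann (n + 1)} {X' : ℕ → E →L[ℝ] Grassmann (n + 1)} {x : E}
    (hN : HasFDerivAt N N' x) (hX : ∀ k, HasFDerivAt (X k) (X' k) x) (even : (N x).IsEven)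
    (nilpotent : N x ^ (n + 1) = 0) :
    ∃ L : E →L[ℝ] Grassmann (n + 1), HasFDerivAt (fun y => taylorSum (N y) fun k => X k y) L x ∧
      ∀ v, L v = N' v * taylorSum (N x) (fun k => X (k + 1) x) +
        taylorSum (N x) fun k => X' k v := by
  have term_hasFDerivAt : ∀ k : ℕ,
      HasFDerivAt (fun y => ((k.factorial : ℂ)⁻¹) • (N y ^ k * X k y)) _ x := fun k =>
    (hasFDerivAt_mul (hasFDerivAt_pow_of_isEven hN even k) (hX k)).const_smul
      ((k.factorial : ℂ)⁻¹)
  simp only [taylorSum]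
  refine ⟨_, HasFDerivAt.fun_sum fun k _ => term_hasFDerivAt k, fun v => ?_⟩
  rw [← taylorSum, ← taylorSum,
    ← sum_pow_pred_mul_eq_taylorSum_succ nilpotent (fun k => X k x), taylorSum, Finset.mul_sum,
    ← Finset.sum_add_distrib, _root_.sum_apply]
  refine Finset.sum_congr rfl fun k _ => ?_
  simp only [_root_.add_apply, _root_.smul_apply, ContinuousLinearMap.comp_apply,
    ContinuousLinearMap.flip_apply, mulL_apply, mul_smul_comm, smul_mul_assoc, mul_assoc, smul_add]
  exact add_comm _ _

theorem hasFDerivAt_soul {g : E → Grassmann (n + 1)} {g' : E →L[ℝ] Grassmann (n + 1)} {x : E}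
    (hg : HasFDerivAt g g' x) : HasFDerivAt (fun y => soul (g y))
      (g' - ((bodyL (n + 1)).smulRight (1 : Grassmann (n + 1))).restrictScalars ℝ ∘L g') x := by
  have := hg.sub ((((bodyL (n + 1)).smulRight
    (1 : Grassmann (n + 1))).restrictScalars ℝ).hasFDerivAt.comp x hg)
  refine this.congr_of_eventuallyEq (Filter.Eventually.of_forall fun y => ?_)
  simp [soul, Algebra.algebraMap_eq_smul_one, bodyL_apply]

theorem evalAt_dx (hV : IsOpen V) (hF : SmoothOn F V) {g : Grassmann (n + 1)} (hg : g.body ∈ V)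
    (ψ : Grassmann (n + 1)) : evalAt (dx F) g ψ = taylorSum (soul g) fun k =>
      dx^[k + 1] (thetaFree F) g.body + ψ * dx^[k + 1] (dtheta F) g.body := by
  simp only [evalAt_eq hV (hF.dx hV) hg, thetaFree_eq, dtheta_eq,
    iterate_dx_clm_comp hV hF _ _ hg, Function.iterate_succ_apply]

theorem taylorSum_fderiv (hV : IsOpen V) (hF : SmoothOn F V) {g : Grassmann (n + 1)}
    (he : g.IsEven) (hg : g.body ∈ V) (ψ ψ' : Grassmann (n + 1)) (c : ℂ) :
    taylorSum (soul g) (fun k => fderiv ℝ (dx^[k] (thetaFree F)) g.body c +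
      (ψ * fderiv ℝ (dx^[k] (dtheta F)) g.body c + ψ' * dx^[k] (dtheta F) g.body)) =
    c • evalAt (dx F) g ψ + (starRingEnd ℂ) c • evalAt (dxt F) g ψ +
      ψ' * evalAt (dtheta F) g ψ := by
  rw [evalAt_dtheta, evalAt_eq hV (hF.dx hV) hg, evalAt_eq hV (hF.dxt hV) hg, ← taylorSum_smul,
    ← taylorSum_smul, ← taylorSum_mul_left (isEven_soul he), ← taylorSum_add, ← taylorSum_add]
  congr 1
  funext k
  rw [thetaFree_eq, dtheta_eq, fderiv_iterate_dx_clm_comp hV hF _ k hg,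
    fderiv_iterate_dx_clm_comp hV hF _ k hg, mul_add, mul_smul_comm, mul_smul_comm]
  module

-- The chain rule: moving the point moves its body as well as its soul, and the two contributions
-- of `∂/∂x` add up to the full increment `g' v`.
theorem exists_hasFDerivAt_evalAt (hV : IsOpen V) (hF : SmoothOn F V) {g ψ : E → Grassmann (n + 1)}
    {g' ψ' : E →L[ℝ] Grassmann (n + 1)} {x : E} (hg : HasFDerivAt g g' x)
    (hψ : HasFDerivAt ψ ψ' x) (he : (g x).IsEven) (hx : (g x).body ∈ V) :
    ∃ L : E →L[ℝ] Grassmann (n + 1), HasFDerivAt (fun y => evalAt F (g y) (ψ y)) L x ∧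
      ∀ v, L v = g' v * evalAt (dx F) (g x) (ψ x) +
        (starRingEnd ℂ) (g' v).body • evalAt (dxt F) (g x) (ψ x) +
        ψ' v * evalAt (dtheta F) (g x) (ψ x) := by
  have hasFDerivAt_comp_body : ∀ {K : SuperFun n}, SmoothOn K V →
      HasFDerivAt (fun y => K ((g y).body))
        (fderiv ℝ K (g x).body ∘L ((bodyL (n + 1)).restrictScalars ℝ ∘L g')) x := fun hK =>
    (hK.differentiableAt hV hx).hasFDerivAt.comp x
      (((bodyL (n + 1)).restrictScalars ℝ).hasFDerivAt.comp x hg)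
  have coeff_hasFDerivAt : ∀ k : ℕ, HasFDerivAt (fun y => dx^[k] (thetaFree F) (g y).body +
      ψ y * dx^[k] (dtheta F) (g y).body) _ x := fun k =>
    (hasFDerivAt_comp_body (hF.thetaFree.iterate_dx hV k)).add
      (hasFDerivAt_mul hψ (hasFDerivAt_comp_body (hF.dtheta.iterate_dx hV k)))
  obtain ⟨L, hL, hLv⟩ := exists_hasFDerivAt_taylorSum (hasFDerivAt_soul hg) coeff_hasFDerivAt
    (isEven_soul he) (soul_pow he)
  refine ⟨L, hL, fun v => ?_⟩
  have increment : (g' - ((bodyL (n + 1)).smulRight (1 : Grassmann (n + 1))).restrictScalars ℝ ∘L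
      g') v = g' v - (g' v).body • 1 := by
    simp [bodyL_apply]
  rw [hLv, increment, ← evalAt_dx hV hF hx]
  refine (congrArg (_ + ·) (taylorSum_fderiv hV hF he hx (ψ x) (ψ' v) (g' v).body)).trans ?_
  rw [sub_mul, smul_mul_assoc, one_mul]
  abel

end Chain

end SuperFun

/-! ### Evaluation along rays and functoriality of pullback -/

namespace SuperFun

open Grassmann

variable {n : ℕ} {F H : SuperFun n} {U V : Set ℂ} {z : ℂ}

theorem hasDerivAt_evalAt (hV : IsOpen V) (hF : SmoothOn F V) {g ψ : ℝ → Grassmann (n + 1)}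
    {g' ψ' : Grassmann (n + 1)} {t : ℝ} (hg : HasDerivAt g g' t) (hψ : HasDerivAt ψ ψ' t)
    (he : (g t).IsEven) (hx : (g t).body ∈ V) (body_deriv : g'.body = 0) :
    HasDerivAt (fun y => evalAt F (g y) (ψ y))
      (g' * evalAt (dx F) (g t) (ψ t) + ψ' * evalAt (dtheta F) (g t) (ψ t)) t := by
  obtain ⟨L, hL, hLv⟩ := exists_hasFDerivAt_evalAt hV hF hg.hasFDerivAt hψ.hasFDerivAt he hx
  simpa [hLv, body_deriv] using hL.hasDerivAt

/-- The straight path from the body of `g` to `g`. -/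
def scaleSoul (g : Grassmann (n + 1)) (t : ℝ) : Grassmann (n + 1) :=
  algebraMap ℂ _ g.body + t • soul g

theorem scaleSoul_one (g : Grassmann (n + 1)) : scaleSoul g 1 = g := by
  rw [scaleSoul, one_smul, soul, add_sub_cancel]

theorem scaleSoul_zero (g : Grassmann (n + 1)) : scaleSoul g 0 = algebraMap ℂ _ g.body := by
  rw [scaleSoul, zero_smul, add_zero]

theorem body_scaleSoul (g : Grassmann (n + 1)) (t : ℝ) : (scaleSoul g t).body = g.body := by
  rw [scaleSoul, real_smul_eq, body_add, body_algebraMap, body_smul, body_soul, mul_zero, add_zero]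

theorem isEven_scaleSoul {g : Grassmann (n + 1)} (hg : g.IsEven) (t : ℝ) :
    (scaleSoul g t).IsEven := by
  rw [scaleSoul, real_smul_eq]
  exact (isEven_algebraMap _).add ((isEven_soul hg).smul _)

theorem isOdd_real_smul {ψ : Grassmann (n + 1)} (hψ : ψ.IsOdd) (t : ℝ) : (t • ψ).IsOdd := by
  rw [real_smul_eq]; exact hψ.smul _

theorem hasDerivAt_scaleSoul (g : Grassmann (n + 1)) (t : ℝ) :
    HasDerivAt (scaleSoul g) (soul g) t := by
  have := ((hasDerivAt_id t).smul_const (soul g)).const_add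
    (algebraMap ℂ (Grassmann (n + 1)) g.body)
  rwa [one_smul] at this

/-- The values of `F` along the straight path from the body of `(g | ψ)` to `(g | ψ)`; identities
between values of superfunctions are proved by differentiating along this path. -/
def evalRay (g ψ : Grassmann (n + 1)) (F : SuperFun n) (t : ℝ) : Grassmann (n + 1) :=
  evalAt F (scaleSoul g t) (t • ψ)

theorem evalRay_zero (g ψ : Grassmann (n + 1)) (F : SuperFun n) :
    evalRay g ψ F 0 = thetaFreeL (F g.body) := by
  rw [evalRay, scaleSoul_zero, zero_smul, evalAt_algebraMap, zero_mul, add_zero]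

theorem evalRay_one (g ψ : Grassmann (n + 1)) (F : SuperFun n) :
    evalRay g ψ F 1 = evalAt F g ψ := by
  rw [evalRay, scaleSoul_one, one_smul]

theorem hasDerivAt_evalRay (hV : IsOpen V) (hF : SmoothOn F V) {g : Grassmann (n + 1)}
    (hg : g.IsEven) (hb : g.body ∈ V) (ψ : Grassmann (n + 1)) (t : ℝ) :
    HasDerivAt (evalRay g ψ F)
      (soul g * evalRay g ψ (dx F) t + ψ * evalRay g ψ (dtheta F) t) t := by
  have hasDerivAt_smul : HasDerivAt (fun t : ℝ => t • ψ) ψ t := by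
    simpa using (hasDerivAt_id t).smul_const ψ
  exact hasDerivAt_evalAt hV hF (hasDerivAt_scaleSoul g t) hasDerivAt_smul
    (isEven_scaleSoul hg t) (by rwa [body_scaleSoul]) (body_soul g)

theorem hasDerivAt_mul {m : ℕ} {f g : ℝ → Grassmann m} {f' g' : Grassmann m} {t : ℝ}
    (hf : HasDerivAt f f' t) (hg : HasDerivAt g g' t) :
    HasDerivAt (fun t => f t * g t) (f' * g t + f t * g') t := by
  simpa [mulL_apply, add_comm] using (hasFDerivAt_mul hf.hasFDerivAt hg.hasFDerivAt).hasDerivAt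

theorem evalAt_dx_mul (hV : IsOpen V) (hF : SmoothOn F V) (hH : SmoothOn H V)
    {g : Grassmann (n + 1)} (hg : g.body ∈ V) (ψ : Grassmann (n + 1)) :
    evalAt (dx fun y => F y * H y) g ψ =
      evalAt (fun y => dx F y * H y) g ψ + evalAt (fun y => F y * dx H y) g ψ := by
  rw [← evalAt_add hV ((hF.dx hV).mul hH) (hF.mul (hH.dx hV)) hg]
  exact evalAt_congr hV
    (fun y hy => dx_mul (hF.differentiableAt hV hy) (hH.differentiableAt hV hy)) hg ψ

theorem evalAt_dtheta_mul (hV : IsOpen V) (hF : SmoothOn F V) (hH : SmoothOn H V)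
    {g : Grassmann (n + 1)} (hg : g.body ∈ V) (ψ : Grassmann (n + 1)) :
    evalAt (dtheta fun y => F y * H y) g ψ = evalAt (fun y => dtheta F y * H y) g ψ +
      evalAt (fun y => gradeInvolL _ (F y) * dtheta H y) g ψ := by
  rw [← evalAt_add hV (hF.dtheta.mul hH)
    (SmoothOn.mul (contDiffOn_clm_comp (gradeInvolL _) hF) hH.dtheta) hg]
  simp only [dtheta_eq, dthetaL_mul]

theorem hasDerivAt_evalRay_mul (hV : IsOpen V) (hF : SmoothOn F V) (hH : SmoothOn H V)
    {g : Grassmann (n + 1)} (hg : g.IsEven) (hb : g.body ∈ V) (ψ : Grassmann (n + 1)) (t : ℝ) :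
    HasDerivAt (evalRay g ψ fun y => F y * H y)
      (soul g * (evalRay g ψ (fun y => dx F y * H y) t + evalRay g ψ (fun y => F y * dx H y) t) +
        ψ * (evalRay g ψ (fun y => dtheta F y * H y) t +
          evalRay g ψ (fun y => gradeInvolL _ (F y) * dtheta H y) t)) t := by
  have hbt : (scaleSoul g t).body ∈ V := by rwa [body_scaleSoul]
  refine (hasDerivAt_evalRay hV (hF.mul hH) hg hb ψ t).congr_deriv ?_
  simp only [evalRay]
  rw [evalAt_dx_mul hV hF hH hbt, evalAt_dtheta_mul hV hF hH hbt]

-- The defect of multiplicativity along a ray has a derivative made of defects of other pairs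
-- times nilpotent factors, so it vanishes to every order.
theorem evalAt_mul (hV : IsOpen V) (hF : SmoothOn F V) (hH : SmoothOn H V)
    {g ψ : Grassmann (n + 1)} (hg : g.IsEven) (hψ : ψ.IsOdd) (hb : g.body ∈ V) :
    evalAt (fun y => F y * H y) g ψ = evalAt F g ψ * evalAt H g ψ := by
  let SmoothPair := {p : SuperFun n × SuperFun n // SmoothOn p.1 V ∧ SmoothOn p.2 V}
  let defect : SmoothPair → ℝ → Grassmann (n + 1) := fun p t =>
    evalRay g ψ (fun y => p.1.1 y * p.1.2 y) t - evalRay g ψ p.1.1 t * evalRay g ψ p.1.2 t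
  let invol (F : SuperFun n) : SuperFun n := fun y => gradeInvolL _ (F y)
  have smooth_invol {F : SuperFun n} (hF : SmoothOn F V) : SmoothOn (invol F) V :=
    contDiffOn_clm_comp _ hF
  let defect' : SmoothPair → ℝ → Grassmann (n + 1) := fun p t =>
    soul g * (defect ⟨(dx p.1.1, p.1.2), p.2.1.dx hV, p.2.2⟩ t +
      defect ⟨(p.1.1, dx p.1.2), p.2.1, p.2.2.dx hV⟩ t) +
    ψ * (defect ⟨(dtheta p.1.1, p.1.2), p.2.1.dtheta, p.2.2⟩ t +
      defect ⟨(invol p.1.1, dtheta p.1.2), smooth_invol p.2.1, p.2.2.dtheta⟩ t)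
  have defect_eq_zero : ∀ p t, defect p t = 0 := by
    refine eq_zero_of_deriv_mem_degreeGE (Δ' := defect') ?_ ?_ fun k degree_k p t => ?_
    · intro p
      simp only [defect, evalRay_zero, thetaFreeL_mul, sub_self]
    · rintro ⟨⟨F, H⟩, hF, hH⟩ t
      have hbt : (scaleSoul g t).body ∈ V := by rwa [body_scaleSoul]
      have odd_comm : ψ * evalRay g ψ (invol F) t = evalRay g ψ F t * ψ := by
        rw [← hψ.mul_gradeInvolL, evalRay,
          ← gradeInvolL_evalAt hV hF hbt (isEven_scaleSoul hg t) (isOdd_real_smul hψ t), evalRay]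
      refine ((hasDerivAt_evalRay_mul hV hF hH hg hb ψ t).sub
        (hasDerivAt_mul (hasDerivAt_evalRay hV hF hg hb ψ t)
          (hasDerivAt_evalRay hV hH hg hb ψ t))).congr_deriv ?_
      simp only [defect', defect, mul_add, add_mul, mul_sub, ← mul_assoc, odd_comm,
        ← (isEven_soul hg).mul_comm (evalRay g ψ F t)]
      abel
    · rw [add_comm k]
      exact add_mem (mul_mem_degreeGE (mem_degreeGE_one.2 (body_soul g))
          (add_mem (degree_k _ t) (degree_k _ t)))
        (mul_mem_degreeGE hψ.mem_degreeGE_one (add_mem (degree_k _ t) (degree_k _ t)))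
  simpa only [defect, evalRay_one, sub_eq_zero] using defect_eq_zero ⟨(F, H), hF, hH⟩ 1

end SuperFun

namespace SuperMap

open Grassmann

variable {n : ℕ} {F : SuperFun n} {U V : Set ℂ} {z : ℂ} {u : SuperMap n}

theorem IsSmooth.smoothOn_pull (hu : u.IsSmooth U V) (hV : IsOpen V) (hF : SmoothOn F V) :
    SmoothOn (u.pull F) U := by
  have coordinates_smooth : ContDiffOn ℝ ∞ (fun x => (u.even x, u.odd x)) U :=
    ContDiffOn.prodMk hu.smooth_even hu.smooth_odd
  exact ((contDiffOn_evalAt hV hF).comp coordinates_smooth fun _ hx => hu.mapsTo hx).congr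
    fun _ _ => rfl

theorem IsSmooth.mono (hu : u.IsSmooth U V) {U' : Set ℂ} (h : U' ⊆ U) {V' : Set ℂ}
    (h' : Set.MapsTo u.base U' V') : u.IsSmooth U' V' :=
  ⟨hu.smooth_even.mono h, hu.smooth_odd.mono h, fun x hx => hu.isEven x (h hx),
    fun x hx => hu.isOdd x (h hx), h'⟩

theorem IsSmooth.exists_hasFDerivAt_pull (hu : u.IsSmooth U V) (hU : IsOpen U) (hV : IsOpen V)
    (hF : SmoothOn F V) (hz : z ∈ U) :
    ∃ L : ℂ →L[ℝ] Grassmann (n + 1), HasFDerivAt (u.pull F) L z ∧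
      ∀ v, L v = fderiv ℝ u.even z v * u.pull (dx F) z +
        (starRingEnd ℂ) (fderiv ℝ u.even z v).body • u.pull (dxt F) z +
        fderiv ℝ u.odd z v * u.pull (dtheta F) z :=
  exists_hasFDerivAt_evalAt hV hF (hu.smooth_even.differentiableAt hU hz).hasFDerivAt
    (hu.smooth_odd.differentiableAt hU hz).hasFDerivAt (hu.isEven z hz) (hu.mapsTo hz)

theorem IsSmooth.dx_pull (hu : u.IsSmooth U V) (hU : IsOpen U) (hV : IsOpen V)
    (hF : SmoothOn F V) (hz : z ∈ U) :
    dx (u.pull F) z = dx u.even z * u.pull (dx F) z +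
      (starRingEnd ℂ) (dxt u.even z).body • u.pull (dxt F) z +
      dx u.odd z * u.pull (dtheta F) z := by
  obtain ⟨L, hL, hLv⟩ := hu.exists_hasFDerivAt_pull hU hV hF hz
  rw [dx_eq_of_hasFDerivAt hL, hLv, hLv, dx, dxt, dx]
  simp only [body_smul, body_add, map_mul, map_add, map_one, map_div₀, map_ofNat,
    Complex.conj_I, smul_add, smul_smul, smul_mul_assoc, sub_mul, smul_sub]
  module

theorem IsSmooth.dxt_pull (hu : u.IsSmooth U V) (hU : IsOpen U) (hV : IsOpen V)
    (hF : SmoothOn F V) (hz : z ∈ U) :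
    dxt (u.pull F) z = dxt u.even z * u.pull (dx F) z +
      (starRingEnd ℂ) (dx u.even z).body • u.pull (dxt F) z +
      dxt u.odd z * u.pull (dtheta F) z := by
  obtain ⟨L, hL, hLv⟩ := hu.exists_hasFDerivAt_pull hU hV hF hz
  rw [dxt_eq_of_hasFDerivAt hL, hLv, hLv, dx, dxt, dxt]
  simp only [body_smul, body_sub, map_mul, map_sub, map_one, map_div₀,
    map_ofNat, Complex.conj_I, smul_add, smul_smul, smul_mul_assoc, add_mul]
  module

theorem dthetaL_evalAt (hV : IsOpen V) (hF : SmoothOn F V) {g ψ : Grassmann (n + 1)}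
    (he : g.IsEven) (ho : ψ.IsOdd) (hg : g.body ∈ V) :
    dthetaL (evalAt F g ψ) =
      dthetaL g * evalAt (dx F) g ψ + dthetaL ψ * evalAt (dtheta F) g ψ := by
  have dthetaL_soul : dthetaL (soul g) = dthetaL g := by
    rw [soul, map_sub, dthetaL_algebraMap, sub_zero]
  have soul_even := isEven_soul he
  have dtheta_deriv := iterate_dx_clm_comp hV hF dthetaL
  rw [← dtheta_eq] at dtheta_deriv
  simp only [evalAt_dtheta, evalAt_eq hV (hF.dx hV) hg, evalAt_eq hV hF hg, dtheta_deriv _ hg,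
    ← Function.iterate_succ_apply dx]
  rw [← sum_pow_pred_mul_eq_taylorSum_succ (soul_pow he)
      (fun k => thetaFreeL (dx^[k] F g.body) + ψ * dthetaL (dx^[k] F g.body)),
    taylorSum, taylorSum, map_sum, Finset.mul_sum, Finset.mul_sum, ← Finset.sum_add_distrib]
  refine Finset.sum_congr rfl fun k _ => ?_
  rw [map_smul, (soul_even.pow k).dthetaL_mul, soul_even.dthetaL_pow, dthetaL_soul, map_add,
    ho.dthetaL_mul, dthetaL_thetaFreeL, dthetaL_dthetaL, mul_zero, sub_zero, zero_add,
    ← mul_assoc _ (dthetaL ψ), (soul_even.pow k).mul_comm]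
  simp only [smul_mul_assoc, mul_smul_comm, mul_assoc, smul_add]

theorem IsSmooth.dtheta_pull (hu : u.IsSmooth U V) (hV : IsOpen V) (hF : SmoothOn F V)
    (hz : z ∈ U) :
    dtheta (u.pull F) z = dtheta u.even z * u.pull (dx F) z +
      dtheta u.odd z * u.pull (dtheta F) z := by
  rw [dtheta_apply, dtheta_apply, dtheta_apply]
  exact dthetaL_evalAt hV hF (hu.isEven z hz) (hu.isOdd z hz) (hu.mapsTo hz)

theorem IsSmooth.D_pull (hu : u.IsSmooth U V) (hU : IsOpen U) (hV : IsOpen V)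
    (hF : SmoothOn F V) (hz : z ∈ U) (hb : (dxt u.even z).body = 0) :
    D (u.pull F) z = D u.even z * u.pull (dx F) z + D u.odd z * u.pull (dtheta F) z := by
  rw [D, D, D, hu.dx_pull hU hV hF hz, hu.dtheta_pull hV hF hz, hb]
  simp only [map_zero, zero_smul, add_zero]
  noncomm_ring

theorem IsSmooth.pull_mul (hu : u.IsSmooth U V) (hV : IsOpen V) (hF : SmoothOn F V)
    {H : SuperFun n} (hH : SmoothOn H V) (hz : z ∈ U) :
    u.pull (fun y => F y * H y) z = u.pull F z * u.pull H z :=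
  evalAt_mul hV hF hH (hu.isEven z hz) (hu.isOdd z hz) (hu.mapsTo hz)

theorem IsSmooth.pull_add (hu : u.IsSmooth U V) (hV : IsOpen V) (hF : SmoothOn F V)
    {H : SuperFun n} (hH : SmoothOn H V) (hz : z ∈ U) :
    u.pull (fun y => F y + H y) z = u.pull F z + u.pull H z :=
  evalAt_add hV hF hH (hu.mapsTo hz) _

theorem IsHolomorphic.dxt_even (hu : u.IsHolomorphic U V) (hU : IsOpen U) (hz : z ∈ U) :
    dxt u.even z = 0 :=
  dxt_eq_zero_of_differentiableAt ((hu.holomorphic_even z hz).differentiableAt (hU.mem_nhds hz))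

theorem IsHolomorphic.dxt_odd (hu : u.IsHolomorphic U V) (hU : IsOpen U) (hz : z ∈ U) :
    dxt u.odd z = 0 :=
  dxt_eq_zero_of_differentiableAt ((hu.holomorphic_odd z hz).differentiableAt (hU.mem_nhds hz))

theorem IsSmooth.evalAt_mul_pull_add (hu : u.IsSmooth U V) (hU : IsOpen U) (hV : IsOpen V)
    {A B F H K : SuperFun n} (hA : SmoothOn A U) (hB : SmoothOn B U) (hF : SmoothOn F V)
    (hH : SmoothOn H V) (hK : ∀ y ∈ U, K y = A y * u.pull F y + B y * u.pull H y)
    {g ψ : Grassmann (n + 1)} (hg : g.IsEven) (hψ : ψ.IsOdd) (hb : g.body ∈ U) :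
    evalAt K g ψ = evalAt A g ψ * evalAt (u.pull F) g ψ + evalAt B g ψ * evalAt (u.pull H) g ψ := by
  have smooth_pull_F := hu.smoothOn_pull hV hF
  have smooth_pull_H := hu.smoothOn_pull hV hH
  rw [evalAt_congr hU hK hb, evalAt_add hU (hA.mul smooth_pull_F) (hB.mul smooth_pull_H) hb,
    evalAt_mul hU hA smooth_pull_F hg hψ hb, evalAt_mul hU hB smooth_pull_H hg hψ hb]

theorem IsHolomorphic.dx_pull (hu : u.IsHolomorphic U V) (hU : IsOpen U) (hV : IsOpen V)
    (hF : SmoothOn F V) (hz : z ∈ U) :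
    dx (u.pull F) z = dx u.even z * u.pull (dx F) z + dx u.odd z * u.pull (dtheta F) z := by
  rw [hu.toIsSmooth.dx_pull hU hV hF hz, hu.dxt_even hU hz, body_zero, map_zero, zero_smul,
    add_zero]

theorem IsHolomorphic.hasDerivAt_evalRay_pull (hu : u.IsHolomorphic U V) (hU : IsOpen U)
    (hV : IsOpen V) (hF : SmoothOn F V) {g ψ : Grassmann (n + 1)} (hg : g.IsEven) (hψ : ψ.IsOdd)
    (hb : g.body ∈ U) (t : ℝ) :
    HasDerivAt (evalRay g ψ (u.pull F))
      ((soul g * evalRay g ψ (dx u.even) t + ψ * evalRay g ψ (dtheta u.even) t) *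
          evalRay g ψ (u.pull (dx F)) t +
        (soul g * evalRay g ψ (dx u.odd) t + ψ * evalRay g ψ (dtheta u.odd) t) *
          evalRay g ψ (u.pull (dtheta F)) t) t := by
  have smooth : u.IsSmooth U V := hu.toIsSmooth
  have hbt : (scaleSoul g t).body ∈ U := by rwa [body_scaleSoul]
  have hgt := isEven_scaleSoul hg t
  have hψt := isOdd_real_smul hψ t
  refine (hasDerivAt_evalRay hU (smooth.smoothOn_pull hV hF) hg hb ψ t).congr_deriv ?_
  simp only [evalRay]
  rw [smooth.evalAt_mul_pull_add hU hV (smooth.smooth_even.dx hU) (smooth.smooth_odd.dx hU)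
      (hF.dx hV) hF.dtheta (fun y => hu.dx_pull hU hV hF) hgt hψt hbt,
    smooth.evalAt_mul_pull_add hU hV smooth.smooth_even.dtheta smooth.smooth_odd.dtheta
      (hF.dx hV) hF.dtheta (fun y => smooth.dtheta_pull hV hF) hgt hψt hbt]
  noncomm_ring

-- The defect of functoriality satisfies, along a ray, a linear equation with nilpotent
-- coefficients and vanishes at the body.
theorem IsHolomorphic.evalAt_pull (hu : u.IsHolomorphic U V) (hU : IsOpen U) (hV : IsOpen V)
    (hF : SmoothOn F V) {g ψ : Grassmann (n + 1)} (hg : g.IsEven) (hψ : ψ.IsOdd)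
    (hb : g.body ∈ U) :
    evalAt (u.pull F) g ψ = evalAt F (evalAt u.even g ψ) (evalAt u.odd g ψ) := by
  have smooth : u.IsSmooth U V := hu.toIsSmooth
  let velocity : SuperFun n → ℝ → Grassmann (n + 1) := fun F t =>
    soul g * evalRay g ψ (dx F) t + ψ * evalRay g ψ (dtheta F) t
  have velocity_mem : ∀ F t, velocity F t ∈ degreeGE (n + 1) 1 := fun F t =>
    add_mem (mul_mem_degreeGE_left _ (mem_degreeGE_one.2 (body_soul g)))
      (mul_mem_degreeGE_left _ hψ.mem_degreeGE_one)
  let defect : {F : SuperFun n // SmoothOn F V} → ℝ → Grassmann (n + 1) := fun F t =>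
    evalRay g ψ (u.pull F.1) t - evalAt F.1 (evalRay g ψ u.even t) (evalRay g ψ u.odd t)
  let defect' : {F : SuperFun n // SmoothOn F V} → ℝ → Grassmann (n + 1) := fun F t =>
    velocity u.even t * defect ⟨dx F.1, F.2.dx hV⟩ t +
      velocity u.odd t * defect ⟨dtheta F.1, F.2.dtheta⟩ t
  have defect_eq_zero : ∀ F t, defect F t = 0 := by
    refine eq_zero_of_deriv_mem_degreeGE (Δ' := defect') ?_ ?_ fun k degree_k F t => ?_
    · rintro ⟨F, hF⟩
      simp only [defect, evalRay_zero]
      rw [pull_apply, thetaFreeL_evalAt hV hF (smooth.mapsTo hb), sub_self]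
    · rintro ⟨F, hF⟩ t
      have hbt : (scaleSoul g t).body ∈ U := by rwa [body_scaleSoul]
      have hψt := isOdd_real_smul hψ t
      have deriv_comp := hasDerivAt_evalAt hV hF
        (hasDerivAt_evalRay hU smooth.smooth_even hg hb ψ t)
        (hasDerivAt_evalRay hU smooth.smooth_odd hg hb ψ t)
        (isEven_evalAt hU smooth.smooth_even smooth.isEven hbt (isEven_scaleSoul hg t) hψt)
        (by rw [evalRay, body_evalAt _ _ hψt.body_eq_zero, body_scaleSoul]; exact smooth.mapsTo hb)
        (mem_degreeGE_one.1 (velocity_mem _ t))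
      refine ((hu.hasDerivAt_evalRay_pull hU hV hF hg hψ hb t).sub deriv_comp).congr_deriv ?_
      simp only [defect', defect, velocity]
      noncomm_ring
    · rw [add_comm k]
      exact add_mem (mul_mem_degreeGE (velocity_mem _ t) (degree_k _ t))
        (mul_mem_degreeGE (velocity_mem _ t) (degree_k _ t))
  simpa only [defect, evalRay_one, sub_eq_zero] using defect_eq_zero ⟨F, hF⟩ 1

end SuperMap

/-! ### Vector fields and linear systems over a Grassmann algebra -/

namespace SuperRiemannSurface

open Grassmann

variable {ι C : Type*} [TopologicalSpace C] [ChartedSpace ℂ C] (S : SuperRiemannSurface ι C)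

theorem isOpen_dom (α : ι) : IsOpen (S.dom α) := (S.chart α).open_target

theorem isOpen_overlap (α β : ι) : IsOpen (S.overlap α β) :=
  ((S.chart α).symm.trans (S.chart β)).open_source

theorem mem_overlap {α β : ι} {x : ℂ} : x ∈ S.overlap α β ↔
    x ∈ S.dom α ∧ (S.chart α).symm x ∈ (S.chart β).source := by
  simp [overlap, dom]

theorem overlap_subset (α β : ι) : S.overlap α β ⊆ S.dom α := fun _ hx => (S.mem_overlap.1 hx).1

theorem trans_apply (α β : ι) (x : ℂ) : S.trans α β x = S.chart β ((S.chart α).symm x) := rfl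

theorem trans_mem {α β : ι} {x : ℂ} (hx : x ∈ S.overlap α β) : S.trans α β x ∈ S.overlap β α := by
  obtain ⟨mem_target, mem_source⟩ := S.mem_overlap.1 hx
  rw [mem_overlap, trans_apply, dom, (S.chart β).left_inv mem_source]
  exact ⟨(S.chart β).map_source mem_source, (S.chart α).map_target mem_target⟩

theorem differentiableOn_trans [IsManifold 𝓘(ℂ) ω C] (α β : ι) :
    DifferentiableOn ℂ (S.trans α β) (S.overlap α β) := by
  have compatible := (contDiffGroupoid ω 𝓘(ℂ)).compatible_of_mem_maximalAtlas (S.chart_mem α)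
    (S.chart_mem β)
  rw [contDiffGroupoid, mem_groupoid_of_pregroupoid] at compatible
  have analytic : ContDiffOn ℂ ω (S.trans α β) (S.overlap α β) := by
    simpa [contDiffPregroupoid, trans, overlap] using compatible.1
  exact analytic.differentiableOn (by simp)

variable {n : ℕ}

theorem rho_base (α β : ι) (x : ℂ) : (S.rho n α β).base x = S.trans α β x :=
  body_algebraMap _

theorem rho_isHolomorphic [IsManifold 𝓘(ℂ) ω C] (α β : ι) :
    (S.rho n α β).IsHolomorphic (S.overlap α β) (S.overlap β α) := by
  have even_eq : (S.rho n α β).even = fun x => S.trans α β x • 1 :=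
    funext fun x => Algebra.algebraMap_eq_smul_one _
  have holomorphic_even : DifferentiableOn ℂ (S.rho n α β).even (S.overlap α β) := by
    rw [even_eq]
    exact (S.differentiableOn_trans α β).smul_const _
  have holomorphic_odd : DifferentiableOn ℂ (S.rho n α β).odd (S.overlap α β) :=
    (S.zeta_holomorphic α β).smul_const _
  have smooth {f : SuperFun n} (hf : DifferentiableOn ℂ f (S.overlap α β)) :
      SmoothOn f (S.overlap α β) := (hf.contDiffOn (S.isOpen_overlap α β)).restrict_scalars ℝ
  exact ⟨⟨smooth holomorphic_even, smooth holomorphic_odd, fun x _ => isEven_algebraMap _,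
    fun x _ => isOdd_theta.smul _, fun x hx => by rw [rho_base]; exact S.trans_mem hx⟩,
    holomorphic_even, holomorphic_odd⟩

theorem dx_rho_even [IsManifold 𝓘(ℂ) ω C] {α β : ι} {x : ℂ} (hx : x ∈ S.overlap α β) :
    dx (S.rho n α β).even x = algebraMap ℂ _ (deriv (S.trans α β) x) := by
  have trans_differentiable := (S.differentiableOn_trans α β x hx).differentiableAt
    ((S.isOpen_overlap α β).mem_nhds hx)
  have even_eq : (S.rho n α β).even = fun x => S.trans α β x • 1 :=
    funext fun x => Algebra.algebraMap_eq_smul_one _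
  have hasDerivAt_even := trans_differentiable.hasDerivAt.smul_const (1 : Grassmann (n + 1))
  rw [even_eq, dx_eq_deriv hasDerivAt_even.differentiableAt, hasDerivAt_even.deriv,
    Algebra.algebraMap_eq_smul_one]

end SuperRiemannSurface

namespace SuperFun

open Grassmann

variable {n : ℕ} {F : SuperFun n} {V : Set ℂ} {z : ℂ}

theorem iterate_dx_const (a : Grassmann (n + 1)) (k : ℕ) :
    dx^[k + 1] (fun _ => a) = fun _ => (0 : Grassmann (n + 1)) := by
  rw [Function.iterate_succ_apply, funext (dx_const a), iterate_dx_zero]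

theorem evalAt_const (a g ψ : Grassmann (n + 1)) :
    evalAt (fun _ => a) g ψ = thetaFreeL a + ψ * dthetaL a := by
  rw [evalAt, taylorSum, Finset.sum_range_succ', thetaFree_eq, dtheta_eq]
  simp [iterate_dx_const]

theorem evalAt_theta (g ψ : Grassmann (n + 1)) : evalAt (fun _ => theta n) g ψ = ψ := by
  rw [evalAt_const]; simp

theorem hasDerivAt_algebraMap (z : ℂ) :
    HasDerivAt (fun y => algebraMap ℂ (Grassmann (n + 1)) y) 1 z := by
  simpa only [Algebra.algebraMap_eq_smul_one, id_eq, one_smul]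
    using (hasDerivAt_id z).smul_const (1 : Grassmann (n + 1))

theorem dx_algebraMap (z : ℂ) : dx (fun y => algebraMap ℂ (Grassmann (n + 1)) y) z = 1 := by
  rw [dx_eq_deriv (hasDerivAt_algebraMap z).differentiableAt, (hasDerivAt_algebraMap z).deriv]

theorem dxt_algebraMap (z : ℂ) : dxt (fun y => algebraMap ℂ (Grassmann (n + 1)) y) z = 0 :=
  dxt_eq_zero_of_differentiableAt (hasDerivAt_algebraMap z).differentiableAt

theorem evalAt_coord (g ψ : Grassmann (n + 1)) : evalAt (fun y => algebraMap ℂ _ y) g ψ = g := by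
  have higher_dx : ∀ k, dx^[k + 1 + 1] (fun y => algebraMap ℂ (Grassmann (n + 1)) y) =
      fun _ => 0 := fun k => by
    rw [Function.iterate_succ_apply, funext dx_algebraMap, iterate_dx_const]
  rw [evalAt, taylorSum, Finset.sum_range_succ', Finset.sum_range_succ']
  simp only [thetaFree_eq, dtheta_eq, thetaFreeL_algebraMap, dthetaL_algebraMap, higher_dx,
    iterate_dx_zero]
  simp [dx_algebraMap, soul]

theorem D_theta (z : ℂ) : D (fun _ => theta n) z = 1 := by
  rw [D, dx_const, dtheta_apply, dthetaL_theta, mul_zero, add_zero]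

theorem D_coord (z : ℂ) : D (fun y => algebraMap ℂ (Grassmann (n + 1)) y) z = theta n := by
  rw [D, dx_algebraMap, dtheta_apply, dthetaL_algebraMap, zero_add, mul_one]

theorem isEven_D (hV : IsOpen V) (hF : SmoothOn F V) (odd : ∀ y ∈ V, (F y).IsOdd) :
    ∀ z ∈ V, (D F z).IsEven := fun z hz => by
  rw [D, dtheta_apply]
  exact (odd z hz).dthetaL.add (isOdd_theta.mul (isOdd_dx hV hF odd z hz))

theorem D_dxt (hV : IsOpen V) (hF : SmoothOn F V) (hz : z ∈ V) : D (dxt F) z = dxt (D F) z := by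
  have dxt_D : dxt (D F) z = dxt (dtheta F) z + dxt (fun y => theta n * dx F y) z :=
    dxt_add (hF.dtheta.differentiableAt hV hz)
      (((smoothOn_const _).mul (hF.dx hV)).differentiableAt hV hz)
  rw [dxt_D, dxt_mul (differentiableAt_const _) ((hF.dx hV).differentiableAt hV hz), dxt_const,
    zero_mul, zero_add, dxt_dtheta (hF.differentiableAt hV hz), D, dx_dxt hF hV hz, dtheta_apply]

/-- The vector field `a ∂/∂x + b ∂/∂θ`, acting on functions. -/
def vectorField (a b F : SuperFun n) : SuperFun n := fun z => a z * dx F z + b z * dtheta F z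

/-- The operator `∂/∂x̃ - (a ∂/∂x + b ∂/∂θ)`: the coefficient of `d x̃` of a Dolbeault operator
perturbed by a vector `(0,1)`-form. -/
def dolbeaultSub (a b F : SuperFun n) : SuperFun n := fun z => dxt F z - vectorField a b F z

variable {a b : SuperFun n}

theorem SmoothOn.vectorField (ha : SmoothOn a V) (hb : SmoothOn b V) (hF : SmoothOn F V)
    (hV : IsOpen V) : SmoothOn (vectorField a b F) V :=
  (ha.mul (hF.dx hV)).add (hb.mul hF.dtheta)

theorem vectorField_eqOn (hV : IsOpen V) {H : SuperFun n} (h : Set.EqOn F H V) :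
    Set.EqOn (vectorField a b F) (vectorField a b H) V := fun z hz => by
  rw [vectorField, vectorField, dx_eqOn hV h hz, dtheta_apply, dtheta_apply, h hz]

theorem dolbeaultSub_eqOn (hV : IsOpen V) {H : SuperFun n} (h : Set.EqOn F H V) :
    Set.EqOn (dolbeaultSub a b F) (dolbeaultSub a b H) V := fun z hz => by
  rw [dolbeaultSub, dolbeaultSub, dxt_eqOn hV h hz, vectorField_eqOn hV h hz]

theorem dolbeaultSub_mul {H : SuperFun n} (hF : DifferentiableAt ℝ F z)
    (hH : DifferentiableAt ℝ H z) (even : (F z).IsEven) :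
    dolbeaultSub a b (fun y => F y * H y) z =
      dolbeaultSub a b F z * H z + F z * dolbeaultSub a b H z := by
  simp only [dolbeaultSub, vectorField, dxt_mul hF hH, dx_mul hF hH, dtheta_apply,
    even.dthetaL_mul]
  simp only [mul_add, add_mul, mul_sub, sub_mul, ← mul_assoc, ← even.mul_comm (a z),
    ← even.mul_comm (b z)]
  abel

theorem dx_D (hV : IsOpen V) (hF : SmoothOn F V) (hz : z ∈ V) :
    dx (D F) z = dthetaL (dx F z) + theta n * dx (dx F) z := by
  have dx_D_eq : dx (D F) z = dx (dtheta F) z + dx (fun y => theta n * dx F y) z :=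
    dx_add (hF.dtheta.differentiableAt hV hz)
      (((smoothOn_const _).mul (hF.dx hV)).differentiableAt hV hz)
  rw [dx_D_eq, dx_mul (differentiableAt_const _) ((hF.dx hV).differentiableAt hV hz), dx_const,
    zero_mul, zero_add, dx_dtheta (hF.differentiableAt hV hz)]

theorem dtheta_D (F : SuperFun n) (z : ℂ) :
    dtheta (D F) z = dx F z - theta n * dthetaL (dx F z) := by
  rw [dtheta_apply, D, dtheta_apply, map_add, dthetaL_dthetaL, dthetaL_theta_mul, zero_add]
  exact eq_sub_of_add_eq (thetaFreeL_add_theta_mul_dthetaL _)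

theorem vectorField_bracket_D (hV : IsOpen V) (ha : SmoothOn a V) (hb : SmoothOn b V)
    (hF : SmoothOn F V) (even : (a z).IsEven) (odd : (b z).IsOdd) (hz : z ∈ V) :
    vectorField a b (D F) z - D (vectorField a b F) z =
      (b z - D a z) * dx F z + -D b z * dtheta F z := by
  have a_diff := ha.differentiableAt hV hz
  have b_diff := hb.differentiableAt hV hz
  have F_diff := hF.differentiableAt hV hz
  have dx_diff := (hF.dx hV).differentiableAt hV hz
  have dtheta_diff := hF.dtheta.differentiableAt hV hz
  have dx_field : dx (vectorField a b F) z =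
      (dx a z * dx F z + a z * dx (dx F) z) + (dx b z * dtheta F z + b z * dthetaL (dx F z)) := by
    rw [show vectorField a b F = fun y => a y * dx F y + b y * dtheta F y from rfl,
      dx_add (differentiableAt_mul a_diff dx_diff) (differentiableAt_mul b_diff dtheta_diff),
      dx_mul a_diff dx_diff, dx_mul b_diff dtheta_diff, dx_dtheta F_diff]
  have dtheta_field : dtheta (vectorField a b F) z =
      dthetaL (a z) * dx F z + a z * dthetaL (dx F z) + dthetaL (b z) * dtheta F z := by
    rw [dtheta_apply, vectorField, map_add, even.dthetaL_mul, odd.dthetaL_mul, dtheta_apply,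
      dthetaL_dthetaL, mul_zero, sub_zero]
  have a_theta : a z * theta n = theta n * a z := even.mul_comm _
  have b_theta : b z * theta n = -(theta n * b z) := odd.mul_eq_neg isOdd_theta
  rw [vectorField, dx_D hV hF hz, dtheta_D, D, dx_field, dtheta_field, D, D, dtheta_apply,
    dtheta_apply, dtheta_apply]
  simp only [mul_add, add_mul, mul_sub, sub_mul, ← mul_assoc, a_theta, b_theta, neg_mul, neg_add]
  abel

-- `∂/∂x̃` commutes with `D`, so on the kernel of `∂/∂x̃ - φ` the bracket `[φ, D]` is
-- `-(∂/∂x̃ - φ) ∘ D`.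
theorem vectorField_bracket_D_of_dolbeaultSub (hV : IsOpen V) (hF : SmoothOn F V)
    (kernel : ∀ y ∈ V, dolbeaultSub a b F y = 0) (hz : z ∈ V) :
    vectorField a b (D F) z - D (vectorField a b F) z = -dolbeaultSub a b (D F) z := by
  have field_eq_dxt : Set.EqOn (vectorField a b F) (dxt F) V :=
    fun y hy => (sub_eq_zero.1 (kernel y hy)).symm
  rw [D_eqOn hV field_eq_dxt hz, D_dxt hV hF hz, dolbeaultSub, neg_sub]

end SuperFun

namespace SuperMap

open Grassmann

variable {n : ℕ} {U V : Set ℂ} {u : SuperMap n} {F : SuperFun n}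

theorem pull_theta (u : SuperMap n) : u.pull (fun _ => theta n) = u.odd :=
  funext fun _ => evalAt_theta _ _

theorem pull_coord (u : SuperMap n) : u.pull (fun y => algebraMap ℂ _ y) = u.even :=
  funext fun _ => evalAt_coord _ _

theorem pull_one (u : SuperMap n) : u.pull (fun _ => 1) = fun _ => 1 :=
  funext fun _ => by rw [pull_apply, evalAt_const]; simp

-- The coordinate functions `θ` and `x` are the test functions: they give the conformal factor
-- `D u⁻` and then `D u⁺ = D u⁻ · u⁻`.
theorem IsSuperconformal.D_even (hu : u.IsSuperconformal U V) :
    ∀ x ∈ U, D u.even x = D u.odd x * u.odd x := by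
  obtain ⟨factor, _, _, D_pull⟩ := hu
  intro x hx
  have D_odd := D_pull _ (smoothOn_const (theta n)) hx
  have D_even := D_pull _ smoothOn_algebraMap hx
  simp only [pull_theta, pull_coord, pull_one, funext D_theta, funext D_coord, mul_one]
    at D_odd D_even
  rw [D_even, D_odd]

theorem IsSmooth.pull_D (hu : u.IsSmooth U V) (hV : IsOpen V) (hF : SmoothOn F V) {x : ℂ}
    (hx : x ∈ U) : u.pull (D F) x = u.pull (dtheta F) x + u.odd x * u.pull (dx F) x := by
  have D_eq : D F = fun y => dtheta F y + theta n * dx F y := rfl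
  rw [D_eq, hu.pull_add hV hF.dtheta ((smoothOn_const _).mul (hF.dx hV)) hx,
    hu.pull_mul hV (smoothOn_const _) (hF.dx hV) hx, pull_theta]

theorem IsSmooth.D_pull_of_D_even (hu : u.IsSmooth U V) (hU : IsOpen U) (hV : IsOpen V) {x : ℂ}
    (hx : x ∈ U) (hb : (dxt u.even x).body = 0) (hD : D u.even x = D u.odd x * u.odd x)
    (hF : SmoothOn F V) : D (u.pull F) x = D u.odd x * u.pull (D F) x := by
  rw [hu.D_pull hU hV hF hx hb, hD, hu.pull_D hV hF hx, mul_add, ← mul_assoc]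
  exact add_comm _ _

theorem IsSmooth.isSuperconformal (hu : u.IsSmooth U V) (hU : IsOpen U) (hV : IsOpen V)
    (hb : ∀ x ∈ U, (dxt u.even x).body = 0) (hD : ∀ x ∈ U, D u.even x = D u.odd x * u.odd x)
    (h0 : ∀ x ∈ U, (dthetaL (u.odd x)).body ≠ 0) : u.IsSuperconformal U V := by
  refine ⟨D u.odd, hu.smooth_odd.D hU, fun x hx => ?_, fun F hF x hx =>
    hu.D_pull_of_D_even hU hV hx (hb x hx) (hD x hx) hF⟩
  rw [D, body_add, body_mul, isOdd_theta.body_eq_zero, zero_mul, add_zero, dtheta_apply]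
  exact h0 x hx

theorem IsSmooth.vectorField_pull (hu : u.IsSmooth U V) (hU : IsOpen U) (hV : IsOpen V)
    (hF : SmoothOn F V) {x : ℂ} (hx : x ∈ U) (hb : (dxt u.even x).body = 0)
    (a b : SuperFun n) :
    vectorField a b (u.pull F) x = vectorField a b u.even x * u.pull (dx F) x +
      vectorField a b u.odd x * u.pull (dtheta F) x := by
  simp only [vectorField]
  rw [hu.dx_pull hU hV hF hx, hu.dtheta_pull hV hF hx, hb, map_zero, zero_smul, add_zero]
  noncomm_ring

theorem IsSmooth.pull_vectorField (hu : u.IsSmooth U V) (hV : IsOpen V) {a b : SuperFun n}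
    (ha : SmoothOn a V) (hb : SmoothOn b V) (hF : SmoothOn F V) {x : ℂ} (hx : x ∈ U) :
    u.pull (vectorField a b F) x =
      u.pull a x * u.pull (dx F) x + u.pull b x * u.pull (dtheta F) x := by
  have vectorField_eq : vectorField a b F = fun y => a y * dx F y + b y * dtheta F y := rfl
  rw [vectorField_eq, hu.pull_add hV (ha.mul (hF.dx hV)) (hb.mul hF.dtheta) hx,
    hu.pull_mul hV ha (hF.dx hV) hx, hu.pull_mul hV hb hF.dtheta hx]

end SuperMap

namespace Grassmann

variable {m : ℕ}

/-- The Schur complement of the lower right block of the matrix `(P Q; R T)` when `T` has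
body `1`. -/
def schurComplement (P Q R T : Grassmann m) : Grassmann m := P - Q * geomInv T * R

theorem body_schurComplement {P Q : Grassmann m} (hP : P.body = 1) (hQ : Q.body = 0)
    (R T : Grassmann m) : (schurComplement P Q R T).body = 1 := by
  rw [schurComplement, body_sub, body_mul, body_mul, hQ, hP]
  ring

theorem row_eq_zero {P Q R T a b : Grassmann m} (hP : P.body = 1) (hQ : Q.body = 0)
    (hT : T.body = 1) (hfst : a * P + b * R = 0) (hsnd : a * Q + b * T = 0) :
    a = 0 ∧ b = 0 := by
  have b_eq : b = -(a * Q * geomInv T) := by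
    rw [eq_neg_iff_add_eq_zero, add_comm]
    calc a * Q * geomInv T + b = (a * Q + b * T) * geomInv T := by
          rw [add_mul, mul_assoc b, mul_geomInv hT, mul_one]
      _ = 0 := by rw [hsnd, zero_mul]
  have a_mul : a * schurComplement P Q R T = 0 := by
    rw [← hfst, b_eq, schurComplement]
    noncomm_ring
  have a_eq : a = 0 := by
    rw [← mul_one a, ← mul_geomInv (body_schurComplement hP hQ R T), ← mul_assoc, a_mul, zero_mul]
  exact ⟨a_eq, by simp [b_eq, a_eq]⟩

theorem row_ext {P Q R T a b a' b' : Grassmann m} (hP : P.body = 1) (hQ : Q.body = 0)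
    (hT : T.body = 1) (hfst : a * P + b * R = a' * P + b' * R)
    (hsnd : a * Q + b * T = a' * Q + b' * T) : a = a' ∧ b = b' := by
  rw [← sub_eq_zero, add_sub_add_comm, ← sub_mul, ← sub_mul] at hfst hsnd
  simpa only [sub_eq_zero] using row_eq_zero hP hQ hT hfst hsnd

/-- The first entry `a` of the solution of the linear system `a P + b R = p`, `a Q + b T = q`,
where the matrix `(P Q; R T)` has body `1` on the diagonal and `Q` has body `0`. -/
def rowSolveFst (P Q R T p q : Grassmann m) : Grassmann m :=
  (p - q * geomInv T * R) * geomInv (schurComplement P Q R T)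

/-- The second entry `b` of the solution of the linear system of `rowSolveFst`. -/
def rowSolveSnd (P Q R T p q : Grassmann m) : Grassmann m :=
  (q - rowSolveFst P Q R T p q * Q) * geomInv T

theorem rowSolve_eq_snd (P Q R p q : Grassmann m) {T : Grassmann m} (hT : T.body = 1) :
    rowSolveFst P Q R T p q * Q + rowSolveSnd P Q R T p q * T = q := by
  rw [rowSolveSnd, mul_assoc _ _ T, geomInv_mul hT, mul_one, add_sub_cancel]

theorem rowSolve_eq_fst {P Q : Grassmann m} (hP : P.body = 1) (hQ : Q.body = 0)
    (R T p q : Grassmann m) :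
    rowSolveFst P Q R T p q * P + rowSolveSnd P Q R T p q * R = p := by
  calc rowSolveFst P Q R T p q * P + rowSolveSnd P Q R T p q * R
      = rowSolveFst P Q R T p q * schurComplement P Q R T + q * geomInv T * R := by
        rw [rowSolveSnd, schurComplement]
        noncomm_ring
    _ = p := by
      rw [rowSolveFst, mul_assoc, geomInv_mul (body_schurComplement hP hQ R T), mul_one,
        sub_add_cancel]

end Grassmann

/-! ### The Beltrami form of an identification -/

namespace SuperFun

open Grassmann

variable {n : ℕ} {F H : SuperFun n} {V : Set ℂ} {z : ℂ}

theorem dx_modXi (hV : IsOpen V) (hF : SmoothOn F V) (hH : SmoothOn H V)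
    (h : ∀ y ∈ V, ModXi (F y) (H y)) (hz : z ∈ V) : ModXi (dx F z) (dx H z) :=
  modXi_iff.2 ⟨dx_apply_congr hV hF hH (fun y hy => (modXi_iff.1 (h y hy)).1) hz,
    dx_apply_congr hV hF hH (fun y hy => (modXi_iff.1 (h y hy)).2) hz⟩

theorem dxt_modXi (hV : IsOpen V) (hF : SmoothOn F V) (hH : SmoothOn H V)
    (h : ∀ y ∈ V, ModXi (F y) (H y)) (hz : z ∈ V) : ModXi (dxt F z) (dxt H z) :=
  modXi_iff.2 ⟨dxt_apply_congr hV hF hH (fun y hy => (modXi_iff.1 (h y hy)).1) hz,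
    dxt_apply_congr hV hF hH (fun y hy => (modXi_iff.1 (h y hy)).2) hz⟩

end SuperFun

namespace SuperMap

open Grassmann

variable {n : ℕ} {V W : Set ℂ} {u : SuperMap n} {F : SuperFun n} {x : ℂ}

theorem EqModXi.base_eq (central : u.EqModXi (ident n) W) (hx : x ∈ W) : u.base x = x :=
  (modXi_iff_body.1 (central x hx).1).1.trans (body_algebraMap x)

theorem EqModXi.isSmooth_self (central : u.EqModXi (ident n) W) (hu : u.IsSmooth W V) :
    u.IsSmooth W W :=
  hu.mono le_rfl fun y hy => by rwa [central.base_eq hy]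

theorem EqModXi.dx_even_modXi (central : u.EqModXi (ident n) W) (hW : IsOpen W)
    (smooth : SmoothOn u.even W) (hx : x ∈ W) : ModXi (dx u.even x) 1 :=
  dx_algebraMap (n := n) x ▸
    dx_modXi hW smooth smoothOn_algebraMap (fun y hy => (central y hy).1) hx

theorem EqModXi.dxt_even_modXi (central : u.EqModXi (ident n) W) (hW : IsOpen W)
    (smooth : SmoothOn u.even W) (hx : x ∈ W) : ModXi (dxt u.even x) 0 :=
  dxt_algebraMap (n := n) x ▸
    dxt_modXi hW smooth smoothOn_algebraMap (fun y hy => (central y hy).1) hx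

theorem EqModXi.dx_odd_modXi (central : u.EqModXi (ident n) W) (hW : IsOpen W)
    (smooth : SmoothOn u.odd W) (hx : x ∈ W) : ModXi (dx u.odd x) 0 :=
  dx_const (theta n) x ▸ dx_modXi hW smooth (smoothOn_const _) (fun y hy => (central y hy).2) hx

theorem EqModXi.dxt_odd_modXi (central : u.EqModXi (ident n) W) (hW : IsOpen W)
    (smooth : SmoothOn u.odd W) (hx : x ∈ W) : ModXi (dxt u.odd x) 0 :=
  dxt_const (theta n) x ▸ dxt_modXi hW smooth (smoothOn_const _) (fun y hy => (central y hy).2) hx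

theorem EqModXi.body_dx_even (central : u.EqModXi (ident n) W) (hW : IsOpen W)
    (smooth : SmoothOn u.even W) (hx : x ∈ W) : (dx u.even x).body = 1 :=
  (modXi_iff.1 (central.dx_even_modXi hW smooth hx)).1

theorem EqModXi.body_dxt_even (central : u.EqModXi (ident n) W) (hW : IsOpen W)
    (smooth : SmoothOn u.even W) (hx : x ∈ W) : (dxt u.even x).body = 0 :=
  (modXi_iff.1 (central.dxt_even_modXi hW smooth hx)).1

theorem EqModXi.body_dx_odd (central : u.EqModXi (ident n) W) (hW : IsOpen W)
    (smooth : SmoothOn u.odd W) (hx : x ∈ W) : (dx u.odd x).body = 0 :=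
  (modXi_iff.1 (central.dx_odd_modXi hW smooth hx)).1

theorem EqModXi.body_dtheta_odd (central : u.EqModXi (ident n) W) (hx : x ∈ W) :
    (dtheta u.odd x).body = 1 := by
  rw [dtheta_apply, (modXi_iff_body.1 (central x hx).2).2, ident, dthetaL_theta, body_one]

theorem EqModXi.body_D_odd (central : u.EqModXi (ident n) W) (hx : x ∈ W) :
    (D u.odd x).body = 1 := by
  rw [D, body_add, body_mul, isOdd_theta.body_eq_zero, central.body_dtheta_odd hx, zero_mul,
    add_zero]

/-- The coefficient of `∂/∂x` of the Beltrami form of `u`: the vector `(0,1)`-form `φ` with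
`φ u⁺ = ∂u⁺/∂x̃` and `φ u⁻ = ∂u⁻/∂x̃`, for `u` the identity modulo the parameters. -/
def beltramiFst (u : SuperMap n) : SuperFun n := fun x =>
  rowSolveFst (dx u.even x) (dx u.odd x) (dtheta u.even x) (dtheta u.odd x) (dxt u.even x)
    (dxt u.odd x)

/-- The coefficient of `∂/∂θ` of the Beltrami form of `u`. -/
def beltramiSnd (u : SuperMap n) : SuperFun n := fun x =>
  rowSolveSnd (dx u.even x) (dx u.odd x) (dtheta u.even x) (dtheta u.odd x) (dxt u.even x)
    (dxt u.odd x)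

theorem IsSmooth.smoothOn_beltramiFst (hu : u.IsSmooth W V) (hW : IsOpen W) :
    SmoothOn u.beltramiFst W := by
  have smooth_inv : SmoothOn (fun y => geomInv (dtheta u.odd y)) W :=
    contDiffOn_geomInv hu.smooth_odd.dtheta
  exact ((hu.smooth_even.dxt hW).sub (((hu.smooth_odd.dxt hW).mul smooth_inv).mul
    hu.smooth_even.dtheta)).mul (contDiffOn_geomInv ((hu.smooth_even.dx hW).sub
      (((hu.smooth_odd.dx hW).mul smooth_inv).mul hu.smooth_even.dtheta)))

theorem IsSmooth.smoothOn_beltramiSnd (hu : u.IsSmooth W V) (hW : IsOpen W) :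
    SmoothOn u.beltramiSnd W :=
  ((hu.smooth_odd.dxt hW).sub ((hu.smoothOn_beltramiFst hW).mul (hu.smooth_odd.dx hW))).mul
    (contDiffOn_geomInv hu.smooth_odd.dtheta)

theorem IsSmooth.isEven_beltramiFst (hu : u.IsSmooth W V) (hW : IsOpen W) (hx : x ∈ W) :
    (u.beltramiFst x).IsEven := by
  have inv_even : (geomInv (dtheta u.odd x)).IsEven := by
    rw [dtheta_apply]
    exact (hu.isOdd x hx).dthetaL.geomInv
  have dtheta_odd : (dtheta u.even x).IsOdd := by
    rw [dtheta_apply]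
    exact (hu.isEven x hx).dthetaL
  exact ((isEven_dxt hW hu.smooth_even hu.isEven x hx).sub
    (((isOdd_dxt hW hu.smooth_odd hu.isOdd x hx).mul_isEven inv_even).mul dtheta_odd)).mul
    ((isEven_dx hW hu.smooth_even hu.isEven x hx).sub
      (((isOdd_dx hW hu.smooth_odd hu.isOdd x hx).mul_isEven inv_even).mul dtheta_odd)).geomInv

theorem IsSmooth.isOdd_beltramiSnd (hu : u.IsSmooth W V) (hW : IsOpen W) (hx : x ∈ W) :
    (u.beltramiSnd x).IsOdd := by
  have inv_even : (geomInv (dtheta u.odd x)).IsEven := by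
    rw [dtheta_apply]
    exact (hu.isOdd x hx).dthetaL.geomInv
  exact ((isOdd_dxt hW hu.smooth_odd hu.isOdd x hx).sub ((hu.isEven_beltramiFst hW hx).mul_isOdd
    (isOdd_dx hW hu.smooth_odd hu.isOdd x hx))).mul_isEven inv_even

theorem EqModXi.beltrami_modXi (central : u.EqModXi (ident n) W) (hu : u.IsSmooth W V)
    (hW : IsOpen W) (hx : x ∈ W) : ModXi (u.beltramiFst x) 0 ∧ ModXi (u.beltramiSnd x) 0 := by
  have even_mem := central.dxt_even_modXi hW hu.smooth_even hx
  have odd_mem := central.dxt_odd_modXi hW hu.smooth_odd hx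
  rw [ModXi, sub_zero] at even_mem odd_mem
  rw [ModXi, ModXi, sub_zero, sub_zero]
  have fst_mem : u.beltramiFst x ∈ TwoSidedIdeal.span (Set.range (xi (n := n))) :=
    TwoSidedIdeal.mul_mem_right _ _ _ (sub_mem even_mem (TwoSidedIdeal.mul_mem_right _ _ _
      (TwoSidedIdeal.mul_mem_right _ _ _ odd_mem)))
  exact ⟨fst_mem, TwoSidedIdeal.mul_mem_right _ _ _
    (sub_mem odd_mem (TwoSidedIdeal.mul_mem_right _ _ _ fst_mem))⟩

theorem EqModXi.dolbeaultSub_beltrami_even (central : u.EqModXi (ident n) W)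
    (hu : u.IsSmooth W V) (hW : IsOpen W) (hx : x ∈ W) :
    dolbeaultSub u.beltramiFst u.beltramiSnd u.even x = 0 :=
  sub_eq_zero.2 (rowSolve_eq_fst (central.body_dx_even hW hu.smooth_even hx)
    (central.body_dx_odd hW hu.smooth_odd hx) _ _ _ _).symm

theorem EqModXi.dolbeaultSub_beltrami_odd (central : u.EqModXi (ident n) W) (hx : x ∈ W) :
    dolbeaultSub u.beltramiFst u.beltramiSnd u.odd x = 0 :=
  sub_eq_zero.2 (rowSolve_eq_snd _ _ _ _ _ (central.body_dtheta_odd hx)).symm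

theorem EqModXi.dolbeaultSub_beltrami_pull (central : u.EqModXi (ident n) W)
    (hu : u.IsSmooth W V) (hW : IsOpen W) (hF : SmoothOn F W) (hx : x ∈ W) :
    dolbeaultSub u.beltramiFst u.beltramiSnd (u.pull F) x = u.pull (dxt F) x := by
  have hu' := central.isSmooth_self hu
  rw [dolbeaultSub,
    hu'.vectorField_pull hW hW hF hx (central.body_dxt_even hW hu.smooth_even hx),
    ← sub_eq_zero.1 (central.dolbeaultSub_beltrami_even hu hW hx),
    ← sub_eq_zero.1 (central.dolbeaultSub_beltrami_odd hx), hu'.dxt_pull hW hW hF hx,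
    central.body_dx_even hW hu.smooth_even hx, map_one, one_smul]
  abel

/-- The factor `c` in `[φ, D] = c D` for the Beltrami form `φ` of a superconformal map `u`: as
`[φ, D] u⁻ = -(∂/∂x̃ - φ) (D u⁻)`, it is `-(∂/∂x̃ - φ) (D u⁻)` divided by `D u⁻`. -/
def beltramiFactor (u : SuperMap n) : SuperFun n := fun x =>
  -dolbeaultSub u.beltramiFst u.beltramiSnd (D u.odd) x * geomInv (D u.odd x)

theorem IsSmooth.smoothOn_beltramiFactor (hu : u.IsSmooth W V) (hW : IsOpen W) :
    SmoothOn u.beltramiFactor W := by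
  have smooth_D := hu.smooth_odd.D hW
  exact SmoothOn.mul ((smooth_D.dxt hW).sub ((hu.smoothOn_beltramiFst hW).vectorField
    (hu.smoothOn_beltramiSnd hW) smooth_D hW)).neg (contDiffOn_geomInv smooth_D)

theorem EqModXi.beltramiFactor_mul_D_odd (central : u.EqModXi (ident n) W) (hx : x ∈ W) :
    u.beltramiFactor x * D u.odd x =
      -dolbeaultSub u.beltramiFst u.beltramiSnd (D u.odd) x := by
  rw [beltramiFactor, mul_assoc, geomInv_mul (central.body_D_odd hx), mul_one]

theorem EqModXi.beltramiFactor_mul_D_even (central : u.EqModXi (ident n) W)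
    (hu : u.IsSmooth W V) (hW : IsOpen W)
    (superconformal : ∀ x ∈ W, D u.even x = D u.odd x * u.odd x) (hx : x ∈ W) :
    u.beltramiFactor x * D u.even x =
      -dolbeaultSub u.beltramiFst u.beltramiSnd (D u.even) x := by
  rw [superconformal x hx, ← mul_assoc, central.beltramiFactor_mul_D_odd hx,
    dolbeaultSub_eqOn hW superconformal hx,
    dolbeaultSub_mul ((hu.smooth_odd.D hW).differentiableAt hW hx)
      (hu.smooth_odd.differentiableAt hW hx) (isEven_D hW hu.smooth_odd hu.isOdd x hx),
    central.dolbeaultSub_beltrami_odd hx, mul_zero, add_zero, neg_mul]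

-- Both sides are vector fields, so it suffices to compare them on the coordinates `u⁺`, `u⁻`.
theorem EqModXi.beltrami_bracket_D (central : u.EqModXi (ident n) W) (hu : u.IsSmooth W V)
    (hW : IsOpen W) (superconformal : ∀ x ∈ W, D u.even x = D u.odd x * u.odd x)
    (hF : SmoothOn F W) (hx : x ∈ W) :
    vectorField u.beltramiFst u.beltramiSnd (D F) x -
      D (vectorField u.beltramiFst u.beltramiSnd F) x = u.beltramiFactor x * D F x := by
  set c := u.beltramiFactor x
  have bracket {F : SuperFun n} (hF : SmoothOn F W) :=
    vectorField_bracket_D hW (hu.smoothOn_beltramiFst hW) (hu.smoothOn_beltramiSnd hW) hF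
      (hu.isEven_beltramiFst hW hx) (hu.isOdd_beltramiSnd hW hx) hx
  have mul_D (F : SuperFun n) : c * D F x = c * theta n * dx F x + c * dtheta F x := by
    rw [D, mul_add, ← mul_assoc]; exact add_comm _ _
  have bracket_even := vectorField_bracket_D_of_dolbeaultSub hW hu.smooth_even
    (fun y hy => central.dolbeaultSub_beltrami_even hu hW hy) hx
  have bracket_odd := vectorField_bracket_D_of_dolbeaultSub hW hu.smooth_odd
    (fun y hy => central.dolbeaultSub_beltrami_odd hy) hx
  rw [bracket hu.smooth_even, ← central.beltramiFactor_mul_D_even hu hW superconformal hx,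
    mul_D] at bracket_even
  rw [bracket hu.smooth_odd, ← central.beltramiFactor_mul_D_odd hx, mul_D] at bracket_odd
  obtain ⟨fst_eq, snd_eq⟩ := row_ext (central.body_dx_even hW hu.smooth_even hx)
    (central.body_dx_odd hW hu.smooth_odd hx) (central.body_dtheta_odd hx) bracket_even bracket_odd
  rw [bracket hF, fst_eq, snd_eq, mul_D]

end SuperMap

namespace SmoothIdentification

open Grassmann

variable {ι C : Type*} [TopologicalSpace C] [ChartedSpace ℂ C]
  {S : SuperRiemannSurface ι C} {n : ℕ} {X : Deformation S n}

theorem central_of_subset (Φ : SmoothIdentification X) {α : ι} {V : Set ℂ} (hV : V ⊆ S.dom α) :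
    (Φ.map α).EqModXi (SuperMap.ident n) V :=
  fun y hy => Φ.central α y (hV hy)

theorem isSmooth_of_subset (Φ : SmoothIdentification X) {α : ι} {V : Set ℂ} (hV : V ⊆ S.dom α) :
    (Φ.map α).IsSmooth V V :=
  (Φ.smooth α).mono hV fun y hy => by rwa [(Φ.central_of_subset hV).base_eq hy]

theorem dolbeaultSub_pull_eq_zero (Φ : SmoothIdentification X) {α β : ι} {v : SuperFun n}
    (smooth : SmoothOn v (S.overlap α β)) (holomorphic : ∀ y ∈ S.overlap α β, dxt v y = 0)
    {x : ℂ} (hx : x ∈ S.overlap α β) :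
    dolbeaultSub (Φ.map α).beltramiFst (Φ.map α).beltramiSnd ((Φ.map α).pull v) x = 0 := by
  have hu := Φ.isSmooth_of_subset (S.overlap_subset α β)
  rw [(Φ.central_of_subset (S.overlap_subset α β)).dolbeaultSub_beltrami_pull hu
      (S.isOpen_overlap α β) smooth hx, pull_apply,
    evalAt_congr (S.isOpen_overlap α β) (H := fun _ => 0) holomorphic (hu.mapsTo hx), evalAt_const]
  simp

variable [IsManifold 𝓘(ℂ) ω C]

-- `w` is a coordinate of `Φ` in the chart `β`; it is annihilated by `∂/∂x̃ - φ_β`, and its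
-- pull-back by `∂/∂x̃ - φ_α`.
theorem vectorField_pull_rho (Φ : SmoothIdentification X) {α β : ι} {v w : SuperFun n}
    (smooth_v : SmoothOn v (S.overlap α β)) (holomorphic : ∀ y ∈ S.overlap α β, dxt v y = 0)
    (smooth_w : SmoothOn w (S.overlap β α))
    (kernel : ∀ y ∈ S.overlap β α,
      dolbeaultSub (Φ.map β).beltramiFst (Φ.map β).beltramiSnd w y = 0)
    (glue : Set.EqOn ((S.rho n α β).pull w) ((Φ.map α).pull v) (S.overlap α β))
    {x : ℂ} (hx : x ∈ S.overlap α β) :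
    vectorField (Φ.map α).beltramiFst (Φ.map α).beltramiSnd ((S.rho n α β).pull w) x =
      (starRingEnd ℂ) (deriv (S.trans α β) x) • (S.rho n α β).pull
        (vectorField (Φ.map β).beltramiFst (Φ.map β).beltramiSnd w) x := by
  have hU := S.isOpen_overlap α β
  have hV := S.isOpen_overlap β α
  have hρ := S.rho_isHolomorphic (n := n) α β
  have pull_kernel := Φ.dolbeaultSub_pull_eq_zero smooth_v holomorphic hx
  rw [← dolbeaultSub_eqOn hU glue hx, dolbeaultSub, sub_eq_zero] at pull_kernel
  have dxt_eq : Set.EqOn (vectorField (Φ.map β).beltramiFst (Φ.map β).beltramiSnd w) (dxt w)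
      (S.overlap β α) := fun y hy => (sub_eq_zero.1 (kernel y hy)).symm
  rw [← pull_kernel, hρ.toIsSmooth.dxt_pull hU hV smooth_w hx, hρ.dxt_even hU hx,
    hρ.dxt_odd hU hx, S.dx_rho_even hx, body_algebraMap, zero_mul, zero_mul, zero_add, add_zero,
    pull_apply, pull_apply, evalAt_congr hV dxt_eq (hρ.mapsTo hx)]

theorem beltrami_rho (Φ : SmoothIdentification X) {α β : ι} {x : ℂ} (hx : x ∈ S.overlap α β) :
    vectorField (Φ.map α).beltramiFst (Φ.map α).beltramiSnd (S.rho n α β).even x =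
        (starRingEnd ℂ) (deriv (S.trans α β) x) • (S.rho n α β).pull (Φ.map β).beltramiFst x ∧
      vectorField (Φ.map α).beltramiFst (Φ.map α).beltramiSnd (S.rho n α β).odd x =
        (starRingEnd ℂ) (deriv (S.trans α β) x) • (S.rho n α β).pull (Φ.map β).beltramiSnd x := by
  have hU := S.isOpen_overlap α β
  have hV := S.isOpen_overlap β α
  have hρ := S.rho_isHolomorphic (n := n) α β
  have hX := X.holomorphic α β
  have central := Φ.central_of_subset (S.overlap_subset β α)
  have hu := Φ.isSmooth_of_subset (S.overlap_subset β α)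
  have pull_body (F : SuperFun n) : ((S.rho n α β).pull F x).body = (F (S.trans α β x)).body := by
    rw [pull_apply, body_evalAt _ _ (hρ.isOdd x hx).body_eq_zero]
    exact congrArg (fun y => (F y).body) (S.rho_base α β x)
  have mem := S.trans_mem hx
  have glue_even := Φ.vectorField_pull_rho hX.smooth_even (fun y => hX.dxt_even hU) hu.smooth_even
    (fun y => central.dolbeaultSub_beltrami_even hu hV) (Φ.glue_even α β) hx
  have glue_odd := Φ.vectorField_pull_rho hX.smooth_odd (fun y => hX.dxt_odd hU) hu.smooth_odd
    (fun y => central.dolbeaultSub_beltrami_odd) (Φ.glue_odd α β) hx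
  have dxt_body : (dxt (S.rho n α β).even x).body = 0 := by rw [hρ.dxt_even hU hx, body_zero]
  rw [hρ.toIsSmooth.vectorField_pull hU hV hu.smooth_even hx dxt_body,
    hρ.toIsSmooth.pull_vectorField hV (hu.smoothOn_beltramiFst hV) (hu.smoothOn_beltramiSnd hV)
      hu.smooth_even hx, smul_add, ← smul_mul_assoc, ← smul_mul_assoc] at glue_even
  rw [hρ.toIsSmooth.vectorField_pull hU hV hu.smooth_odd hx dxt_body,
    hρ.toIsSmooth.pull_vectorField hV (hu.smoothOn_beltramiFst hV) (hu.smoothOn_beltramiSnd hV)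
      hu.smooth_odd hx, smul_add, ← smul_mul_assoc, ← smul_mul_assoc] at glue_odd
  exact row_ext (by rw [pull_body, central.body_dx_even hV hu.smooth_even mem])
    (by rw [pull_body, central.body_dx_odd hV hu.smooth_odd mem])
    (by rw [pull_body, central.body_dtheta_odd mem]) glue_even glue_odd

/-- The Beltrami form of an identification: in each chart it is the vector `(0,1)`-form that
measures the failure of the identification to be holomorphic. -/
def beltramiForm (Φ : SmoothIdentification X) : VectorForm S n where
  a α := (Φ.map α).beltramiFst
  b α := (Φ.map α).beltramiSnd
  smooth_a α := (Φ.smooth α).smoothOn_beltramiFst (S.isOpen_dom α)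
  smooth_b α := (Φ.smooth α).smoothOn_beltramiSnd (S.isOpen_dom α)
  glue α β F hF x hx := by
    have hU := S.isOpen_overlap α β
    have hV := S.isOpen_overlap β α
    have hρ := S.rho_isHolomorphic (n := n) α β
    have hu := Φ.isSmooth_of_subset (S.overlap_subset β α)
    obtain ⟨even_eq, odd_eq⟩ := Φ.beltrami_rho hx
    have dxt_body : (dxt (S.rho n α β).even x).body = 0 := by rw [hρ.dxt_even hU hx, body_zero]
    change vectorField _ _ ((S.rho n α β).pull F) x =
      _ • (S.rho n α β).pull (vectorField _ _ F) x
    rw [hρ.toIsSmooth.vectorField_pull hU hV hF hx dxt_body, even_eq, odd_eq,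
      hρ.toIsSmooth.pull_vectorField hV (hu.smoothOn_beltramiFst hV) (hu.smoothOn_beltramiSnd hV)
        hF hx, smul_add, smul_mul_assoc, smul_mul_assoc]

theorem isEven_beltramiForm (Φ : SmoothIdentification X) : Φ.beltramiForm.IsEven :=
  fun α _ hx => ⟨(Φ.smooth α).isEven_beltramiFst (S.isOpen_dom α) hx,
    (Φ.smooth α).isOdd_beltramiSnd (S.isOpen_dom α) hx⟩

theorem beltramiForm_vanishesModXi (Φ : SmoothIdentification X) : Φ.beltramiForm.VanishesModXi :=
  fun α _ hx => (Φ.central α).beltrami_modXi (Φ.smooth α) (S.isOpen_dom α) hx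

theorem IsSuperconformal.beltramiForm {Φ : SmoothIdentification X} (hΦ : Φ.IsSuperconformal) :
    Φ.beltramiForm.IsSuperconformal := fun α =>
  ⟨(Φ.map α).beltramiFactor, (Φ.smooth α).smoothOn_beltramiFactor (S.isOpen_dom α),
    fun _ hF _ hx => (Φ.central α).beltrami_bracket_D (Φ.smooth α) (S.isOpen_dom α)
      (hΦ α).D_even hF hx⟩

theorem isComplexStructure_perturbedDolbeault (Φ : SmoothIdentification X) :
    Φ.IsComplexStructure (perturbedDolbeault Φ.beltramiForm) := fun _ _ hV hVα _ hF _ hx =>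
  (Φ.central_of_subset hVα).dolbeaultSub_beltrami_pull (Φ.isSmooth_of_subset hVα) hV hF hx

end SmoothIdentification

/-! ### Superconformal extension of sections -/

namespace Grassmann

variable {m n : ℕ}

theorem pow_sub_pow_mem_degreeGE {a b : Grassmann m} {k : ℕ} (h : a - b ∈ degreeGE m k) (j : ℕ) :
    a ^ j - b ^ j ∈ degreeGE m k := by
  induction j with
  | zero => simp
  | succ j ih =>
    have telescope : a ^ (j + 1) - b ^ (j + 1) = a ^ j * (a - b) + (a ^ j - b ^ j) * b := by
      rw [pow_succ, pow_succ]; noncomm_ring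
    rw [telescope]
    exact add_mem (mul_mem_degreeGE_right _ h) (mul_mem_degreeGE_left _ ih)

theorem pow_sub_pow_mem_degreeGE_succ {a b : Grassmann m} {k : ℕ} (ha : a ∈ degreeGE m 1)
    (hb : b ∈ degreeGE m 1) (h : a - b ∈ degreeGE m k) (j : ℕ) :
    a ^ (j + 2) - b ^ (j + 2) ∈ degreeGE m (k + 1) := by
  have telescope : a ^ (j + 2) - b ^ (j + 2) =
      a ^ j * (a * (a - b)) + (a ^ (j + 1) - b ^ (j + 1)) * b := by
    rw [pow_succ, pow_succ, pow_succ b (j + 1)]; noncomm_ring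
  rw [telescope]
  refine add_mem (mul_mem_degreeGE_right _ ?_) (mul_mem_degreeGE (pow_sub_pow_mem_degreeGE h _) hb)
  rw [add_comm]
  exact mul_mem_degreeGE ha h

theorem mul_sub_body_smul_mem_degreeGE {a : Grassmann m} {k : ℕ} (ha : a ∈ degreeGE m k)
    (b : Grassmann m) : a * b - b.body • a ∈ degreeGE m (k + 1) := by
  have factor : a * b - b.body • a = a * (b - algebraMap ℂ _ b.body) := by
    rw [mul_sub, Algebra.algebraMap_eq_smul_one, mul_smul_comm, mul_one]
  rw [factor]
  exact mul_mem_degreeGE ha (mem_degreeGE_one.2 (by rw [body_sub, body_algebraMap, sub_self]))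

theorem body_sum_smul {κ : Type*} {t : Finset κ} {w : κ → ℂ} (hw : ∑ i ∈ t, w i = 1)
    {f : κ → Grassmann m} {c : ℂ} (hf : ∀ i ∈ t, (f i).body = c) :
    (∑ i ∈ t, w i • f i).body = c := by
  rw [body, sum_apply, ← one_mul c, ← hw, Finset.sum_mul]
  exact Finset.sum_congr rfl fun i hi => congrArg (w i * ·) (hf i hi)

theorem thetaFreeL_sqrt (a : Grassmann (n + 1)) : thetaFreeL (sqrt a) = sqrt (thetaFreeL a) := by
  suffices iter : ∀ k, thetaFreeL (sqrtIter a k) = sqrtIter (thetaFreeL a) k from iter _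
  intro k
  induction k with
  | zero => exact thetaFreeL_one
  | succ k ih => simp only [sqrtIter, map_add, map_smul, map_sub, thetaFreeL_mul, ih]

end Grassmann

theorem sum_smul_sub_eq_sum_smul_sub {R M κ : Type*} [Ring R] [AddCommGroup M] [Module R M]
    {t : Finset κ} {w : κ → R} (hw : ∑ i ∈ t, w i = 1) (f : κ → M) (a : M) :
    ∑ i ∈ t, w i • f i - a = ∑ i ∈ t, w i • (f i - a) := by
  simp only [smul_sub, Finset.sum_sub_distrib, ← Finset.sum_smul, hw, one_smul]

namespace SuperFun

open Grassmann

variable {n : ℕ}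

theorem taylorSum_eq_add_sum (N : Grassmann (n + 1)) (X : ℕ → Grassmann (n + 1)) :
    taylorSum N X = X 0 + N * X 1 +
      ∑ j ∈ Finset.range n, (((j + 2).factorial : ℂ)⁻¹) • (N ^ (j + 2) * X (j + 2)) := by
  rw [taylorSum, Finset.sum_range_succ', Finset.sum_range_succ']
  simp only [zero_add, Nat.factorial_zero, Nat.factorial_one, Nat.cast_one, inv_one, one_smul,
    pow_zero, pow_one, one_mul]
  abel

theorem taylorSum_sub_mem_degreeGE {N N' : Grassmann (n + 1)} {X X' : ℕ → Grassmann (n + 1)}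
    {k : ℕ} (hN : N ∈ degreeGE (n + 1) 1) (hN' : N' ∈ degreeGE (n + 1) 1)
    (hsub : N' - N ∈ degreeGE (n + 1) k) (hX : ∀ j, X' j - X j ∈ degreeGE (n + 1) k) :
    taylorSum N' X' - taylorSum N X - ((X' 0 - X 0) + (X' 1).body • (N' - N)) ∈
      degreeGE (n + 1) (k + 1) := by
  have nilpotent_mul (j : ℕ) : N * (X' j - X j) ∈ degreeGE (n + 1) (k + 1) := by
    rw [add_comm k]; exact mul_mem_degreeGE hN (hX j)
  have linear : (N' - N) * X' 1 - (X' 1).body • (N' - N) + N * (X' 1 - X 1) ∈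
      degreeGE (n + 1) (k + 1) :=
    add_mem (mul_sub_body_smul_mem_degreeGE hsub _) (nilpotent_mul 1)
  have higher (j : ℕ) : N' ^ (j + 2) * X' (j + 2) - N ^ (j + 2) * X (j + 2) ∈
      degreeGE (n + 1) (k + 1) := by
    have split : N' ^ (j + 2) * X' (j + 2) - N ^ (j + 2) * X (j + 2) =
        (N' ^ (j + 2) - N ^ (j + 2)) * X' (j + 2) +
          N ^ (j + 1) * (N * (X' (j + 2) - X (j + 2))) := by
      rw [← mul_assoc, ← pow_succ, sub_mul, mul_sub]; abel
    rw [split]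
    exact add_mem (mul_mem_degreeGE_left _ (pow_sub_pow_mem_degreeGE_succ hN' hN hsub j))
      (mul_mem_degreeGE_right _ (nilpotent_mul _))
  have expand : taylorSum N' X' - taylorSum N X - ((X' 0 - X 0) + (X' 1).body • (N' - N)) =
      ((N' - N) * X' 1 - (X' 1).body • (N' - N) + N * (X' 1 - X 1)) +
      ∑ j ∈ Finset.range n, (((j + 2).factorial : ℂ)⁻¹) •
        (N' ^ (j + 2) * X' (j + 2) - N ^ (j + 2) * X (j + 2)) := by
    simp only [taylorSum_eq_add_sum, smul_sub, Finset.sum_sub_distrib, sub_mul, mul_sub]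
    abel
  rw [expand]
  exact add_mem linear (sum_mem fun j _ => Submodule.smul_mem _ _ (higher j))

theorem evalAt_sub_mem_degreeGE (F : SuperFun n) {g g' ψ ψ' : Grassmann (n + 1)} {k : ℕ}
    (hb : g'.body = g.body) (hψ' : ψ'.body = 0)
    (hg : g' - g ∈ degreeGE (n + 1) k) (hψ : ψ' - ψ ∈ degreeGE (n + 1) k) :
    evalAt F g' ψ' - evalAt F g ψ - ((dx (thetaFree F) g.body).body • (g' - g) +
      (dtheta F g.body).body • (ψ' - ψ)) ∈ degreeGE (n + 1) (k + 1) := by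
  set c := g.body
  let X (η : Grassmann (n + 1)) (j : ℕ) := dx^[j] (thetaFree F) c + η * dx^[j] (dtheta F) c
  have X_sub (j : ℕ) : X ψ' j - X ψ j = (ψ' - ψ) * dx^[j] (dtheta F) c := by
    rw [add_sub_add_left_eq_sub, ← sub_mul]
  have body_X : (X ψ' 1).body = (dx (thetaFree F) c).body := by
    rw [body_add, body_mul, hψ', zero_mul, add_zero, Function.iterate_one]
  have soul_sub : soul g' - soul g = g' - g := by rw [soul, soul, hb, sub_sub_sub_cancel_right]
  have taylor := taylorSum_sub_mem_degreeGE (X := X ψ) (X' := X ψ')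
    (mem_degreeGE_one.2 (body_soul g)) (mem_degreeGE_one.2 (body_soul g')) (soul_sub ▸ hg)
    fun j => X_sub j ▸ mul_mem_degreeGE_left _ hψ
  rw [X_sub, body_X, soul_sub] at taylor
  convert add_mem taylor (mul_sub_body_smul_mem_degreeGE hψ (dtheta F c)) using 1
  rw [evalAt, evalAt, hb, Function.iterate_zero, id]
  abel

-- Modulo higher degree, evaluation is an affine function of the point, so it commutes with
-- averages; this is what lets a partition of unity glue local data one degree at a time.
theorem sum_smul_evalAt_sub_evalAt_sum_mem_degreeGE (F : SuperFun n) {κ : Type*} {t : Finset κ}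
    {w : κ → ℂ} (hw : ∑ i ∈ t, w i = 1) {g ψ : κ → Grassmann (n + 1)} {g₀ ψ₀ : Grassmann (n + 1)}
    {k : ℕ} (hb : ∀ i ∈ t, (g i).body = g₀.body) (hψ : ∀ i ∈ t, (ψ i).body = 0)
    (hg : ∀ i ∈ t, g i - g₀ ∈ degreeGE (n + 1) k) (hd : ∀ i ∈ t, ψ i - ψ₀ ∈ degreeGE (n + 1) k) :
    ∑ i ∈ t, w i • evalAt F (g i) (ψ i) - evalAt F (∑ i ∈ t, w i • g i) (∑ i ∈ t, w i • ψ i) ∈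
      degreeGE (n + 1) (k + 1) := by
  have mean_sub_mem {f : κ → Grassmann (n + 1)} {a : Grassmann (n + 1)}
      (hf : ∀ i ∈ t, f i - a ∈ degreeGE (n + 1) k) :
      ∑ i ∈ t, w i • f i - a ∈ degreeGE (n + 1) k := by
    rw [sum_smul_sub_eq_sum_smul_sub hw]
    exact sum_mem fun i hi => Submodule.smul_mem _ _ (hf i hi)
  have at_mean := evalAt_sub_mem_degreeGE F (body_sum_smul hw hb) (body_sum_smul hw hψ)
    (mean_sub_mem hg) (mean_sub_mem hd)
  have mean_at := sum_mem (t := t) fun i hi => Submodule.smul_mem _ (w i)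
    (evalAt_sub_mem_degreeGE F (hb i hi) (hψ i hi) (hg i hi) (hd i hi))
  have mean_affine (p q : ℂ) : ∑ i ∈ t, w i • (evalAt F (g i) (ψ i) - evalAt F g₀ ψ₀ -
      (p • (g i - g₀) + q • (ψ i - ψ₀))) = (∑ i ∈ t, w i • evalAt F (g i) (ψ i) - evalAt F g₀ ψ₀) -
      (p • (∑ i ∈ t, w i • g i - g₀) + q • (∑ i ∈ t, w i • ψ i - ψ₀)) := by
    rw [sum_smul_sub_eq_sum_smul_sub hw g, sum_smul_sub_eq_sum_smul_sub hw ψ,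
      sum_smul_sub_eq_sum_smul_sub hw fun i => evalAt F (g i) (ψ i), Finset.smul_sum,
      Finset.smul_sum, ← Finset.sum_add_distrib, ← Finset.sum_sub_distrib]
    exact Finset.sum_congr rfl fun i _ => by module
  rw [mean_affine] at mean_at
  have difference := sub_mem mean_at at_mean
  rwa [sub_sub_sub_cancel_right, sub_sub_sub_cancel_right] at difference

variable {O : Set ℂ} {p q p' q' : SuperFun n} {x : ℂ}

theorem thetaFreeL_dx (hO : IsOpen O) (hp : SmoothOn p O)
    (free : ∀ y ∈ O, thetaFreeL (p y) = p y) (hx : x ∈ O) : thetaFreeL (dx p x) = dx p x := by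
  rw [← dx_thetaFree (hp.differentiableAt hO hx), thetaFree_eq]
  exact dx_eqOn hO free hx

theorem D_add_theta_mul (hp : DifferentiableAt ℝ p x) (hq : DifferentiableAt ℝ q x)
    (free : thetaFreeL (p x) = p x) (free' : thetaFreeL (q x) = q x) :
    D (fun y => p y + theta n * q y) x = q x + theta n * dx p x := by
  have theta_mul_self : theta n * theta n = 0 := isOdd_theta.mul_self
  rw [D, dtheta_apply, dthetaL_add_theta_mul free free',
    dx_add hp (differentiableAt_mul (differentiableAt_const _) hq),
    dx_mul (differentiableAt_const _) hq, dx_const, zero_mul, zero_add, mul_add, ← mul_assoc,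
    theta_mul_self, zero_mul, add_zero]

theorem dthetaL_even_eq (hD : D p x = D q x * q x) :
    dthetaL (p x) = dthetaL (q x) * thetaFreeL (q x) := by
  simpa only [D, map_add, thetaFreeL_mul, thetaFreeL_theta_mul, add_zero, dtheta_apply,
    thetaFreeL_dthetaL, thetaFreeL_theta, zero_mul] using congrArg thetaFreeL hD

theorem dthetaL_odd_mul_self (hO : IsOpen O) (hp : SmoothOn p O) (hq : SmoothOn q O)
    (odd : ∀ y ∈ O, (q y).IsOdd) (hx : x ∈ O) (hD : D p x = D q x * q x) :
    dthetaL (q x) * dthetaL (q x) =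
      dx (thetaFree p) x - dx (thetaFree q) x * thetaFreeL (q x) := by
  have coeff := congrArg (fun a => thetaFreeL (dthetaL a)) hD
  simp only [(isEven_D hO hq odd x hx).dthetaL_mul] at coeff
  simp only [D, map_add, thetaFreeL_mul, dtheta_apply, thetaFreeL_dthetaL, dthetaL_dthetaL,
    dthetaL_theta_mul, thetaFreeL_theta, zero_mul, zero_add, add_zero,
    thetaFreeL_thetaFreeL] at coeff
  rw [dx_thetaFree (hp.differentiableAt hO hx), dx_thetaFree (hq.differentiableAt hO hx), coeff,
    add_sub_cancel_left]

-- The superconformality equation determines the even `θ`-derivative from the odd one, and the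
-- odd one up to sign as a square root of data at `θ = 0`.
theorem eqOn_of_thetaFree_eqOn (hO : IsOpen O) (hp : SmoothOn p O) (hq : SmoothOn q O)
    (hp' : SmoothOn p' O) (hq' : SmoothOn q' O) (odd : ∀ y ∈ O, (q y).IsOdd)
    (odd' : ∀ y ∈ O, (q' y).IsOdd) (hD : ∀ y ∈ O, D p y = D q y * q y)
    (hD' : ∀ y ∈ O, D p' y = D q' y * q' y) (heven : Set.EqOn (thetaFree p) (thetaFree p') O)
    (hodd : Set.EqOn (thetaFree q) (thetaFree q') O)
    (hbody : ∀ y ∈ O, (dthetaL (q y)).body = (dthetaL (q' y)).body)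
    (hbody_ne : ∀ y ∈ O, (dthetaL (q y)).body ≠ 0) : Set.EqOn p p' O ∧ Set.EqOn q q' O := by
  have dthetaL_odd : ∀ y ∈ O, dthetaL (q y) = dthetaL (q' y) := fun y hy => by
    refine (odd y hy).dthetaL.eq_of_mul_self_eq ?_ (hbody y hy) (hbody_ne y hy)
    rw [dthetaL_odd_mul_self hO hp hq odd hy (hD y hy),
      dthetaL_odd_mul_self hO hp' hq' odd' hy (hD' y hy), ← thetaFree_apply, ← thetaFree_apply,
      hodd hy, dx_eqOn hO heven hy, dx_eqOn hO hodd hy]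
  have heven_apply : ∀ y ∈ O, thetaFreeL (p y) = thetaFreeL (p' y) := fun y hy => by
    rw [← thetaFree_apply, ← thetaFree_apply, heven hy]
  have hodd_apply : ∀ y ∈ O, thetaFreeL (q y) = thetaFreeL (q' y) := fun y hy => by
    rw [← thetaFree_apply, ← thetaFree_apply, hodd hy]
  refine ⟨fun y hy => ?_, fun y hy => ?_⟩
  · rw [← thetaFreeL_add_theta_mul_dthetaL (p y), ← thetaFreeL_add_theta_mul_dthetaL (p' y),
      heven_apply y hy, dthetaL_even_eq (hD y hy), dthetaL_even_eq (hD' y hy), dthetaL_odd y hy,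
      hodd_apply y hy]
  · rw [← thetaFreeL_add_theta_mul_dthetaL (q y), ← thetaFreeL_add_theta_mul_dthetaL (q' y),
      hodd_apply y hy, dthetaL_odd y hy]

end SuperFun

namespace SuperMap

open Grassmann

variable {n : ℕ} {U V : Set ℂ} {u : SuperMap n}

theorem IsSmooth.D_pull_even_eq (hu : u.IsSmooth U V) (hU : IsOpen U) (hV : IsOpen V) {x : ℂ}
    (hx : x ∈ U) (hb : (dxt u.even x).body = 0) (hD : D u.even x = D u.odd x * u.odd x)
    {p q : SuperFun n} (hp : SmoothOn p V) (hq : SmoothOn q V)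
    (hpq : ∀ y ∈ V, D p y = D q y * q y) :
    D (u.pull p) x = D (u.pull q) x * u.pull q x := by
  rw [hu.D_pull_of_D_even hU hV hx hb hD hp, hu.D_pull_of_D_even hU hV hx hb hD hq, mul_assoc,
    ← hu.pull_mul hV (hq.D hV) hq hx]
  exact congrArg (D u.odd x * ·) (evalAt_congr hV hpq (hu.mapsTo hx) _)

/-- The `θ`-derivative that the odd component of a superconformal map must have if the map
restricts to `(g, ψ)` at `θ = 0` and is the identity modulo the parameters. -/
def sectionSlope (g ψ : SuperFun n) : SuperFun n := fun x => sqrt (dx g x - dx ψ x * ψ x)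

/-- The superconformal map that is the identity modulo the parameters and restricts to `(g, ψ)`
at `θ = 0`. -/
def ofSection (g ψ : SuperFun n) : SuperMap n where
  even := fun x => g x + theta n * (sectionSlope g ψ x * ψ x)
  odd := fun x => ψ x + theta n * sectionSlope g ψ x

/-- A smooth family of points over `W`, with coordinates in the algebra of the parameters, that
lifts the points of `W`. -/
structure IsSection (g ψ : SuperFun n) (W : Set ℂ) : Prop where
  smooth_even : SmoothOn g W
  smooth_odd : SmoothOn ψ W
  isEven : ∀ x ∈ W, (g x).IsEven
  isOdd : ∀ x ∈ W, (ψ x).IsOdd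
  thetaFreeL_even : ∀ x ∈ W, thetaFreeL (g x) = g x
  thetaFreeL_odd : ∀ x ∈ W, thetaFreeL (ψ x) = ψ x
  body_eq : ∀ x ∈ W, (g x).body = x

namespace IsSection

variable {g ψ : SuperFun n} {W : Set ℂ} {x : ℂ}

theorem body_dx (h : IsSection g ψ W) (hW : IsOpen W) (hx : x ∈ W) : (dx g x).body = 1 := by
  have body_eq_coord : ∀ y ∈ W, g y ∅ = algebraMap ℂ (Grassmann (n + 1)) y ∅ := fun y hy =>
    (h.body_eq y hy).trans (body_algebraMap y).symm
  rw [body, dx_apply_congr hW h.smooth_even smoothOn_algebraMap body_eq_coord hx, dx_algebraMap]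
  exact body_one

theorem body_slope_sq (h : IsSection g ψ W) (hW : IsOpen W) (hx : x ∈ W) :
    (dx g x - dx ψ x * ψ x).body = 1 := by
  rw [body_sub, body_mul, (h.isOdd x hx).body_eq_zero, h.body_dx hW hx, mul_zero, sub_zero]

theorem slope_mul_self (h : IsSection g ψ W) (hW : IsOpen W) (hx : x ∈ W) :
    sectionSlope g ψ x * sectionSlope g ψ x = dx g x - dx ψ x * ψ x :=
  sqrt_mul_self (h.body_slope_sq hW hx)

theorem body_slope (h : IsSection g ψ W) (hW : IsOpen W) (hx : x ∈ W) :
    (sectionSlope g ψ x).body = 1 :=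
  body_sqrtIter (h.body_slope_sq hW hx) _

theorem isEven_slope (h : IsSection g ψ W) (hW : IsOpen W) (hx : x ∈ W) :
    (sectionSlope g ψ x).IsEven :=
  IsEven.sqrtIter ((isEven_dx hW h.smooth_even h.isEven x hx).sub
    ((isOdd_dx hW h.smooth_odd h.isOdd x hx).mul (h.isOdd x hx))) _

theorem thetaFreeL_slope (h : IsSection g ψ W) (hW : IsOpen W) (hx : x ∈ W) :
    thetaFreeL (sectionSlope g ψ x) = sectionSlope g ψ x := by
  rw [sectionSlope, thetaFreeL_sqrt, map_sub, thetaFreeL_mul, h.thetaFreeL_odd x hx,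
    thetaFreeL_dx hW h.smooth_even h.thetaFreeL_even hx,
    thetaFreeL_dx hW h.smooth_odd h.thetaFreeL_odd hx]

theorem smoothOn_slope (h : IsSection g ψ W) (hW : IsOpen W) : SmoothOn (sectionSlope g ψ) W :=
  contDiffOn_sqrt ((h.smooth_even.dx hW).sub ((h.smooth_odd.dx hW).mul h.smooth_odd))

theorem thetaFreeL_ofSection_even (h : IsSection g ψ W) (hx : x ∈ W) :
    thetaFreeL ((ofSection g ψ).even x) = g x := by
  simp only [ofSection, map_add, thetaFreeL_theta_mul, add_zero, h.thetaFreeL_even x hx]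

theorem thetaFreeL_ofSection_odd (h : IsSection g ψ W) (hx : x ∈ W) :
    thetaFreeL ((ofSection g ψ).odd x) = ψ x := by
  simp only [ofSection, map_add, thetaFreeL_theta_mul, add_zero, h.thetaFreeL_odd x hx]

theorem dthetaL_ofSection_even (h : IsSection g ψ W) (hW : IsOpen W) (hx : x ∈ W) :
    dthetaL ((ofSection g ψ).even x) = sectionSlope g ψ x * ψ x :=
  dthetaL_add_theta_mul (h.thetaFreeL_even x hx)
    (by rw [thetaFreeL_mul, h.thetaFreeL_slope hW hx, h.thetaFreeL_odd x hx])

theorem dthetaL_ofSection_odd (h : IsSection g ψ W) (hW : IsOpen W) (hx : x ∈ W) :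
    dthetaL ((ofSection g ψ).odd x) = sectionSlope g ψ x :=
  dthetaL_add_theta_mul (h.thetaFreeL_odd x hx) (h.thetaFreeL_slope hW hx)

theorem body_ofSection_even (h : IsSection g ψ W) (hx : x ∈ W) :
    ((ofSection g ψ).even x).body = x := by
  rw [← body_thetaFreeL, h.thetaFreeL_ofSection_even hx, h.body_eq x hx]

theorem isSmooth_ofSection (h : IsSection g ψ W) (hW : IsOpen W) :
    (ofSection g ψ).IsSmooth W W where
  smooth_even := h.smooth_even.add
    ((smoothOn_const _).mul ((h.smoothOn_slope hW).mul h.smooth_odd))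
  smooth_odd := h.smooth_odd.add ((smoothOn_const _).mul (h.smoothOn_slope hW))
  isEven x hx := (h.isEven x hx).add
    (isOdd_theta.mul ((h.isEven_slope hW hx).mul_isOdd (h.isOdd x hx)))
  isOdd x hx := (h.isOdd x hx).add (isOdd_theta.mul_isEven (h.isEven_slope hW hx))
  mapsTo x hx := by rw [base, h.body_ofSection_even hx]; exact hx

theorem eqModXi_ofSection (h : IsSection g ψ W) (hW : IsOpen W) :
    (ofSection g ψ).EqModXi (ident n) W := by
  refine fun x hx => ⟨modXi_iff_body.2 ⟨?_, ?_⟩, modXi_iff_body.2 ⟨?_, ?_⟩⟩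
  · rw [h.body_ofSection_even hx]
    exact (body_algebraMap x).symm
  · rw [h.dthetaL_ofSection_even hW hx, body_mul, (h.isOdd x hx).body_eq_zero, mul_zero]
    simp only [ident, dthetaL_algebraMap, body_zero]
  · rw [((h.isSmooth_ofSection hW).isOdd x hx).body_eq_zero]
    exact isOdd_theta.body_eq_zero.symm
  · rw [h.dthetaL_ofSection_odd hW hx, h.body_slope hW hx]
    simp only [ident, dthetaL_theta, body_one]

theorem D_ofSection_even (h : IsSection g ψ W) (hW : IsOpen W) (hx : x ∈ W) :
    D (ofSection g ψ).even x = sectionSlope g ψ x * ψ x + theta n * dx g x :=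
  D_add_theta_mul (h.smooth_even.differentiableAt hW hx)
    (((h.smoothOn_slope hW).mul h.smooth_odd).differentiableAt hW hx) (h.thetaFreeL_even x hx)
    (by rw [thetaFreeL_mul, h.thetaFreeL_slope hW hx, h.thetaFreeL_odd x hx])

theorem D_ofSection_odd (h : IsSection g ψ W) (hW : IsOpen W) (hx : x ∈ W) :
    D (ofSection g ψ).odd x = sectionSlope g ψ x + theta n * dx ψ x :=
  D_add_theta_mul (h.smooth_odd.differentiableAt hW hx)
    ((h.smoothOn_slope hW).differentiableAt hW hx) (h.thetaFreeL_odd x hx)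
    (h.thetaFreeL_slope hW hx)

theorem D_ofSection (h : IsSection g ψ W) (hW : IsOpen W) (hx : x ∈ W) :
    D (ofSection g ψ).even x = D (ofSection g ψ).odd x * (ofSection g ψ).odd x := by
  have odd_eq : (ofSection g ψ).odd x = ψ x + theta n * sectionSlope g ψ x := rfl
  have dx_g := eq_add_of_sub_eq (h.slope_mul_self hW hx).symm
  rw [h.D_ofSection_even hW hx, h.D_ofSection_odd hW hx, odd_eq, dx_g]
  set l := sectionSlope g ψ x
  have slope_mul_theta : l * (theta n * l) = theta n * (l * l) := by
    rw [← mul_assoc, (h.isEven_slope hW hx).mul_comm, mul_assoc]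
  have cross_term : theta n * dx ψ x * (theta n * l) = 0 := by
    rw [isOdd_theta.mul_eq_neg (isOdd_dx hW h.smooth_odd h.isOdd x hx), neg_mul, mul_assoc,
      ← mul_assoc (theta n), isOdd_theta.mul_self, zero_mul, mul_zero, neg_zero]
  rw [add_mul, mul_add l, mul_add (theta n * dx ψ x), cross_term, slope_mul_theta,
    mul_add (theta n), add_zero, add_assoc, mul_assoc (theta n) (dx ψ x)]

end IsSection

end SuperMap

/-! ### Gluing by a partition of unity -/

theorem contDiffGroupoid_complex_le_real :
    contDiffGroupoid ω 𝓘(ℂ) ≤ contDiffGroupoid ∞ 𝓘(ℝ, ℂ) := by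
  intro e he
  change e ∈ contDiffGroupoid ω 𝓘(ℂ) at he
  change e ∈ contDiffGroupoid ∞ 𝓘(ℝ, ℂ)
  rw [contDiffGroupoid, mem_groupoid_of_pregroupoid] at he ⊢
  have analytic : ContDiffOn ℂ ω e e.source := by simpa [contDiffPregroupoid] using he.1
  have analytic_symm : ContDiffOn ℂ ω e.symm e.target := by simpa [contDiffPregroupoid] using he.2
  constructor
  · simpa [contDiffPregroupoid] using (analytic.restrict_scalars ℝ).of_le le_top
  · simpa [contDiffPregroupoid] using (analytic_symm.restrict_scalars ℝ).of_le le_top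

theorem isManifold_real_of_complex (C : Type*) [TopologicalSpace C] [ChartedSpace ℂ C]
    [IsManifold 𝓘(ℂ) ω C] : IsManifold 𝓘(ℝ, ℂ) ∞ C := by
  have : HasGroupoid C (contDiffGroupoid ∞ 𝓘(ℝ, ℂ)) :=
    ⟨fun he he' => contDiffGroupoid_complex_le_real
      (HasGroupoid.compatible (G := contDiffGroupoid ω 𝓘(ℂ)) he he')⟩
  exact IsManifold.mk' 𝓘(ℝ, ℂ) ∞ C

theorem mem_maximalAtlas_real {C : Type*} [TopologicalSpace C] [ChartedSpace ℂ C]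
    {e : OpenPartialHomeomorph C ℂ} (he : e ∈ IsManifold.maximalAtlas 𝓘(ℂ) ω C) :
    e ∈ IsManifold.maximalAtlas 𝓘(ℝ, ℂ) ∞ C := by
  rw [IsManifold.maximalAtlas, mem_maximalAtlas_iff] at he ⊢
  exact fun e' he' => ⟨contDiffGroupoid_complex_le_real (he e' he').1,
    contDiffGroupoid_complex_le_real (he e' he').2⟩

theorem sum_finsupport_ofReal_eq_one {ι E H M : Type*} [NormedAddCommGroup E] [NormedSpace ℝ E]
    [TopologicalSpace H] {I : ModelWithCorners ℝ E H} [TopologicalSpace M] [ChartedSpace H M]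
    {t : Set M} (f : SmoothPartitionOfUnity ι I M t) {x : M} (hx : x ∈ t) :
    ∑ i ∈ f.finsupport x, (f i x : ℂ) = 1 := by
  rw [← Complex.ofReal_sum, f.sum_finsupport x hx, Complex.ofReal_one]

/-- A point of `ℂ^{1|1}` whose even and odd coordinates lie in the Grassmann algebra. Parity and
independence of `θ` are imposed separately, by `SuperPoint.IsOver`. -/
abbrev SuperPoint (n : ℕ) : Type := Grassmann (n + 1) × Grassmann (n + 1)

namespace SuperPoint

open Grassmann

variable {n : ℕ}

/-- A genuine `𝔸^{0|n}`-valued point of `ℂ^{1|1}` with reduced point `c`: its coordinates have the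
right parities and do not involve `θ`. -/
structure IsOver (p : SuperPoint n) (c : ℂ) : Prop where
  isEven : p.1.IsEven
  isOdd : p.2.IsOdd
  thetaFreeL_fst : thetaFreeL p.1 = p.1
  thetaFreeL_snd : thetaFreeL p.2 = p.2
  body_eq : p.1.body = c

theorem isOver_algebraMap (c : ℂ) : IsOver (n := n) (algebraMap ℂ _ c, 0) c :=
  ⟨isEven_algebraMap _, isOdd_zero, thetaFreeL_algebraMap _, map_zero _, body_algebraMap _⟩

theorem isOver_sum_smul {κ : Type*} {t : Finset κ} {w : κ → ℂ} (hw : ∑ i ∈ t, w i = 1) {c : ℂ}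
    {q : κ → SuperPoint n} (hq : ∀ i ∈ t, (q i).IsOver c) :
    IsOver (∑ i ∈ t, w i • q i) c where
  isEven := by
    simp only [Prod.fst_sum, Prod.smul_fst]
    exact IsEven.sum fun i hi => (hq i hi).isEven.smul _
  isOdd := by
    simp only [Prod.snd_sum, Prod.smul_snd]
    exact IsOdd.sum fun i hi => (hq i hi).isOdd.smul _
  thetaFreeL_fst := by
    simp only [Prod.fst_sum, Prod.smul_fst, map_sum, map_smul]
    exact Finset.sum_congr rfl fun i hi => by rw [(hq i hi).thetaFreeL_fst]
  thetaFreeL_snd := by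
    simp only [Prod.snd_sum, Prod.smul_snd, map_sum, map_smul]
    exact Finset.sum_congr rfl fun i hi => by rw [(hq i hi).thetaFreeL_snd]
  body_eq := by
    simp only [Prod.fst_sum, Prod.smul_fst]
    exact body_sum_smul hw fun i hi => (hq i hi).body_eq

/-- Pairs of coordinates of degree at least `k` in the generators; two points that differ by such
a pair are regarded as equal up to order `k`. -/
def filtration (n k : ℕ) : Submodule ℂ (SuperPoint n) :=
  (degreeGE (n + 1) k).prod (degreeGE (n + 1) k)

theorem mem_filtration {k : ℕ} {p : SuperPoint n} :
    p ∈ filtration n k ↔ p.1 ∈ degreeGE (n + 1) k ∧ p.2 ∈ degreeGE (n + 1) k :=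
  Submodule.mem_prod

theorem IsOver.sub_mem_filtration_one {p q : SuperPoint n} {c : ℂ} (hp : p.IsOver c)
    (hq : q.IsOver c) : p - q ∈ filtration n 1 := by
  refine mem_filtration.2 ⟨mem_degreeGE_one.2 ?_, mem_degreeGE_one.2 ?_⟩
  · rw [Prod.fst_sub, body_sub, hp.body_eq, hq.body_eq, sub_self]
  · rw [Prod.snd_sub, body_sub, hp.isOdd.body_eq_zero, hq.isOdd.body_eq_zero, sub_self]

theorem eq_zero_of_mem_filtration {k : ℕ} (hk : n + 1 < k) {p : SuperPoint n}
    (hp : p ∈ filtration n k) : p = 0 :=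
  Prod.ext (eq_zero_of_mem_degreeGE hk (mem_filtration.1 hp).1)
    (eq_zero_of_mem_degreeGE hk (mem_filtration.1 hp).2)

theorem real_smul_eq_complex_smul (r : ℝ) (p : SuperPoint n) : r • p = (r : ℂ) • p :=
  Prod.ext (real_smul_eq r p.1) (real_smul_eq r p.2)

end SuperPoint

namespace SuperMap

open Grassmann SuperPoint

variable {n : ℕ} {U V W : Set ℂ} {u v w : SuperMap n} {x c : ℂ} {p : SuperPoint n} {F : SuperFun n}

/-- The effect of a map of superdomains on points with Grassmann coordinates. -/
def onPoint (u : SuperMap n) (p : SuperPoint n) : SuperPoint n :=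
  (evalAt u.even p.1 p.2, evalAt u.odd p.1 p.2)

theorem IsSmooth.isOver_onPoint (hu : u.IsSmooth U V) (hU : IsOpen U) (hc : c ∈ U)
    (hp : p.IsOver c) : (u.onPoint p).IsOver (u.base c) := by
  have body_mem : p.1.body ∈ U := by rwa [hp.body_eq]
  refine ⟨isEven_evalAt hU hu.smooth_even hu.isEven body_mem hp.isEven hp.isOdd,
    isOdd_evalAt hU hu.smooth_odd hu.isOdd body_mem hp.isEven hp.isOdd, ?_, ?_, ?_⟩
  · rw [onPoint, thetaFreeL_evalAt hU hu.smooth_even body_mem, hp.thetaFreeL_fst,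
      hp.thetaFreeL_snd]
  · rw [onPoint, thetaFreeL_evalAt hU hu.smooth_odd body_mem, hp.thetaFreeL_fst,
      hp.thetaFreeL_snd]
  · rw [onPoint, body_evalAt _ _ hp.isOdd.body_eq_zero, hp.body_eq, base]

theorem IsSmooth.contDiffAt_onPoint (hu : u.IsSmooth U V) (hU : IsOpen U) (hp : p.1.body ∈ U) :
    ContDiffAt ℝ ∞ u.onPoint p :=
  ((contDiffOn_evalAt hU hu.smooth_even).prodMk (contDiffOn_evalAt hU hu.smooth_odd)).contDiffAt
    ((hU.preimage ((bodyL (n + 1)).continuous.comp continuous_fst)).mem_nhds hp)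

theorem IsHolomorphic.onPoint_onPoint (hu : u.IsHolomorphic U V) (hU : IsOpen U) (hV : IsOpen V)
    (hv : v.IsSmooth V W) (hw : w.IsComp v u U) (hc : c ∈ U) (hp : p.IsOver c) :
    v.onPoint (u.onPoint p) = w.onPoint p := by
  have body_mem : p.1.body ∈ U := by rwa [hp.body_eq]
  rw [onPoint, onPoint, onPoint,
    ← hu.evalAt_pull hU hV hv.smooth_even hp.isEven hp.isOdd body_mem,
    ← hu.evalAt_pull hU hV hv.smooth_odd hp.isEven hp.isOdd body_mem,
    evalAt_congr hU hw.1 body_mem, evalAt_congr hU hw.2 body_mem]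

theorem sum_smul_onPoint_sub_onPoint_sum_mem_filtration (u : SuperMap n) {κ : Type*}
    {t : Finset κ} {r : κ → ℂ} (hr : ∑ i ∈ t, r i = 1) {q : κ → SuperPoint n} {k : ℕ}
    (hq : ∀ i ∈ t, (q i).IsOver c) (hp : p.IsOver c)
    (hsub : ∀ i ∈ t, q i - p ∈ filtration n k) :
    ∑ i ∈ t, r i • u.onPoint (q i) - u.onPoint (∑ i ∈ t, r i • q i) ∈ filtration n (k + 1) := by
  have affine (F : SuperFun n) := sum_smul_evalAt_sub_evalAt_sum_mem_degreeGE F hr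
    (fun i hi => (hq i hi).body_eq.trans hp.body_eq.symm)
    (fun i hi => (hq i hi).isOdd.body_eq_zero)
    (fun i hi => (mem_filtration.1 (hsub i hi)).1) (fun i hi => (mem_filtration.1 (hsub i hi)).2)
  rw [mem_filtration]
  simp only [onPoint, Prod.fst_sub, Prod.snd_sub, Prod.fst_sum, Prod.snd_sum, Prod.smul_fst,
    Prod.smul_snd]
  exact ⟨affine u.even, affine u.odd⟩

theorem IsSmooth.thetaFree_pull (hu : u.IsSmooth U V) (hV : IsOpen V) (hF : SmoothOn F V)
    (hx : x ∈ U) :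
    thetaFree (u.pull F) x = evalAt F (thetaFreeL (u.even x)) (thetaFreeL (u.odd x)) := by
  rw [thetaFree_apply, pull_apply, thetaFreeL_evalAt hV hF (hu.mapsTo hx)]

theorem IsSmooth.body_dthetaL_pull (hu : u.IsSmooth U V) (hV : IsOpen V) (hF : SmoothOn F V)
    (hx : x ∈ U) : (dthetaL (u.pull F x)).body =
      (dthetaL (u.odd x)).body * (dthetaL (F (u.base x))).body := by
  rw [← dtheta_apply, hu.dtheta_pull hV hF hx, body_add, body_mul, body_mul, dtheta_apply,
    (hu.isEven x hx).dthetaL.body_eq_zero, zero_mul, zero_add, dtheta_apply, pull_apply,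
    body_evalAt _ _ (hu.isOdd x hx).body_eq_zero, dtheta_apply, base]

theorem IsSmooth.isOdd_pull (hu : u.IsSmooth U V) (hV : IsOpen V) (hF : SmoothOn F V)
    (odd : ∀ y ∈ V, (F y).IsOdd) (hx : x ∈ U) : (u.pull F x).IsOdd :=
  isOdd_evalAt hV hF odd (hu.mapsTo hx) (hu.isEven x hx) (hu.isOdd x hx)

end SuperMap

namespace SuperRiemannSurface

open Grassmann

variable {ι C : Type*} [TopologicalSpace C] [ChartedSpace ℂ C] (S : SuperRiemannSurface ι C)
  {n : ℕ} {α β γ : ι} {p : C} {x : ℂ}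

theorem chart_mem_overlap (hα : p ∈ (S.chart α).source) (hβ : p ∈ (S.chart β).source) :
    S.chart α p ∈ S.overlap α β := by
  rw [mem_overlap, (S.chart α).left_inv hα]
  exact ⟨(S.chart α).map_source hα, hβ⟩

theorem trans_chart (hα : p ∈ (S.chart α).source) : S.trans α β (S.chart α p) = S.chart β p := by
  rw [trans_apply, (S.chart α).left_inv hα]

theorem trans_mem_overlap (hβ : x ∈ S.overlap α β) (hγ : x ∈ S.overlap α γ) :
    S.trans α β x ∈ S.overlap β γ :=
  S.trans_apply α β x ▸ S.chart_mem_overlap (S.mem_overlap.1 hβ).2 (S.mem_overlap.1 hγ).2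

theorem zeta_ne_zero (hx : x ∈ S.overlap α β) : S.zeta α β x ≠ 0 := by
  have hdom := S.overlap_subset α β hx
  have self_overlap : x ∈ S.overlap α α := S.mem_overlap.2 ⟨hdom, (S.chart α).map_target hdom⟩
  have deriv_self : deriv (S.trans α α) x = 1 := by
    have trans_eq_id : S.trans α α =ᶠ[nhds x] id :=
      Filter.eventuallyEq_of_mem ((S.isOpen_dom α).mem_nhds hdom)
        fun y hy => (S.chart α).right_inv hy
    rw [trans_eq_id.deriv_eq, deriv_id]
  have zeta_self_sq : S.zeta α α x ^ 2 = 1 := (S.zeta_sq α α x self_overlap).trans deriv_self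
  intro zeta_eq_zero
  rw [S.zeta_cocycle α β α x ⟨hx, self_overlap⟩, zeta_eq_zero, mul_zero] at zeta_self_sq
  norm_num at zeta_self_sq

theorem thetaFreeL_rho_even : thetaFreeL ((S.rho n α β).even x) = algebraMap ℂ _ (S.trans α β x) :=
  thetaFreeL_algebraMap _

theorem thetaFreeL_rho_odd : thetaFreeL ((S.rho n α β).odd x) = 0 := by
  rw [rho, map_smul, thetaFreeL_theta, smul_zero]

theorem dthetaL_rho_odd : dthetaL ((S.rho n α β).odd x) = S.zeta α β x • 1 := by
  rw [rho, map_smul, dthetaL_theta]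

theorem body_dthetaL_rho_odd : (dthetaL ((S.rho n α β).odd x)).body = S.zeta α β x := by
  rw [dthetaL_rho_odd, body_smul, body_one, mul_one]

theorem dx_rho_odd (hx : x ∈ S.overlap α β) :
    dx (S.rho n α β).odd x = deriv (S.zeta α β) x • theta n := by
  have hzeta : HasDerivAt (S.zeta α β) (deriv (S.zeta α β) x) x :=
    ((S.zeta_holomorphic α β x hx).differentiableAt
      ((S.isOpen_overlap α β).mem_nhds hx)).hasDerivAt
  have hodd : HasDerivAt (S.rho n α β).odd (deriv (S.zeta α β) x • theta n) x :=
    hzeta.smul_const (theta n)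
  rw [dx_eq_deriv hodd.differentiableAt, hodd.deriv]

theorem D_rho_odd (hx : x ∈ S.overlap α β) : D (S.rho n α β).odd x = S.zeta α β x • 1 := by
  rw [D, dtheta_apply, dthetaL_rho_odd, S.dx_rho_odd hx, mul_smul_comm, isOdd_theta.mul_self,
    smul_zero, add_zero]

/-- The superconformal map in the chart `α` determined by the family of points `s α`. -/
def glueMap (s : ι → C → SuperPoint n) (α : ι) : SuperMap n :=
  SuperMap.ofSection (fun x => (s α ((S.chart α).symm x)).1) fun x => (s α ((S.chart α).symm x)).2

variable [IsManifold 𝓘(ℂ) ω C]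

theorem D_rho_even (hx : x ∈ S.overlap α β) :
    D (S.rho n α β).even x = S.zeta α β x ^ 2 • theta n := by
  have dtheta_even : dtheta (S.rho n α β).even x = 0 := by
    rw [dtheta_apply]; exact dthetaL_algebraMap _
  have deriv_trans : deriv (S.trans α β) x = S.zeta α β x ^ 2 := (S.zeta_sq α β x hx).symm
  rw [D, S.dx_rho_even hx, dtheta_even, zero_add, deriv_trans, Algebra.algebraMap_eq_smul_one,
    mul_smul_comm, mul_one]

theorem D_rho (hx : x ∈ S.overlap α β) :
    D (S.rho n α β).even x = D (S.rho n α β).odd x * (S.rho n α β).odd x := by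
  rw [S.D_rho_even hx, S.D_rho_odd hx, rho, smul_mul_smul_comm, one_mul, sq]

theorem thetaFree_pull_rho {F : SuperFun n} (hF : SmoothOn F (S.overlap β α))
    (hx : x ∈ S.overlap α β) :
    thetaFree ((S.rho n α β).pull F) x = thetaFreeL (F (S.trans α β x)) := by
  rw [(S.rho_isHolomorphic α β).toIsSmooth.thetaFree_pull (S.isOpen_overlap β α) hF hx,
    thetaFreeL_rho_even, thetaFreeL_rho_odd, evalAt_algebraMap, zero_mul, add_zero]

end SuperRiemannSurface

namespace Deformation

open Grassmann SuperPoint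

variable {ι C : Type*} [TopologicalSpace C] [ChartedSpace ℂ C] {S : SuperRiemannSurface ι C}
  {n : ℕ} (X : Deformation S n) {α β γ : ι}

theorem base_transition {x : ℂ} (hx : x ∈ S.overlap α β) :
    (X.transition α β).base x = S.trans α β x :=
  (modXi_iff.1 (X.central α β x hx).1).1.trans (body_algebraMap _)

theorem body_dthetaL_transition_odd {x : ℂ} (hx : x ∈ S.overlap α β) :
    (dthetaL ((X.transition α β).odd x)).body = S.zeta α β x :=
  (modXi_iff_body.1 (X.central α β x hx).2).2.trans S.body_dthetaL_rho_odd

theorem transition_onPoint_transition_onPoint {c : ℂ} (hα : c ∈ S.overlap γ α)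
    (hβ : c ∈ S.overlap γ β) {p : SuperPoint n} (hp : p.IsOver c) :
    (X.transition α β).onPoint ((X.transition γ α).onPoint p) = (X.transition γ β).onPoint p := by
  have hγα := X.holomorphic γ α
  have mapsTo : Set.MapsTo (X.transition γ α).base (S.overlap γ α ∩ S.overlap γ β)
      (S.overlap α β) := fun y hy => by
    rw [X.base_transition hy.1]
    exact S.trans_mem_overlap hy.1 hy.2
  have holomorphic : (X.transition γ α).IsHolomorphic (S.overlap γ α ∩ S.overlap γ β)
      (S.overlap α β) :=
    ⟨hγα.toIsSmooth.mono Set.inter_subset_left mapsTo,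
      hγα.holomorphic_even.mono Set.inter_subset_left,
      hγα.holomorphic_odd.mono Set.inter_subset_left⟩
  exact holomorphic.onPoint_onPoint ((S.isOpen_overlap γ α).inter (S.isOpen_overlap γ β))
    (S.isOpen_overlap α β) (X.holomorphic α β).toIsSmooth (X.cocycle γ α β) ⟨hα, hβ⟩ hp

/-- Smooth families `s α` of points over the charts of the deformation that agree on overlaps, in
the sense of the transition maps of the deformation, up to terms of degree `k`. For `k > n + 1`
this is a smooth section over `C` of the reduction of the deformation modulo `θ`. -/
structure IsCompatible (k : ℕ) (s : ι → C → SuperPoint n) : Prop where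
  smooth : ∀ α, ContMDiffOn 𝓘(ℝ, ℂ) 𝓘(ℝ, SuperPoint n) ∞ (s α) (S.chart α).source
  isOver : ∀ α, ∀ p ∈ (S.chart α).source, (s α p).IsOver (S.chart α p)
  sub_mem : ∀ α β, ∀ p ∈ (S.chart α).source, p ∈ (S.chart β).source →
    s β p - (X.transition α β).onPoint (s α p) ∈ filtration n k

variable {X} {k : ℕ} {s : ι → C → SuperPoint n} {p : C}

theorem isOver_transition_onPoint {q : SuperPoint n} (hα : p ∈ (S.chart α).source)
    (hβ : p ∈ (S.chart β).source) (hq : q.IsOver (S.chart α p)) :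
    ((X.transition α β).onPoint q).IsOver (S.chart β p) := by
  have hp := S.chart_mem_overlap hα hβ
  have isOver_base := (X.holomorphic α β).toIsSmooth.isOver_onPoint (S.isOpen_overlap α β) hp hq
  rwa [X.base_transition hp, S.trans_chart hα] at isOver_base

variable (X) in
theorem exists_isCompatible_one : ∃ s, X.IsCompatible 1 s := by
  refine ⟨fun α p => (algebraMap ℂ _ (S.chart α p), 0), fun α => ?_,
    fun α p _ => isOver_algebraMap _, fun α β p hα hβ => ?_⟩
  · have smooth_inclusion : ContDiffOn ℝ ∞
        (fun c : ℂ => ((algebraMap ℂ (Grassmann (n + 1)) c, 0) : SuperPoint n)) Set.univ :=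
      ContDiffOn.prodMk (smoothOn_algebraMap (V := Set.univ)) contDiffOn_const
    exact (contMDiffOn_iff_contDiffOn.2 smooth_inclusion).comp
      (contMDiffOn_of_mem_maximalAtlas (mem_maximalAtlas_real (S.chart_mem α)))
      fun _ _ => trivial
  · exact (isOver_algebraMap _).sub_mem_filtration_one
      (isOver_transition_onPoint hα hβ (isOver_algebraMap _))

variable (X) in
/-- The average, weighted by a partition of unity `f`, of the families `s γ` carried to the
chart `α` by the transition maps. -/
def average (f : SmoothPartitionOfUnity ι 𝓘(ℝ, ℂ) C Set.univ) (s : ι → C → SuperPoint n) (α : ι)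
    (p : C) : SuperPoint n :=
  ∑ᶠ γ, f γ p • (X.transition γ α).onPoint (s γ p)

section Average

variable {f : SmoothPartitionOfUnity ι 𝓘(ℝ, ℂ) C Set.univ}

theorem average_eq_sum : X.average f s α p =
    ∑ γ ∈ f.finsupport p, (f γ p : ℂ) • (X.transition γ α).onPoint (s γ p) := by
  simp only [← real_smul_eq_complex_smul]
  exact (f.sum_finsupport_smul_eq_finsum p fun γ p => (X.transition γ α).onPoint (s γ p)).symm

theorem mem_source_of_mem_finsupport (hf : f.IsSubordinate fun α => (S.chart α).source)
    (hγ : γ ∈ f.finsupport p) : p ∈ (S.chart γ).source :=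
  hf γ (subset_tsupport _ ((f.mem_finsupport p).1 hγ))

variable (hs : X.IsCompatible k s) (hf : f.IsSubordinate fun α => (S.chart α).source)
include hs hf

theorem IsCompatible.isOver_average (hα : p ∈ (S.chart α).source) :
    (X.average f s α p).IsOver (S.chart α p) := by
  rw [average_eq_sum]
  exact isOver_sum_smul (sum_finsupport_ofReal_eq_one f (Set.mem_univ p)) fun γ hγ =>
    have hpγ := mem_source_of_mem_finsupport hf hγ
    isOver_transition_onPoint hpγ hα (hs.isOver γ p hpγ)

theorem IsCompatible.contMDiffOn_average (α : ι) :
    ContMDiffOn 𝓘(ℝ, ℂ) 𝓘(ℝ, SuperPoint n) ∞ (X.average f s α) (S.chart α).source := by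
  refine fun p hα => ContMDiffAt.contMDiffWithinAt (f.contMDiffAt_finsum fun γ hγ => ?_)
  have hpγ : p ∈ (S.chart γ).source := hf γ hγ
  have body_mem : (s γ p).1.body ∈ S.overlap γ α := by
    rw [(hs.isOver γ p hpγ).body_eq]; exact S.chart_mem_overlap hpγ hα
  exact ((X.holomorphic γ α).toIsSmooth.contDiffAt_onPoint (S.isOpen_overlap γ α)
    body_mem).contMDiffAt.comp p
      ((hs.smooth γ p hpγ).contMDiffAt ((S.chart γ).open_source.mem_nhds hpγ))

theorem IsCompatible.average_sub_mem (hα : p ∈ (S.chart α).source)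
    (hβ : p ∈ (S.chart β).source) :
    X.average f s β p - (X.transition α β).onPoint (X.average f s α p) ∈
      filtration n (k + 1) := by
  have hmem {γ : ι} (hγ : γ ∈ f.finsupport p) := mem_source_of_mem_finsupport hf hγ
  have through_α : ∀ γ ∈ f.finsupport p, (f γ p : ℂ) • (X.transition γ β).onPoint (s γ p) =
      (f γ p : ℂ) • (X.transition α β).onPoint ((X.transition γ α).onPoint (s γ p)) := fun γ hγ =>
    congrArg _ (X.transition_onPoint_transition_onPoint (S.chart_mem_overlap (hmem hγ) hα)
      (S.chart_mem_overlap (hmem hγ) hβ) (hs.isOver γ p (hmem hγ))).symm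
  rw [average_eq_sum, average_eq_sum, Finset.sum_congr rfl through_α]
  refine SuperMap.sum_smul_onPoint_sub_onPoint_sum_mem_filtration _
    (sum_finsupport_ofReal_eq_one f (Set.mem_univ p))
    (fun γ hγ => isOver_transition_onPoint (hmem hγ) hα (hs.isOver γ p (hmem hγ)))
    (hs.isOver α p hα) fun γ hγ => ?_
  rw [← neg_sub]
  exact neg_mem (hs.sub_mem γ α p (hmem hγ) hα)

end Average

section Existence

variable [IsManifold 𝓘(ℂ) ω C] [T2Space C] [SecondCountableTopology C]

theorem IsCompatible.exists_succ (hs : X.IsCompatible k s) : ∃ s', X.IsCompatible (k + 1) s' := by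
  have := isManifold_real_of_complex C
  have : LocallyCompactSpace C := ChartedSpace.locallyCompactSpace ℂ C
  obtain ⟨f, hf⟩ := SmoothPartitionOfUnity.exists_isSubordinate 𝓘(ℝ, ℂ) (isClosed_univ (X := C))
    (fun α => (S.chart α).source) (fun α => (S.chart α).open_source)
    (fun p _ => Set.mem_iUnion.2 (S.cover p))
  exact ⟨X.average f s, hs.contMDiffOn_average hf, fun _ _ => hs.isOver_average hf,
    fun _ _ _ => hs.average_sub_mem hf⟩

variable (X) in
theorem exists_isCompatible (k : ℕ) : ∃ s, X.IsCompatible (k + 1) s := by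
  induction k with
  | zero => exact X.exists_isCompatible_one
  | succ k ih => obtain ⟨s, hs⟩ := ih; exact hs.exists_succ

end Existence

namespace IsCompatible

theorem isSection (hs : X.IsCompatible k s) (α : ι) :
    SuperMap.IsSection (fun x => (s α ((S.chart α).symm x)).1)
      (fun x => (s α ((S.chart α).symm x)).2) (S.dom α) := by
  have smooth : ContDiffOn ℝ ∞ (fun x => s α ((S.chart α).symm x)) (S.dom α) :=
    contMDiffOn_iff_contDiffOn.1 ((hs.smooth α).comp
      (contMDiffOn_symm_of_mem_maximalAtlas (mem_maximalAtlas_real (S.chart_mem α)))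
      fun x hx => (S.chart α).map_target hx)
  have isOver (x) (hx : x ∈ S.dom α) : (s α ((S.chart α).symm x)).IsOver x := by
    have isOver_chart := hs.isOver α _ ((S.chart α).map_target hx)
    rwa [(S.chart α).right_inv hx] at isOver_chart
  exact ⟨contDiff_fst.comp_contDiffOn smooth, contDiff_snd.comp_contDiffOn smooth,
    fun x hx => (isOver x hx).isEven, fun x hx => (isOver x hx).isOdd,
    fun x hx => (isOver x hx).thetaFreeL_fst, fun x hx => (isOver x hx).thetaFreeL_snd,
    fun x hx => (isOver x hx).body_eq⟩

theorem eq_transition_onPoint (hs : X.IsCompatible k s) (hk : n + 1 < k) {x : ℂ}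
    (hx : x ∈ S.overlap α β) : s β ((S.chart β).symm (S.trans α β x)) =
      (X.transition α β).onPoint (s α ((S.chart α).symm x)) := by
  have mem := S.mem_overlap.1 hx
  rw [S.trans_apply, (S.chart β).left_inv mem.2]
  exact sub_eq_zero.1 (eq_zero_of_mem_filtration hk
    (hs.sub_mem α β _ ((S.chart α).map_target mem.1) mem.2))

variable (hs : X.IsCompatible k s)
include hs

theorem isSmooth_glueMap (α : ι) : (S.glueMap s α).IsSmooth (S.dom α) (S.dom α) :=
  (hs.isSection α).isSmooth_ofSection (S.isOpen_dom α)

theorem eqModXi_glueMap (α : ι) : (S.glueMap s α).EqModXi (SuperMap.ident n) (S.dom α) :=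
  (hs.isSection α).eqModXi_ofSection (S.isOpen_dom α)

theorem D_glueMap (α : ι) : ∀ x ∈ S.dom α,
    D (S.glueMap s α).even x = D (S.glueMap s α).odd x * (S.glueMap s α).odd x := fun _ hx =>
  (hs.isSection α).D_ofSection (S.isOpen_dom α) hx

theorem body_dxt_glueMap (α : ι) : ∀ x ∈ S.dom α, (dxt (S.glueMap s α).even x).body = 0 :=
  fun _ hx => (hs.eqModXi_glueMap α).body_dxt_even (S.isOpen_dom α)
    (hs.isSmooth_glueMap α).smooth_even hx

theorem body_dthetaL_glueMap_odd {x : ℂ} (hx : x ∈ S.dom α) :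
    (dthetaL ((S.glueMap s α).odd x)).body = 1 := by
  rw [← dtheta_apply, (hs.eqModXi_glueMap α).body_dtheta_odd hx]

theorem isSuperconformal_glueMap (α : ι) :
    (S.glueMap s α).IsSuperconformal (S.dom α) (S.dom α) :=
  (hs.isSmooth_glueMap α).isSuperconformal (S.isOpen_dom α) (S.isOpen_dom α)
    (hs.body_dxt_glueMap α) (hs.D_glueMap α) fun x hx => by
      rw [hs.body_dthetaL_glueMap_odd hx]; exact one_ne_zero

theorem isSmooth_glueMap_overlap (α β : ι) :
    (S.glueMap s α).IsSmooth (S.overlap α β) (S.overlap α β) :=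
  (hs.isSmooth_glueMap α).mono (S.overlap_subset α β) fun x hx => by
    rwa [(hs.eqModXi_glueMap α).base_eq (S.overlap_subset α β hx)]

theorem thetaFree_glueMap_pull {F : SuperFun n} (hF : SmoothOn F (S.overlap α β)) {x : ℂ}
    (hx : x ∈ S.overlap α β) : thetaFree ((S.glueMap s α).pull F) x =
      evalAt F (s α ((S.chart α).symm x)).1 (s α ((S.chart α).symm x)).2 := by
  have hdom := S.overlap_subset α β hx
  rw [(hs.isSmooth_glueMap_overlap α β).thetaFree_pull (S.isOpen_overlap α β) hF hx,
    SuperRiemannSurface.glueMap, (hs.isSection α).thetaFreeL_ofSection_even hdom,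
    (hs.isSection α).thetaFreeL_ofSection_odd hdom]

theorem body_dthetaL_glueMap_pull_transition {x : ℂ} (hx : x ∈ S.overlap α β) :
    (dthetaL ((S.glueMap s α).pull (X.transition α β).odd x)).body = S.zeta α β x := by
  have hdom := S.overlap_subset α β hx
  rw [(hs.isSmooth_glueMap_overlap α β).body_dthetaL_pull (S.isOpen_overlap α β)
    (X.holomorphic α β).smooth_odd hx, hs.body_dthetaL_glueMap_odd hdom, one_mul,
    (hs.eqModXi_glueMap α).base_eq hdom, X.body_dthetaL_transition_odd hx]

variable [IsManifold 𝓘(ℂ) ω C]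

theorem body_dthetaL_rho_pull_glueMap {x : ℂ} (hx : x ∈ S.overlap α β) :
    (dthetaL ((S.rho n α β).pull (S.glueMap s β).odd x)).body = S.zeta α β x := by
  have hρ := (S.rho_isHolomorphic (n := n) α β).toIsSmooth
  have base_mem := S.overlap_subset β α (hρ.mapsTo hx)
  rw [hρ.body_dthetaL_pull (S.isOpen_overlap β α) (hs.isSmooth_glueMap_overlap β α).smooth_odd hx,
    S.body_dthetaL_rho_odd, hs.body_dthetaL_glueMap_odd base_mem, mul_one]

theorem thetaFree_rho_pull_glueMap (hk : n + 1 < k) (α β : ι) :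
    Set.EqOn (thetaFree ((S.rho n α β).pull (S.glueMap s β).even))
        (thetaFree ((S.glueMap s α).pull (X.transition α β).even)) (S.overlap α β) ∧
      Set.EqOn (thetaFree ((S.rho n α β).pull (S.glueMap s β).odd))
        (thetaFree ((S.glueMap s α).pull (X.transition α β).odd)) (S.overlap α β) := by
  have smooth := hs.isSmooth_glueMap_overlap β α
  have trans_mem {x : ℂ} (hx : x ∈ S.overlap α β) := S.overlap_subset β α (S.trans_mem hx)
  refine ⟨fun x hx => ?_, fun x hx => ?_⟩
  · rw [S.thetaFree_pull_rho smooth.smooth_even hx,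
      hs.thetaFree_glueMap_pull (X.holomorphic α β).smooth_even hx, SuperRiemannSurface.glueMap,
      (hs.isSection β).thetaFreeL_ofSection_even (trans_mem hx), hs.eq_transition_onPoint hk hx]
    rfl
  · rw [S.thetaFree_pull_rho smooth.smooth_odd hx,
      hs.thetaFree_glueMap_pull (X.holomorphic α β).smooth_odd hx, SuperRiemannSurface.glueMap,
      (hs.isSection β).thetaFreeL_ofSection_odd (trans_mem hx), hs.eq_transition_onPoint hk hx]
    rfl

theorem rho_pull_glueMap_eqOn (hk : n + 1 < k) (α β : ι) :
    Set.EqOn ((S.rho n α β).pull (S.glueMap s β).even)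
        ((S.glueMap s α).pull (X.transition α β).even) (S.overlap α β) ∧
      Set.EqOn ((S.rho n α β).pull (S.glueMap s β).odd)
        ((S.glueMap s α).pull (X.transition α β).odd) (S.overlap α β) := by
  have hU := S.isOpen_overlap α β
  have hV := S.isOpen_overlap β α
  have hρ := S.rho_isHolomorphic (n := n) α β
  have hϑ := (X.holomorphic α β).toIsSmooth
  have hα := hs.isSmooth_glueMap_overlap α β
  have hβ := hs.isSmooth_glueMap_overlap β α
  have hthetaFree := hs.thetaFree_rho_pull_glueMap hk α β
  exact eqOn_of_thetaFree_eqOn hU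
    (hρ.smoothOn_pull hV hβ.smooth_even) (hρ.smoothOn_pull hV hβ.smooth_odd)
    (hα.smoothOn_pull hU hϑ.smooth_even) (hα.smoothOn_pull hU hϑ.smooth_odd)
    (fun _ hx => hρ.isOdd_pull hV hβ.smooth_odd hβ.isOdd hx)
    (fun _ hx => hα.isOdd_pull hU hϑ.smooth_odd hϑ.isOdd hx)
    (fun _ hx => hρ.D_pull_even_eq hU hV hx (by rw [hρ.dxt_even hU hx, body_zero]) (S.D_rho hx)
      hβ.smooth_even hβ.smooth_odd fun y hy => hs.D_glueMap β y (S.overlap_subset β α hy))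
    (fun x hx => hα.D_pull_even_eq hU hU hx (hs.body_dxt_glueMap α x (S.overlap_subset α β hx))
      (hs.D_glueMap α x (S.overlap_subset α β hx)) hϑ.smooth_even hϑ.smooth_odd
      (X.superconformal α β).D_even)
    hthetaFree.1 hthetaFree.2
    (fun _ hx => (hs.body_dthetaL_rho_pull_glueMap hx).trans
      (hs.body_dthetaL_glueMap_pull_transition hx).symm)
    fun _ hx => (hs.body_dthetaL_rho_pull_glueMap hx).trans_ne (S.zeta_ne_zero hx)

/-- The identification whose local maps are the superconformal extensions of a family of points
that is compatible up to a degree in which the Grassmann algebra vanishes. -/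
def identification (hk : n + 1 < k) : SmoothIdentification X where
  map := S.glueMap s
  smooth := hs.isSmooth_glueMap
  central := hs.eqModXi_glueMap
  glue_even α β := (hs.rho_pull_glueMap_eqOn hk α β).1
  glue_odd α β := (hs.rho_pull_glueMap_eqOn hk α β).2

end IsCompatible

theorem exists_superconformal_identification [IsManifold 𝓘(ℂ) ω C] [T2Space C]
    [SecondCountableTopology C] (X : Deformation S n) :
    ∃ Φ : SmoothIdentification X, Φ.IsSuperconformal := by
  obtain ⟨s, hs⟩ := X.exists_isCompatible (n + 1)
  exact ⟨hs.identification (by lia), hs.isSuperconformal_glueMap⟩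

end Deformation

end

theorem mainTheorem6 {ι C : Type*} [TopologicalSpace C] [ChartedSpace ℂ C]
    [IsManifold 𝓘(ℂ) ω C] [T2Space C] [SecondCountableTopology C]
    (S : SuperRiemannSurface ι C) (n : ℕ) (X : Deformation S n) :
    (∃ Φ : SmoothIdentification X, Φ.IsSuperconformal) ∧
    ∀ Φ : SmoothIdentification X, ∃ φ : VectorForm S n,
      φ.IsEven ∧ φ.VanishesModXi ∧ (Φ.IsSuperconformal → φ.IsSuperconformal) ∧
      Φ.IsComplexStructure (perturbedDolbeault φ) :=
  ⟨X.exists_superconformal_identification, fun Φ =>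
    ⟨Φ.beltramiForm, Φ.isEven_beltramiForm, Φ.beltramiForm_vanishesModXi,
      SmoothIdentification.IsSuperconformal.beltramiForm, Φ.isComplexStructure_perturbedDolbeault⟩⟩
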